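/- \textbf{Setting.} Let $M$ be a non-empty smooth 6-manifold with a global smooth coframe $h^1,\dots,h^6$ (for example a Lie group with a left-invariant coframe). Any coframe $x^1,\dots,x^6$ of $M$ determines an $\mathrm{SU}(3)$-structure for which it is adapted, $$\omega=x^{12}+x^{34}+x^{56},\quad \psi_+=x^{135}-x^{146}-x^{236}-x^{245},\quad \psi_-=-x^{246}+x^{235}+x^{145}+x^{136},$$ whose metric and orientation make $x^1,\dots,x^6$ orthonormal and positive. It is \emph{balanced} if $d\psi_+=d\psi_-=0$ and $d\omega=\nu_3$ with $\nu_3\wedge\omega=0$, $\nu_3\wedge\psi_\pm=0$. Assume that the structure with adapted coframe $h$ is balanced. Let $J\subseteq\mathbb R$ be an open interval with $0\in J$, let $f,f_1,\dots,f_6$ be differentiable nowhere vanishing real functions on $J$ with $f_i(0)=1$ ($f$ is constant on $M$ for each $t$), put $x^i(t)=f_i(t)h^i$, and let $(\omega(t),\psi_\pm(t))$ be the $\mathrm{SU}(3)$-structure with adapted coframe $x(t)$ and $\nu_3(t)=d\omega(t)$. On $M\times S^1$, with $s$ the angular coordinate of $S^1$, consider the warped $\mathrm{G}_2$-structures $$\varphi(t)=f(t)\,\omega(t)\wedge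 ds-\psi_-(t),$$ with metric $g_t+f(t)^2ds^2$ and volume form $f(t)\,\mathrm{vol}_6(t)\wedge ds$. The Laplacian coflow is $$\frac{\partial}{\partial t}(\ast_t\varphi(t))=-\Delta_t(\ast_t\varphi(t)),\qquad d(\ast_t\varphi(t))=0 \qquad (t\in J),\tag{1}$$ where $\Delta_t$ is the Hodge Laplacian, and the reduced system on $M$ is $$\frac{\partial\omega^2(t)}{\partial t}=2\,d_6(\ast_6\nu_3(t)),\qquad \frac{f'(t)}{f(t)}\psi_+(t)+\frac{\partial\psi_+(t)}{\partial t}=0\qquad (t\in J).\tag{2}$$ Consider the conditions, for all $t\in J$, $$d_6(\ast_6\nu_3(t))=B_{1234}(t)x^{1234}+B_{1256}(t)x^{1256}+B_{3456}(t)x^{3456}$$ with functions $B_{ijkl}$ of $t$ such that $$B_{1234}=2\Big(\frac{f_1'}{f_1}+\frac{f_3'}{f_3}\Big),\quad B_{1256}=2\Big(\frac{f_1'}{f_1}+\frac{f_5'}{f_5}\Big),\quad B_{3456}=2\Big(\frac{f_3'}{f_3}+\frac{f_5'}{f_5}\Big),\tag{3}$$ and $$\frac{f'}{f}+\frac{f_1'}{f_1}+\frac{f_3'}{f_3}+\frac{f_5'}{f_5}=0.\tag{4}$$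 \textbf{Statement.} (a) If $f_{2k}=f_{2k-1}$ on $J$ for $k=1,2,3$, then $\varphi(t)$ solves the coflow (1) if and only if (3) and (4) hold and $(\omega(t),\psi_\pm(t))$ is balanced for all $t\in J$. (b) If $(\omega(t),\psi_\pm(t))$ is balanced for all $t\in J$ (with no assumption relating the $f_i$), then the following are equivalent: $\varphi(t)$ solves the coflow (1); the reduced system (2) holds; $f_{2k}=f_{2k-1}$ on $J$ for $k=1,2,3$ and (3) and (4) hold. -/

import Mathlib

open scoped Manifold ContDiff

namespace WarpedG2

noncomputable section

/-! ### Differential forms on manifolds -/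

section Forms

variable {E : Type*} [NormedAddCommGroup E] [NormedSpace ℝ E] {H : Type*} [TopologicalSpace H]
  {E' : Type*} [NormedAddCommGroup E'] [NormedSpace ℝ E'] {H' : Type*} [TopologicalSpace H']

/-- Differential `k`-forms on the manifold `N` (no smoothness is built in). -/
abbrev DForm (I : ModelWithCorners ℝ E H) (N : Type*) [TopologicalSpace N] [ChartedSpace H N]
    (k : ℕ) : Type _ :=
  ∀ p : N, TangentSpace I p [⋀^Fin k]→L[ℝ] ℝ

variable {I : ModelWithCorners ℝ E H} {N : Type*} [TopologicalSpace N] [ChartedSpace H N]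
  {I' : ModelWithCorners ℝ E' H'} {N' : Type*} [TopologicalSpace N'] [ChartedSpace H' N']
  {k l n : ℕ}

/-- Pullback of a differential form along a map. -/
def DForm.pullback (F : N' → N) (η : DForm I N k) : DForm I' N' k :=
  fun p => (η (F p)).compContinuousLinearMap (mfderiv I' I F p)

/-- The expression of a form in the chart centred at `q`: its pullback along the inverse of the
chart, which is a form on (a part of) the model vector space `E`. -/
def DForm.inChart (η : DForm I N k) (q : N) : E → E [⋀^Fin k]→L[ℝ] ℝ :=
  fun u => (η ((extChartAt I q).symm u)).compContinuousLinearMap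
    (mfderivWithin 𝓘(ℝ, E) I (extChartAt I q).symm (Set.range I) u)

/-- A form is smooth when its expression in every preferred chart is smooth. -/
def DForm.IsSmooth (η : DForm I N k) : Prop :=
  ∀ q : N, ContDiffOn ℝ ∞ (η.inChart q) (extChartAt I q).target

/-- The exterior derivative: at `p`, differentiate the expression of the form in the chart
centred at `p`, and pull the result back along the chart. -/
def DForm.d (η : DForm I N k) : DForm I N (k + 1) :=
  fun p => (extDerivWithin (η.inChart p) (Set.range I) (extChartAt I p p)).compContinuousLinearMap
    (mfderiv I 𝓘(ℝ, E) (extChartAt I p) p)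

/-- The multilinear map `v ↦ α (v₁, …, v_k) * β (v_{k+1}, …, v_{k+l})`. -/
def tensorMul {V : Type*} [AddCommGroup V] [Module ℝ V] [TopologicalSpace V]
    (α : V [⋀^Fin k]→L[ℝ] ℝ) (β : V [⋀^Fin l]→L[ℝ] ℝ) :
    ContinuousMultilinearMap ℝ (fun _ : Fin (k + l) => V) ℝ where
  toFun v := α (fun i => v (Fin.castAdd l i)) * β (fun j => v (Fin.natAdd k j))
  map_update_add' := by
    intro inst m i x y
    obtain rfl : inst = instDecidableEqFin (k + l) := Subsingleton.elim _ _
    refine Fin.addCases (fun a => ?_) (fun b => ?_) i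
    · have h1 : ∀ z : V, (fun i => Function.update m (Fin.castAdd l a) z (Fin.castAdd l i)) =
          Function.update (fun i => m (Fin.castAdd l i)) a z := by
        intro z; ext i; by_cases h : i = a
        · subst h; simp
        · simp [Function.update, h]
      have h2 : ∀ z : V, (fun j => Function.update m (Fin.castAdd l a) z (Fin.natAdd k j)) =
          fun j => m (Fin.natAdd k j) := by
        intro z; ext j
        rw [Function.update_of_ne]
        intro h; have := congrArg Fin.val h; simp at this; omega
      simp only [h1, h2, ContinuousAlternatingMap.map_update_add, add_mul]
    · have h1 : ∀ z : V, (fun j => Function.update m (Fin.natAdd k b) z (Fin.natAdd k j)) =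
          Function.update (fun j => m (Fin.natAdd k j)) b z := by
        intro z; ext j; by_cases h : j = b
        · subst h; simp
        · simp [Function.update, h]
      have h2 : ∀ z : V, (fun i => Function.update m (Fin.natAdd k b) z (Fin.castAdd l i)) =
          fun i => m (Fin.castAdd l i) := by
        intro z; ext j
        rw [Function.update_of_ne]
        intro h; have := congrArg Fin.val h; simp at this; omega
      simp only [h1, h2, ContinuousAlternatingMap.map_update_add, mul_add]
  map_update_smul' := by
    intro inst m i c x
    obtain rfl : inst = instDecidableEqFin (k + l) := Subsingleton.elim _ _
    refine Fin.addCases (fun a => ?_) (fun b => ?_) i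
    · have h1 : ∀ z : V, (fun i => Function.update m (Fin.castAdd l a) z (Fin.castAdd l i)) =
          Function.update (fun i => m (Fin.castAdd l i)) a z := by
        intro z; ext i; by_cases h : i = a
        · subst h; simp
        · simp [Function.update, h]
      have h2 : ∀ z : V, (fun j => Function.update m (Fin.castAdd l a) z (Fin.natAdd k j)) =
          fun j => m (Fin.natAdd k j) := by
        intro z; ext j
        rw [Function.update_of_ne]
        intro h; have := congrArg Fin.val h; simp at this; omega
      simp only [h1, h2, ContinuousAlternatingMap.map_update_smul, smul_eq_mul, mul_assoc]
    · have h1 : ∀ z : V, (fun j => Function.update m (Fin.natAdd k b) z (Fin.natAdd k j)) =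
          Function.update (fun j => m (Fin.natAdd k j)) b z := by
        intro z; ext j; by_cases h : j = b
        · subst h; simp
        · simp [Function.update, h]
      have h2 : ∀ z : V, (fun i => Function.update m (Fin.natAdd k b) z (Fin.castAdd l i)) =
          fun i => m (Fin.castAdd l i) := by
        intro z; ext j
        rw [Function.update_of_ne]
        intro h; have := congrArg Fin.val h; simp at this; omega
      simp only [h1, h2, ContinuousAlternatingMap.map_update_smul, smul_eq_mul, mul_left_comm]
  cont := by
    refine Continuous.mul ?_ ?_
    · exact α.cont.comp (continuous_pi fun i => continuous_apply _)
    · exact β.cont.comp (continuous_pi fun i => continuous_apply _)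

/-- The wedge product, normalised so that `(θ¹ ∧ θ²)(v₁, v₂) = θ¹(v₁) θ²(v₂) - θ¹(v₂) θ²(v₁)`:
`(α ∧ β)(v) = 1/(k! l!) ∑_σ sgn σ · α (v_{σ 1}, …, v_{σ k}) β (v_{σ (k+1)}, …, v_{σ (k+l)})`. -/
def DForm.wedge (α : DForm I N k) (β : DForm I N l) : DForm I N (k + l) :=
  fun p => ((k.factorial : ℝ) * (l.factorial : ℝ))⁻¹ •
    ContinuousMultilinearMap.alternatization (tensorMul (α p) (β p))

/-- A 1-form at a point, seen as a linear functional. -/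
def covector {V : Type*} [AddCommGroup V] [Module ℝ V] [TopologicalSpace V]
    (α : V [⋀^Fin 1]→L[ℝ] ℝ) : V →L[ℝ] ℝ :=
  (ContinuousAlternatingMap.ofSubsingleton ℝ V ℝ (0 : Fin 1)).symm α

/-- The monomial `θ^{K 1} ∧ ⋯ ∧ θ^{K k}` in a family of 1-forms `θ`, that is
`v ↦ det (θ^{K i} (v_j))`. -/
def mono (θ : Fin n → DForm I N 1) (K : Fin k → Fin n) : DForm I N k :=
  fun p => ContinuousMultilinearMap.alternatization
    ((ContinuousMultilinearMap.mkPiAlgebra ℝ (Fin k) ℝ).compContinuousLinearMap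
      (fun i => covector (θ (K i) p)))

/-- The 1-forms `θ` form a coframe: a basis of the cotangent space at each point (the number of
forms being the dimension of the manifold). -/
def IsCoframe (θ : Fin n → DForm I N 1) : Prop :=
  ∀ p, LinearIndependent ℝ (fun i => covector (θ i p))

open Classical in
/-- The frame of tangent vectors dual to a coframe. -/
def dualFrame (θ : Fin n → DForm I N 1) (p : N) : Fin n → TangentSpace I p :=
  if h : ∃ e : Fin n → TangentSpace I p,
      ∀ i j, covector (θ i p) (e j) = if i = j then 1 else 0
  then h.choose else 0

/-- The Hodge star, from `k`-forms to `l`-forms with `k + l = n`, of the metric and the orientation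
for which the coframe `θ` is orthonormal and positive (the metric is `∑ θⁱ ⊗ θⁱ`, the volume form
is `θ^{1 ⋯ n}`). With `e` the dual frame,
`⋆η = 1/(k! l!) ∑_σ sgn σ · η (e_{σ 1}, …, e_{σ k}) θ^{σ (k+1)} ∧ ⋯ ∧ θ^{σ n}`,
the sum being over all permutations; equivalently `⋆ θ^{σ 1 ⋯ σ k} = sgn σ · θ^{σ (k+1) ⋯ σ n}`. -/
def star (θ : Fin n → DForm I N 1) (hn : k + l = n) (η : DForm I N k) : DForm I N l :=
  fun p => ((k.factorial : ℝ) * (l.factorial : ℝ))⁻¹ •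
    ∑ σ : Equiv.Perm (Fin n),
      (((Equiv.Perm.sign σ : ℤ) : ℝ) *
        η p (fun i => dualFrame θ p (σ (Fin.cast hn (Fin.castAdd l i))))) •
      mono θ (fun j => σ (Fin.cast hn (Fin.natAdd k j))) p

/-- The codifferential on `(j+1)`-forms of an `n`-manifold, `(-1)^{n (k + 1) + 1} ⋆ d ⋆` with
`k = j + 1`. -/
def codiff (θ : Fin n → DForm I N 1) {j l : ℕ} (hn : j + 1 + l = n) (η : DForm I N (j + 1)) :
    DForm I N j :=
  ((-1 : ℝ) ^ (n * (j + 2) + 1)) • star θ (by omega) (star θ hn η).d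

/-- The Hodge Laplacian `d d* + d* d`, on forms whose degree is neither `0` nor the dimension. -/
def hodgeLaplacian (θ : Fin n → DForm I N 1) {j l : ℕ} (hn : j + 1 + (l + 1) = n)
    (η : DForm I N (j + 1)) : DForm I N (j + 1) :=
  (codiff θ hn η).d + codiff θ (j := j + 1) (l := l) (by omega) η.d

end Forms

/-! ### `SU(3)`-structures on 6-manifolds, through a global adapted coframe -/

section SU3

variable {M : Type*} [TopologicalSpace M] [ChartedSpace (EuclideanSpace ℝ (Fin 6)) M]

/-- `ω = x¹² + x³⁴ + x⁵⁶`. (Indices start at `0` in the code.) -/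
def omega (x : Fin 6 → DForm (𝓡 6) M 1) : DForm (𝓡 6) M 2 :=
  mono x ![0, 1] + mono x ![2, 3] + mono x ![4, 5]

/-- `ψ₊ = x¹³⁵ - x¹⁴⁶ - x²³⁶ - x²⁴⁵`. -/
def psiPlus (x : Fin 6 → DForm (𝓡 6) M 1) : DForm (𝓡 6) M 3 :=
  mono x ![0, 2, 4] - mono x ![0, 3, 5] - mono x ![1, 2, 5] - mono x ![1, 3, 4]

/-- `ψ₋ = -x²⁴⁶ + x²³⁵ + x¹⁴⁵ + x¹³⁶`. -/
def psiMinus (x : Fin 6 → DForm (𝓡 6) M 1) : DForm (𝓡 6) M 3 :=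
  -mono x ![1, 3, 5] + mono x ![1, 2, 4] + mono x ![0, 3, 4] + mono x ![0, 2, 5]

/-- `γ` lies in the 12-dimensional component `Ω³₁₂` of the 3-forms:
`γ ∧ ω = 0` and `γ ∧ ψ₊ = γ ∧ ψ₋ = 0`. -/
def InOmega312 (x : Fin 6 → DForm (𝓡 6) M 1) (γ : DForm (𝓡 6) M 3) : Prop :=
  γ.wedge (omega x) = 0 ∧ γ.wedge (psiPlus x) = 0 ∧ γ.wedge (psiMinus x) = 0

/-- The `SU(3)`-structure with adapted coframe `x` is balanced: all its torsion forms vanish except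
possibly `ν₃`, that is `dω = ν₃ ∈ Ω³₁₂`, `dψ₊ = 0`, `dψ₋ = 0`. -/
def IsBalanced (x : Fin 6 → DForm (𝓡 6) M 1) : Prop :=
  InOmega312 x (omega x).d ∧ (psiPlus x).d = 0 ∧ (psiMinus x).d = 0

/-- The torsion form `ν₃ = dω` of a balanced `SU(3)`-structure. -/
def nu3 (x : Fin 6 → DForm (𝓡 6) M 1) : DForm (𝓡 6) M 3 := (omega x).d

/-- The 4-form `d₆ ⋆₆ ν₃` of a balanced `SU(3)`-structure. -/
def dStarNu3 (x : Fin 6 → DForm (𝓡 6) M 1) : DForm (𝓡 6) M 4 :=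
  (star x (k := 3) (l := 3) rfl (nu3 x)).d

/-- The diagonal ansatz `xⁱ(t) = fᵢ(t) hⁱ`. -/
def ansatz (h : Fin 6 → DForm (𝓡 6) M 1) (c : Fin 6 → ℝ → ℝ) (t : ℝ) :
    Fin 6 → DForm (𝓡 6) M 1 :=
  fun i => c i t • h i

/-! ### The warped product `M × S¹` -/

/-- The 1-form `ds` on the unit circle, `s` being the angular coordinate: `ds_z(v) = Im (z̄ v)`. -/
def ds : DForm (𝓡 1) Circle 1 :=
  fun z => ContinuousAlternatingMap.ofSubsingleton ℝ (TangentSpace (𝓡 1) z) ℝ (0 : Fin 1)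
    ((Complex.imCLM.comp
      (ContinuousLinearMap.mul ℝ ℂ ((starRingEnd ℂ) (z : ℂ)))).comp
        (mfderiv (𝓡 1) 𝓘(ℝ, ℂ) (fun w : Circle => (w : ℂ)) z))

/-- The model of `M × S¹`. -/
abbrev I7 := (𝓡 6).prod (𝓡 1)

/-- Forms on `M`, seen on `M × S¹`. -/
abbrev fromBase {k : ℕ} (η : DForm (𝓡 6) M k) : DForm I7 (M × Circle) k :=
  η.pullback Prod.fst

/-- The form `ds`, seen on `M × S¹`. -/
abbrev ds7 : DForm I7 (M × Circle) 1 := ds.pullback Prod.snd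

/-- The coframe `(x¹, …, x⁶, f ds)` on `M × S¹`. It is orthonormal and positive for the metric
`g₆ + f² ds²` and the volume form `f vol₆ ∧ ds` of the warped `G₂`-structure. -/
def warpedCoframe (f : ℝ) (x : Fin 6 → DForm (𝓡 6) M 1) : Fin 7 → DForm I7 (M × Circle) 1 :=
  Fin.snoc (n := 6) (α := fun _ => DForm I7 (M × Circle) 1) (fun i => fromBase (x i)) (f • ds7)

/-- The warped `G₂`-structure `φ = f ω ∧ ds - ψ₋`, with constant warping function `f`. -/
def warpedG2 (f : ℝ) (x : Fin 6 → DForm (𝓡 6) M 1) : DForm I7 (M × Circle) 3 :=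
  f • (fromBase (omega x)).wedge ds7 - fromBase (psiMinus x)

/-- `⋆₇ φ` for the warped `G₂`-structure `φ`. -/
def starWarpedG2 (f : ℝ) (x : Fin 6 → DForm (𝓡 6) M 1) : DForm I7 (M × Circle) 4 :=
  star (warpedCoframe f x) (k := 3) (l := 4) rfl (warpedG2 f x)

/-- The family of warped `G₂`-structures `φ(t)` given by `f(t)` and the coframes `x(t)` solves the
Laplacian coflow for `t ∈ J`: `d (⋆φ) = 0` and `∂/∂t (⋆φ) = -Δ_t (⋆φ)`, the star and the Hodge
Laplacian being those of `φ(t)`. -/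
def SolvesLaplacianCoflow (J : Set ℝ) (f : ℝ → ℝ) (x : ℝ → Fin 6 → DForm (𝓡 6) M 1) : Prop :=
  ∀ t ∈ J, (starWarpedG2 (f t) (x t)).d = 0 ∧
    ∀ (p : M × Circle) (v : Fin 4 → TangentSpace I7 p),
      HasDerivAt (fun τ => starWarpedG2 (f τ) (x τ) p v)
        (-(hodgeLaplacian (warpedCoframe (f t) (x t)) (j := 3) (l := 2) rfl
          (starWarpedG2 (f t) (x t)) p v)) t

/-- The system
`∂ω²/∂t = 2 d₆(⋆₆ν₃)`, `(f'/f) ψ₊ + ∂ψ₊/∂t = 0`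
to which the coflow reduces on the base along balanced structures. -/
def SolvesBalancedSystem (J : Set ℝ) (f : ℝ → ℝ) (x : ℝ → Fin 6 → DForm (𝓡 6) M 1) : Prop :=
  ∀ t ∈ J,
    (∀ (p : M) (v : Fin 4 → TangentSpace (𝓡 6) p),
      HasDerivAt (fun τ => (omega (x τ)).wedge (omega (x τ)) p v) (2 * dStarNu3 (x t) p v) t) ∧
    (∀ (p : M) (v : Fin 3 → TangentSpace (𝓡 6) p), ∃ ψ' : ℝ,
      HasDerivAt (fun τ => psiPlus (x τ) p v) ψ' t ∧
        deriv f t / f t * psiPlus (x t) p v + ψ' = 0)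

/-- `d₆(⋆₆ν₃(t)) = B₁₂₃₄(t) x¹²³⁴ + B₁₂₅₆(t) x¹²⁵⁶ + B₃₄₅₆(t) x³⁴⁵⁶` for functions of `t` with
`B₁₂₃₄ = 2 (f₁'/f₁ + f₃'/f₃)`, `B₁₂₅₆ = 2 (f₁'/f₁ + f₅'/f₅)`, `B₃₄₅₆ = 2 (f₃'/f₃ + f₅'/f₅)`,
where `x = x(t)` comes from the diagonal ansatz with the functions `c`. -/
def CoefficientEquations (J : Set ℝ) (h : Fin 6 → DForm (𝓡 6) M 1) (c : Fin 6 → ℝ → ℝ) : Prop :=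
  ∃ B1234 B1256 B3456 : ℝ → ℝ, ∀ t ∈ J,
    dStarNu3 (ansatz h c t) =
      B1234 t • mono (ansatz h c t) ![0, 1, 2, 3] + B1256 t • mono (ansatz h c t) ![0, 1, 4, 5] +
        B3456 t • mono (ansatz h c t) ![2, 3, 4, 5] ∧
    B1234 t = 2 * (deriv (c 0) t / c 0 t + deriv (c 2) t / c 2 t) ∧
    B1256 t = 2 * (deriv (c 0) t / c 0 t + deriv (c 4) t / c 4 t) ∧
    B3456 t = 2 * (deriv (c 2) t / c 2 t + deriv (c 4) t / c 4 t)

/-- The warping function satisfies `f'/f + f₁'/f₁ + f₃'/f₃ + f₅'/f₅ = 0`. -/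
def WarpingEquation (J : Set ℝ) (f : ℝ → ℝ) (c : Fin 6 → ℝ → ℝ) : Prop :=
  ∀ t ∈ J, deriv f t / f t + deriv (c 0) t / c 0 t + deriv (c 2) t / c 2 t +
    deriv (c 4) t / c 4 t = 0

/-- `f₂ = f₁`, `f₄ = f₃` and `f₆ = f₅` on `J`. -/
def PairsAgree (J : Set ℝ) (c : Fin 6 → ℝ → ℝ) : Prop :=
  ∀ t ∈ J, c 1 t = c 0 t ∧ c 3 t = c 2 t ∧ c 5 t = c 4 t

end SU3

end

end WarpedG2

/-! In the orthonormal coframe `(x¹, …, x⁶, f ds)` the dual form is `⋆φ = ½ω² + ψ₊ ∧ f ds`. Along a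
balanced structure `⋆φ` is closed and `dφ = dω ∧ f ds`, because `dψ₋ = 0`. Since `⋆₇(γ ∧ f ds) =
-⋆₆γ` for a 3-form `γ` on the base, and the codifferential on 4-forms in dimension 7 is `+⋆d⋆`, this
gives `Δ⋆φ = d⋆dφ = -d₆⋆₆ν₃` (`hodgeLaplacian_starWarpedG2`). The coflow is then `∂ₜ(½ω²) + ∂ₜ(fψ₊)
∧ ds = d₆⋆₆ν₃`, and separating the terms with and without `ds` gives exactly the reduced system.

Both systems are compared through `CoframeEquations`, their common form in the fixed coframe `h`:
the four coefficients of `fψ₊` are constant in time, and `d₆⋆₆ν₃` is given by the derivatives of the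
three coefficients of `½ω²`. See `solvesLaplacianCoflow_iff` and `solvesBalancedSystem_iff`.

The four constants force the pairs to agree: the `fᵢ` start at 1 and never vanish, so they are
positive on the interval, and the equalities `f₁f₃f₅ = f₁f₄f₆ = f₂f₃f₆ = f₂f₄f₅` then leave only `f₂
= f₁`, `f₄ = f₃`, `f₆ = f₅` (`pairsAgree_of_deriv_eq_zero`). Once the pairs agree, the coframe
equations are (3) and (4) written with logarithmic derivatives
(`coframeEquations_iff_of_pairsAgree`).

In part (a) balancedness is a conclusion. When the pairs agree, `ψ±(t)` are constant multiples on
`M` of `ψ±(0)`, hence closed; closedness of `⋆φ` then gives `dω ∧ ω = 0`, and `dω ∧ ψ± = 0` follows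
by differentiating `ω ∧ ψ± = 0` (`isBalanced_ansatz`).

The remaining work is exterior calculus for the definitions used here: the Leibniz rule, pullback
along the projections of a product, and the Hodge star on monomials. -/

open scoped Manifold ContDiff

namespace WarpedG2

noncomputable section

/-! ### Exterior algebra of one vector space: monomials and wedge products. -/

section Pointwise

variable {V : Type*} [AddCommGroup V] [Module ℝ V] [TopologicalSpace V]
  {W : Type*} [AddCommGroup W] [Module ℝ W] [TopologicalSpace W] {k l n : ℕ}

/-- The exterior product of a family of covectors. -/
def monomial (a : Fin k → V →L[ℝ] ℝ) : V [⋀^Fin k]→L[ℝ] ℝ :=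
  ContinuousMultilinearMap.alternatization
    ((ContinuousMultilinearMap.mkPiAlgebra ℝ (Fin k) ℝ).compContinuousLinearMap a)

/-- The wedge product of alternating maps. -/
def wedgeAt (α : V [⋀^Fin k]→L[ℝ] ℝ) (β : V [⋀^Fin l]→L[ℝ] ℝ) : V [⋀^Fin (k + l)]→L[ℝ] ℝ :=
  ((k.factorial : ℝ) * (l.factorial : ℝ))⁻¹ •
    ContinuousMultilinearMap.alternatization (tensorMul α β)

theorem monomial_apply (a : Fin k → V →L[ℝ] ℝ) (v : Fin k → V) :
    monomial a v = ∑ σ : Equiv.Perm (Fin k), ((Equiv.Perm.sign σ : ℤ) : ℝ) * ∏ i, a i (v (σ i)) := by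
  simp only [monomial, ContinuousMultilinearMap.alternatization_apply_apply, Units.smul_def,
    zsmul_eq_mul]
  rfl

theorem monomial_eq_det (a : Fin k → V →L[ℝ] ℝ) (v : Fin k → V) :
    monomial a v = (Matrix.of fun i j => a i (v j)).det := by
  rw [← Matrix.det_transpose, Matrix.det_apply', monomial_apply]
  rfl

theorem monomial_eq_detRow (a : Fin k → V →L[ℝ] ℝ) (v : Fin k → V) :
    monomial a v = Matrix.detRowAlternating (fun i j => a i (v j)) :=
  monomial_eq_det a v

theorem monomial_comp_perm (a : Fin k → V →L[ℝ] ℝ) (σ : Equiv.Perm (Fin k)) :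
    monomial (a ∘ σ) = ((Equiv.Perm.sign σ : ℤ) : ℝ) • monomial a := by
  ext v
  have := Matrix.detRowAlternating.map_perm (fun i j => a i (v j)) σ
  rw [monomial_eq_detRow, ContinuousAlternatingMap.smul_apply, monomial_eq_detRow]
  rw [Units.smul_def, zsmul_eq_mul] at this
  exact this

theorem monomial_eq_zero_of_not_injective (a : Fin k → V →L[ℝ] ℝ)
    (ha : ¬ Function.Injective a) : monomial a = 0 := by
  ext v
  rw [monomial_eq_detRow]
  refine Matrix.detRowAlternating.map_eq_zero_of_not_injective _ fun h => ha fun i j hij => h ?_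
  simp [hij]

theorem monomial_smul (c : Fin k → ℝ) (a : Fin k → V →L[ℝ] ℝ) :
    monomial (fun i => c i • a i) = (∏ i, c i) • monomial a := by
  ext v
  simp only [monomial_apply, ContinuousAlternatingMap.smul_apply, smul_eq_mul, Finset.mul_sum,
    _root_.smul_apply, Finset.prod_mul_distrib]
  exact Finset.sum_congr rfl fun _ _ => by ring

theorem monomial_compContinuousLinearMap (a : Fin k → V →L[ℝ] ℝ) (L : W →L[ℝ] V) :
    (monomial a).compContinuousLinearMap L = monomial (fun i => (a i).comp L) := by
  ext v
  simp [monomial_apply]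

theorem wedgeAt_apply (α : V [⋀^Fin k]→L[ℝ] ℝ) (β : V [⋀^Fin l]→L[ℝ] ℝ) (v : Fin (k + l) → V) :
    wedgeAt α β v = ((k.factorial : ℝ) * (l.factorial : ℝ))⁻¹ *
      ∑ σ : Equiv.Perm (Fin (k + l)), ((Equiv.Perm.sign σ : ℤ) : ℝ) *
        (α (fun i => v (σ (Fin.castAdd l i))) * β (fun j => v (σ (Fin.natAdd k j)))) := by
  simp only [wedgeAt, ContinuousAlternatingMap.smul_apply, smul_eq_mul,
    ContinuousMultilinearMap.alternatization_apply_apply, Units.smul_def, zsmul_eq_mul]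
  rfl

theorem wedgeAt_add_left (α α' : V [⋀^Fin k]→L[ℝ] ℝ) (β : V [⋀^Fin l]→L[ℝ] ℝ) :
    wedgeAt (α + α') β = wedgeAt α β + wedgeAt α' β := by
  ext v
  simp [wedgeAt_apply, add_mul, mul_add, Finset.sum_add_distrib]

theorem wedgeAt_add_right (α : V [⋀^Fin k]→L[ℝ] ℝ) (β β' : V [⋀^Fin l]→L[ℝ] ℝ) :
    wedgeAt α (β + β') = wedgeAt α β + wedgeAt α β' := by
  ext v
  simp [wedgeAt_apply, mul_add, Finset.sum_add_distrib]

theorem wedgeAt_smul_left (c : ℝ) (α : V [⋀^Fin k]→L[ℝ] ℝ) (β : V [⋀^Fin l]→L[ℝ] ℝ) :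
    wedgeAt (c • α) β = c • wedgeAt α β := by
  ext v
  simp only [wedgeAt_apply, ContinuousAlternatingMap.smul_apply, smul_eq_mul, Finset.mul_sum]
  exact Finset.sum_congr rfl fun _ _ => by ring

theorem wedgeAt_smul_right (c : ℝ) (α : V [⋀^Fin k]→L[ℝ] ℝ) (β : V [⋀^Fin l]→L[ℝ] ℝ) :
    wedgeAt α (c • β) = c • wedgeAt α β := by
  ext v
  simp only [wedgeAt_apply, ContinuousAlternatingMap.smul_apply, smul_eq_mul, Finset.mul_sum]
  exact Finset.sum_congr rfl fun _ _ => by ring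

theorem wedgeAt_compContinuousLinearMap (α : V [⋀^Fin k]→L[ℝ] ℝ) (β : V [⋀^Fin l]→L[ℝ] ℝ)
    (L : W →L[ℝ] V) :
    (wedgeAt α β).compContinuousLinearMap L =
      wedgeAt (α.compContinuousLinearMap L) (β.compContinuousLinearMap L) := by
  ext v
  simp only [ContinuousAlternatingMap.compContinuousLinearMap_apply, wedgeAt_apply]
  rfl

/-- The wedge product as a bilinear map. -/
def wedgeₗ (k l : ℕ) : (V [⋀^Fin k]→L[ℝ] ℝ) →ₗ[ℝ] (V [⋀^Fin l]→L[ℝ] ℝ) →ₗ[ℝ]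
    (V [⋀^Fin (k + l)]→L[ℝ] ℝ) :=
  LinearMap.mk₂ ℝ wedgeAt wedgeAt_add_left wedgeAt_smul_left wedgeAt_add_right
    (fun c α β => wedgeAt_smul_right c α β)

/-- Expanding both determinants gives a sum over pairs of permutations of the two blocks. Each pair
can be absorbed into the outer permutation, so all `k! l!` pairs contribute the same alternating sum
and cancel the normalising factor. -/
theorem wedgeAt_monomial (a : Fin k → V →L[ℝ] ℝ) (b : Fin l → V →L[ℝ] ℝ) :
    wedgeAt (monomial a) (monomial b) = monomial (Fin.append a b) := by
  ext v
  rw [wedgeAt_apply, inv_mul_eq_iff_eq_mul₀ (by positivity)]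
  simp only [monomial_apply]
  -- the embedding of pairs of permutations
  let ε : Equiv.Perm (Fin k) × Equiv.Perm (Fin l) → Equiv.Perm (Fin (k + l)) := fun q =>
    finSumFinEquiv.permCongr (Equiv.Perm.sumCongr q.1 q.2)
  have hl : ∀ q i, ε q (Fin.castAdd l i) = Fin.castAdd l (q.1 i) := by
    intro q i; simp [ε, Equiv.permCongr_apply]
  have hr : ∀ q i, ε q (Fin.natAdd k i) = Fin.natAdd k (q.2 i) := by
    intro q i; simp [ε, Equiv.permCongr_apply]
  have hs : ∀ q, Equiv.Perm.sign (ε q) = Equiv.Perm.sign q.1 * Equiv.Perm.sign q.2 := by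
    intro q; simp [ε]
  have key : ∀ q : Equiv.Perm (Fin k) × Equiv.Perm (Fin l),
      ∑ σ : Equiv.Perm (Fin (k + l)), ((Equiv.Perm.sign σ : ℤ) : ℝ) *
        ((((Equiv.Perm.sign q.1 : ℤ) : ℝ) * ∏ i, a i (v (σ (Fin.castAdd l (q.1 i))))) *
          (((Equiv.Perm.sign q.2 : ℤ) : ℝ) * ∏ i, b i (v (σ (Fin.natAdd k (q.2 i)))))) =
      ∑ σ : Equiv.Perm (Fin (k + l)), ((Equiv.Perm.sign σ : ℤ) : ℝ) *
        ∏ i, Fin.append a b i (v (σ i)) := by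
    intro q
    -- Substituting `σ ↦ σ * ε q` absorbs the inner permutations; their signs are exactly the sign
    -- of `ε q`.
    rw [← Equiv.sum_comp (Equiv.mulRight (ε q)) (fun σ : Equiv.Perm (Fin (k + l)) =>
      ((Equiv.Perm.sign σ : ℤ) : ℝ) * ∏ i, Fin.append a b i (v (σ i)))]
    refine Finset.sum_congr rfl fun σ _ => ?_
    simp only [Equiv.coe_mulRight, Fin.prod_univ_add, Fin.append_left, Fin.append_right,
      Equiv.Perm.mul_apply, hl, hr, Equiv.Perm.sign_mul, hs]
    push_cast
    ring
  have := Finset.sum_congr (rfl : (Finset.univ : Finset (Equiv.Perm (Fin k) × Equiv.Perm (Fin l))) =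
    Finset.univ) (fun q _ => key q)
  rw [Finset.sum_const, Finset.card_univ, Fintype.card_prod, Fintype.card_perm, Fintype.card_perm,
    Fintype.card_fin, Fintype.card_fin, nsmul_eq_mul] at this
  push_cast at this
  rw [← this, Finset.sum_comm]
  refine Finset.sum_congr rfl fun σ _ => ?_
  rw [← Finset.mul_sum, Fintype.sum_prod_type, Finset.sum_mul_sum]

/-- The sum runs over all index maps, not only increasing ones, which avoids choosing
representatives and costs the factor `1 / k!`. Multilinear expansion of `α (v ∘ σ)`, averaged with
signs over all `σ`, turns the products of coordinates into determinants. -/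
theorem eq_sum_monomial {e : Fin n → V} {b : Fin n → V →L[ℝ] ℝ} (hb : ∀ v, v = ∑ j, b j v • e j)
    (α : V [⋀^Fin k]→L[ℝ] ℝ) :
    α = (k.factorial : ℝ)⁻¹ • ∑ K : Fin k → Fin n, α (e ∘ K) • monomial (b ∘ K) := by
  have h1 : ∀ v : Fin k → V, α v = ∑ K : Fin k → Fin n, (∏ i, b (K i) (v i)) * α (e ∘ K) := by
    intro v
    conv_lhs => rw [show v = fun i => ∑ j, b j (v i) • e j from funext fun i => hb (v i)]
    rw [α.map_sum]
    refine Finset.sum_congr rfl fun K _ => ?_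
    rw [α.map_smul_univ (fun i => b (K i) (v i)) (fun i => e (K i))]
    rfl
  ext v
  rw [ContinuousAlternatingMap.smul_apply, ContinuousAlternatingMap.sum_apply, smul_eq_mul,
    eq_inv_mul_iff_mul_eq₀ (by positivity)]
  simp only [ContinuousAlternatingMap.smul_apply, smul_eq_mul, monomial_apply, Finset.mul_sum]
  rw [Finset.sum_comm]
  have h2 : ∀ σ : Equiv.Perm (Fin k), α v = ∑ K : Fin k → Fin n,
      α (e ∘ K) * (((Equiv.Perm.sign σ : ℤ) : ℝ) * ∏ i, (b ∘ K) i (v (σ i))) := by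
    intro σ
    have h3 : α v = ((Equiv.Perm.sign σ : ℤ) : ℝ) * α (v ∘ σ) := by
      have := α.toAlternatingMap.map_perm v σ
      simp only [ContinuousAlternatingMap.coe_toAlternatingMap, Units.smul_def, zsmul_eq_mul] at this
      rw [this, ← mul_assoc, ← Int.cast_mul, ← Units.val_mul, Int.units_mul_self]
      simp
    rw [h3, h1, Finset.mul_sum]
    refine Finset.sum_congr rfl fun K _ => ?_
    simp only [Function.comp_apply]
    ring
  rw [← Finset.sum_congr rfl (fun σ _ => h2 σ), Finset.sum_const, Finset.card_univ,
    Fintype.card_perm, Fintype.card_fin, nsmul_eq_mul]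

/-- Linear maps that agree on the monomials agree. -/
theorem linearMap_ext_monomial {F : Type*} [AddCommGroup F] [Module ℝ F] {e : Fin n → V}
    {b : Fin n → V →L[ℝ] ℝ} (hb : ∀ v, v = ∑ j, b j v • e j)
    {Φ Ψ : (V [⋀^Fin k]→L[ℝ] ℝ) →ₗ[ℝ] F}
    (h : ∀ K : Fin k → Fin n, Φ (monomial (b ∘ K)) = Ψ (monomial (b ∘ K))) : Φ = Ψ := by
  ext α
  rw [eq_sum_monomial hb α]
  simp [map_sum, h]

end Pointwise

/-! ### The Leibniz rule for forms on a vector space. -/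

section Leibniz

variable {E : Type*} [NormedAddCommGroup E] [NormedSpace ℝ E] {k l n : ℕ}

/-- This is Laplace expansion of a determinant along its first row. -/
theorem alternatizeUncurryFin_smulRight (c : E →L[ℝ] ℝ) (a : Fin k → E →L[ℝ] ℝ) :
    ContinuousAlternatingMap.alternatizeUncurryFin (c.smulRight (monomial a)) =
      monomial (Fin.cons c a : Fin (k + 1) → E →L[ℝ] ℝ) := by
  ext v
  rw [ContinuousAlternatingMap.alternatizeUncurryFin_apply, monomial_eq_det,
    Matrix.det_succ_row_zero]
  refine Finset.sum_congr rfl fun i _ => ?_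
  rw [ContinuousLinearMap.smulRight_apply, ContinuousAlternatingMap.smul_apply, monomial_eq_det]
  simp only [zsmul_eq_mul, smul_eq_mul, Matrix.of_apply, Fin.cons_zero]
  push_cast
  rw [mul_assoc]
  rfl

/-- Moving `c` to the front passes it over the `k` covectors of `a`; this is the source of the sign
in the Leibniz rule. -/
theorem monomial_append_cons (c : E →L[ℝ] ℝ) (a : Fin k → E →L[ℝ] ℝ) (b : Fin l → E →L[ℝ] ℝ) :
    monomial (Fin.append a (Fin.cons c b : Fin (l + 1) → E →L[ℝ] ℝ)) =
      (-1 : ℝ) ^ k • monomial (Fin.cons c (Fin.append a b) : Fin (k + l + 1) → E →L[ℝ] ℝ) := by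
  ext v
  let r : Fin (k + l + 1) := ⟨k, by omega⟩
  have h1 : Fin.append a (Fin.cons c b : Fin (l + 1) → E →L[ℝ] ℝ) =
      Fin.insertNth (α := fun _ => E →L[ℝ] ℝ) r c (Fin.append a b) := by
    rw [Fin.eq_insertNth_iff]
    constructor
    · have : r = Fin.natAdd k (0 : Fin (l + 1)) := by ext; simp [r]
      rw [this, Fin.append_right]; rfl
    · ext1 i
      simp only [Fin.removeNth]
      refine Fin.addCases (fun j => ?_) (fun j => ?_) i
      · have : r.succAbove (Fin.castAdd l j) = Fin.castAdd (l + 1) j := by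
          ext; simp [r, Fin.succAbove, Fin.lt_def]
        rw [this, Fin.append_left, Fin.append_left]
      · have : r.succAbove (Fin.natAdd k j) = Fin.natAdd k j.succ := by
          ext; simp [r, Fin.succAbove, Fin.lt_def]; omega
        rw [this, Fin.append_right, Fin.append_right, Fin.cons_succ]
  have h2 := Matrix.detRowAlternating.map_insertNth r (fun j => c (v j))
    (fun i j => Fin.append a b i (v j))
  rw [ContinuousAlternatingMap.smul_apply, monomial_eq_detRow, monomial_eq_detRow, h1]
  have h3 : (fun i j => Fin.insertNth (α := fun _ => E →L[ℝ] ℝ) r c (Fin.append a b) i (v j)) =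
      Fin.insertNth (α := fun _ => Fin (k + l + 1) → ℝ) r (fun j => c (v j))
        (fun i j => Fin.append a b i (v j)) := by
    funext i j
    rcases Fin.eq_self_or_eq_succAbove r i with h | ⟨m, h⟩ <;> subst h <;> simp
  have h4 : (fun i j => (Fin.cons c (Fin.append a b) : Fin (k + l + 1) → E →L[ℝ] ℝ) i (v j)) =
      Matrix.vecCons (fun j => c (v j)) (fun i j => Fin.append a b i (v j)) := by
    funext i j
    refine Fin.cases ?_ (fun m => ?_) i <;> simp
  refine (congrArg _ h3).trans (h2.trans ?_)
  simp only [zsmul_eq_mul, smul_eq_mul]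
  push_cast
  exact congrArg (fun N => (-1 : ℝ) ^ k * Matrix.detRowAlternating N) h4.symm

theorem monomial_append_cons_left (c : E →L[ℝ] ℝ) (a : Fin k → E →L[ℝ] ℝ) (b : Fin l → E →L[ℝ] ℝ)
    (v : Fin (k + l + 1) → E) :
    monomial (Fin.append (Fin.cons c a : Fin (k + 1) → E →L[ℝ] ℝ) b)
        (v ∘ Fin.cast (by omega : k + 1 + l = k + l + 1)) =
      monomial (Fin.cons c (Fin.append a b) : Fin (k + l + 1) → E →L[ℝ] ℝ) v := by
  rw [monomial_eq_det, monomial_eq_det,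
    ← Matrix.det_submatrix_equiv_self (finCongr (by omega : k + 1 + l = k + l + 1))]
  congr 1
  ext i j
  simp [Fin.append_cons]

theorem wedgeAt_sum_left {ι : Type*} (s : Finset ι) (α : ι → E [⋀^Fin k]→L[ℝ] ℝ)
    (β : E [⋀^Fin l]→L[ℝ] ℝ) : wedgeAt (∑ i ∈ s, α i) β = ∑ i ∈ s, wedgeAt (α i) β :=
  map_sum ((wedgeₗ k l).flip β) α s

theorem wedgeAt_sum_right {ι : Type*} (s : Finset ι) (α : E [⋀^Fin k]→L[ℝ] ℝ)
    (β : ι → E [⋀^Fin l]→L[ℝ] ℝ) : wedgeAt α (∑ i ∈ s, β i) = ∑ i ∈ s, wedgeAt α (β i) :=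
  map_sum (wedgeₗ k l α) β s

theorem differentiableAt_apply_const {F : Type*} [NormedAddCommGroup F] [NormedSpace ℝ F]
    {η : F → E [⋀^Fin k]→L[ℝ] ℝ} {x : F} (h : DifferentiableAt ℝ η x) (v : Fin k → E) :
    DifferentiableAt ℝ (fun u => η u v) x := by
  fun_prop

variable [FiniteDimensional ℝ E]

theorem exists_dual_basis (E : Type*) [NormedAddCommGroup E] [NormedSpace ℝ E]
    [FiniteDimensional ℝ E] :
    ∃ (n : ℕ) (e : Fin n → E) (b : Fin n → E →L[ℝ] ℝ), ∀ v, v = ∑ j, b j v • e j := by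
  refine ⟨_, Module.finBasis ℝ E,
    fun j => LinearMap.toContinuousLinearMap ((Module.finBasis ℝ E).coord j), fun v => ?_⟩
  simp [(Module.finBasis ℝ E).sum_repr v]

theorem exists_eq_sum_smulRight_monomial (A : E →L[ℝ] E [⋀^Fin k]→L[ℝ] ℝ) :
    ∃ (ι : Type) (_ : Fintype ι) (c : ι → E →L[ℝ] ℝ) (a : ι → Fin k → E →L[ℝ] ℝ),
      A = ∑ i, (c i).smulRight (monomial (a i)) := by
  obtain ⟨n, e, b, hb⟩ := exists_dual_basis E
  refine ⟨Fin k → Fin n, inferInstance, fun K => (k.factorial : ℝ)⁻¹ •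
    LinearMap.toContinuousLinearMap ⟨⟨fun w => A w (e ∘ K), fun x y => by simp⟩,
      fun m x => by simp⟩, fun K => b ∘ K, ?_⟩
  ext1 w
  rw [eq_sum_monomial hb (A w), _root_.sum_apply, Finset.smul_sum]
  refine Finset.sum_congr rfl fun K _ => ?_
  simp [mul_smul]

theorem exists_eq_sum_monomial (β : E [⋀^Fin k]→L[ℝ] ℝ) :
    ∃ (ι : Type) (_ : Fintype ι) (c : ι → ℝ) (a : ι → Fin k → E →L[ℝ] ℝ),
      β = ∑ i, c i • monomial (a i) := by
  obtain ⟨n, e, b, hb⟩ := exists_dual_basis E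
  refine ⟨Fin k → Fin n, inferInstance, fun K => (k.factorial : ℝ)⁻¹ * β (e ∘ K),
    fun K => b ∘ K, ?_⟩
  conv_lhs => rw [eq_sum_monomial hb β, Finset.smul_sum]
  simp [mul_smul]

/-- Both sides are bilinear in `A` and `β`, so it suffices to take `A = c ⊗ monomial a` and `β` a
monomial, where both become the monomial of `c`, `a` and the factors of `β`. -/
theorem alternatizeUncurryFin_wedgeAt_left (A : E →L[ℝ] E [⋀^Fin k]→L[ℝ] ℝ)
    (β : E [⋀^Fin l]→L[ℝ] ℝ) (v : Fin (k + l + 1) → E) :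
    ∑ i : Fin (k + l + 1), (-1 : ℝ) ^ (i : ℕ) * wedgeAt (A (v i)) β (i.removeNth v) =
      wedgeAt (ContinuousAlternatingMap.alternatizeUncurryFin A) β
        (v ∘ Fin.cast (by omega : k + 1 + l = k + l + 1)) := by
  obtain ⟨ι, _, c, a, rfl⟩ := exists_eq_sum_smulRight_monomial A
  obtain ⟨κ, _, d, b, rfl⟩ := exists_eq_sum_monomial β
  have h1 : ContinuousAlternatingMap.alternatizeUncurryFin
      (∑ i, (c i).smulRight (monomial (a i))) =
      ∑ i, monomial (Fin.cons (c i) (a i) : Fin (k + 1) → E →L[ℝ] ℝ) := by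
    rw [← ContinuousAlternatingMap.alternatizeUncurryFinCLM_apply, map_sum]
    simp only [ContinuousAlternatingMap.alternatizeUncurryFinCLM_apply,
      alternatizeUncurryFin_smulRight]
  rw [h1]
  simp only [_root_.sum_apply, wedgeAt_sum_left, wedgeAt_sum_right, wedgeAt_smul_right,
    ContinuousAlternatingMap.sum_apply, ContinuousAlternatingMap.smul_apply, smul_eq_mul,
    Finset.mul_sum]
  rw [Finset.sum_comm]
  refine Finset.sum_congr rfl fun i _ => ?_
  rw [Finset.sum_comm]
  refine Finset.sum_congr rfl fun j _ => ?_
  rw [wedgeAt_monomial, monomial_append_cons_left, ← alternatizeUncurryFin_smulRight,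
    ContinuousAlternatingMap.alternatizeUncurryFin_apply, Finset.mul_sum]
  refine Finset.sum_congr rfl fun m _ => ?_
  rw [ContinuousLinearMap.smulRight_apply, wedgeAt_smul_left, wedgeAt_monomial,
    ContinuousLinearMap.smulRight_apply]
  simp only [ContinuousAlternatingMap.smul_apply, smul_eq_mul, zsmul_eq_mul]
  push_cast
  ring

theorem alternatizeUncurryFin_wedgeAt_right (α : E [⋀^Fin k]→L[ℝ] ℝ)
    (B : E →L[ℝ] E [⋀^Fin l]→L[ℝ] ℝ) (v : Fin (k + l + 1) → E) :
    ∑ i : Fin (k + l + 1), (-1 : ℝ) ^ (i : ℕ) * wedgeAt α (B (v i)) (i.removeNth v) =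
      (-1 : ℝ) ^ k * wedgeAt α (ContinuousAlternatingMap.alternatizeUncurryFin B) v := by
  obtain ⟨ι, _, c, a, rfl⟩ := exists_eq_sum_smulRight_monomial B
  obtain ⟨κ, _, d, b, rfl⟩ := exists_eq_sum_monomial α
  have h1 : ContinuousAlternatingMap.alternatizeUncurryFin
      (∑ i, (c i).smulRight (monomial (a i))) =
      ∑ i, monomial (Fin.cons (c i) (a i) : Fin (l + 1) → E →L[ℝ] ℝ) := by
    rw [← ContinuousAlternatingMap.alternatizeUncurryFinCLM_apply, map_sum]
    simp only [ContinuousAlternatingMap.alternatizeUncurryFinCLM_apply,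
      alternatizeUncurryFin_smulRight]
  rw [h1]
  simp only [_root_.sum_apply, wedgeAt_sum_left, wedgeAt_sum_right, wedgeAt_smul_left,
    ContinuousAlternatingMap.sum_apply, ContinuousAlternatingMap.smul_apply, smul_eq_mul,
    Finset.mul_sum]
  rw [Finset.sum_comm]
  refine Finset.sum_congr rfl fun i _ => ?_
  rw [Finset.sum_comm]
  refine Finset.sum_congr rfl fun j _ => ?_
  have h4 : wedgeAt (monomial (b j)) (monomial (Fin.cons (c i) (a i) : Fin (l + 1) → E →L[ℝ] ℝ)) v =
      ((-1 : ℝ) ^ k • monomial (Fin.cons (c i) (Fin.append (b j) (a i)) :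
        Fin (k + l + 1) → E →L[ℝ] ℝ)) v := by
    rw [wedgeAt_monomial, ← monomial_append_cons]
  rw [h4, ContinuousAlternatingMap.smul_apply, ← alternatizeUncurryFin_smulRight,
    -- The sign in the statement meets the one from moving the new covector past the factors of `α`,
    -- and the two cancel.
    ContinuousAlternatingMap.alternatizeUncurryFin_apply, smul_eq_mul, mul_left_comm (d j),
    ← mul_assoc ((-1 : ℝ) ^ k), ← pow_add, Even.neg_one_pow ⟨k, rfl⟩, one_mul, Finset.mul_sum]
  refine Finset.sum_congr rfl fun m _ => ?_
  rw [ContinuousLinearMap.smulRight_apply, wedgeAt_smul_right, wedgeAt_monomial,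
    ContinuousLinearMap.smulRight_apply]
  simp only [ContinuousAlternatingMap.smul_apply, smul_eq_mul, zsmul_eq_mul]
  push_cast
  ring

/-- In finite dimension a form is a finite combination of fixed monomials whose coefficients are its
values on basis vectors. -/
theorem differentiableAt_of_apply {F : Type*} [NormedAddCommGroup F] [NormedSpace ℝ F]
    {η : F → E [⋀^Fin k]→L[ℝ] ℝ} {x : F} (h : ∀ v, DifferentiableAt ℝ (fun u => η u v) x) :
    DifferentiableAt ℝ η x := by
  obtain ⟨n, e, b, hb⟩ := exists_dual_basis E
  rw [show η = fun u => (k.factorial : ℝ)⁻¹ • ∑ K : Fin k → Fin n, η u (e ∘ K) • monomial (b ∘ K)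
    from funext fun u => eq_sum_monomial hb (η u)]
  have h' : ∀ K : Fin k → Fin n, DifferentiableAt ℝ (fun u => η u (e ∘ K)) x := fun K => h _
  fun_prop

theorem differentiableAt_monomial {F : Type*} [NormedAddCommGroup F] [NormedSpace ℝ F]
    {a : Fin k → F → E →L[ℝ] ℝ} {x : F} (h : ∀ i w, DifferentiableAt ℝ (fun u => a i u w) x) :
    DifferentiableAt ℝ (fun u => monomial (fun i => a i u)) x := by
  refine differentiableAt_of_apply fun v => ?_
  simp only [monomial_apply]
  fun_prop

theorem differentiableAt_wedgeAt {F : Type*} [NormedAddCommGroup F] [NormedSpace ℝ F]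
    {α : F → E [⋀^Fin k]→L[ℝ] ℝ} {β : F → E [⋀^Fin l]→L[ℝ] ℝ} {x : F}
    (hα : DifferentiableAt ℝ α x) (hβ : DifferentiableAt ℝ β x) :
    DifferentiableAt ℝ (fun u => wedgeAt (α u) (β u)) x := by
  refine differentiableAt_of_apply fun v => ?_
  simp only [wedgeAt_apply]
  refine (DifferentiableAt.fun_sum fun σ _ => DifferentiableAt.const_mul ?_ _).const_mul _
  exact (differentiableAt_apply_const hα _).mul (differentiableAt_apply_const hβ _)

/-- The scalar product rule is applied to each term of the permutation sum defining the wedge. The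
two halves are then recognised by the algebraic identities above. Evaluating on `v` lets the degrees
`k + 1 + l` and `k + l + 1` be matched by a cast of the arguments. -/
theorem extDeriv_wedgeAt {α : E → E [⋀^Fin k]→L[ℝ] ℝ} {β : E → E [⋀^Fin l]→L[ℝ] ℝ} {x : E}
    (hα : DifferentiableAt ℝ α x) (hβ : DifferentiableAt ℝ β x) (v : Fin (k + l + 1) → E) :
    extDeriv (fun u => wedgeAt (α u) (β u)) x v =
      wedgeAt (extDeriv α x) (β x) (v ∘ Fin.cast (by omega : k + 1 + l = k + l + 1)) +
        (-1 : ℝ) ^ k * wedgeAt (α x) (extDeriv β x) v := by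
  rw [extDeriv_apply (differentiableAt_wedgeAt hα hβ), extDeriv, extDeriv,
    ← alternatizeUncurryFin_wedgeAt_left, ← alternatizeUncurryFin_wedgeAt_right,
    ← Finset.sum_add_distrib]
  refine Finset.sum_congr rfl fun i _ => ?_
  have ha : ∀ w, HasFDerivAt (fun u => α u w) (_ : E →L[ℝ] ℝ) x := fun w =>
    (differentiableAt_apply_const hα w).hasFDerivAt
  have hb : ∀ w, HasFDerivAt (fun u => β u w) (_ : E →L[ℝ] ℝ) x := fun w =>
    (differentiableAt_apply_const hβ w).hasFDerivAt
  have h := HasFDerivAt.const_mul (HasFDerivAt.fun_sum (u := Finset.univ)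
    (fun (σ : Equiv.Perm (Fin (k + l))) _ => HasFDerivAt.const_mul
      ((ha (fun j => i.removeNth v (σ (Fin.castAdd l j)))).fun_mul
        (hb (fun j => i.removeNth v (σ (Fin.natAdd k j))))) ((Equiv.Perm.sign σ : ℤ) : ℝ)))
    ((k.factorial : ℝ) * (l.factorial : ℝ))⁻¹
  simp only [wedgeAt_apply]
  rw [h.fderiv, zsmul_eq_mul, ← mul_add, ← mul_add, ← Finset.sum_add_distrib]
  rw [FunLike.coe_smul, Pi.smul_apply, FunLike.coe_sum, Finset.sum_apply, smul_eq_mul]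
  push_cast
  congr 2
  refine Finset.sum_congr rfl fun σ _ => ?_
  simp only [Pi.smul_apply, Pi.add_apply, smul_eq_mul]
  rw [fderiv_continuousAlternatingMap_apply_const_apply hα,
    fderiv_continuousAlternatingMap_apply_const_apply hβ]
  ring

end Leibniz

/-! ### The Hodge star on monomials. -/

section Hodge

variable {V : Type*} [AddCommGroup V] [Module ℝ V] [TopologicalSpace V] {k l n : ℕ}

/-- The Hodge star of alternating maps for a basis `e` with dual basis `b`. -/
def starAt (e : Fin n → V) (b : Fin n → V →L[ℝ] ℝ) (hn : k + l = n) (α : V [⋀^Fin k]→L[ℝ] ℝ) :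
    V [⋀^Fin l]→L[ℝ] ℝ :=
  ((k.factorial : ℝ) * (l.factorial : ℝ))⁻¹ •
    ∑ σ : Equiv.Perm (Fin n),
      (((Equiv.Perm.sign σ : ℤ) : ℝ) * α (fun i => e (σ (Fin.cast hn (Fin.castAdd l i))))) •
      monomial (fun j => b (σ (Fin.cast hn (Fin.natAdd k j))))

/-- The Hodge star as a linear map. -/
def starₗ (e : Fin n → V) (b : Fin n → V →L[ℝ] ℝ) (hn : k + l = n) :
    (V [⋀^Fin k]→L[ℝ] ℝ) →ₗ[ℝ] (V [⋀^Fin l]→L[ℝ] ℝ) where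
  toFun := starAt e b hn
  map_add' α β := by
    simp [starAt, mul_add, add_smul, Finset.sum_add_distrib]
  map_smul' c α := by
    simp only [starAt, ContinuousAlternatingMap.smul_apply, smul_eq_mul, RingHom.id_apply]
    rw [smul_comm, Finset.smul_sum (r := c)]
    congr 1
    refine Finset.sum_congr rfl fun σ _ => ?_
    rw [smul_smul, mul_left_comm]

/-- The permutation of `Fin (k + l)` acting by `q.1` on the first and by `q.2` on the second
block. -/
def blockPerm (q : Equiv.Perm (Fin k) × Equiv.Perm (Fin l)) : Equiv.Perm (Fin (k + l)) :=
  finSumFinEquiv.permCongr (Equiv.Perm.sumCongr q.1 q.2)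

theorem blockPerm_castAdd (q : Equiv.Perm (Fin k) × Equiv.Perm (Fin l)) (i : Fin k) :
    blockPerm q (Fin.castAdd l i) = Fin.castAdd l (q.1 i) := by
  simp [blockPerm, Equiv.permCongr_apply]

theorem blockPerm_natAdd (q : Equiv.Perm (Fin k) × Equiv.Perm (Fin l)) (i : Fin l) :
    blockPerm q (Fin.natAdd k i) = Fin.natAdd k (q.2 i) := by
  simp [blockPerm, Equiv.permCongr_apply]

theorem sign_blockPerm (q : Equiv.Perm (Fin k) × Equiv.Perm (Fin l)) :
    Equiv.Perm.sign (blockPerm q) = Equiv.Perm.sign q.1 * Equiv.Perm.sign q.2 := by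
  simp [blockPerm]

theorem blockPerm_injective :
    Function.Injective (blockPerm : Equiv.Perm (Fin k) × Equiv.Perm (Fin l) → _) :=
  (Equiv.injective _).comp Equiv.Perm.sumCongrHom_injective

theorem mem_range_blockPerm {τ : Equiv.Perm (Fin (k + l))}
    (h : ∀ i : Fin k, ∃ j : Fin k, τ (Fin.castAdd l i) = Fin.castAdd l j) :
    τ ∈ Set.range (blockPerm : Equiv.Perm (Fin k) × Equiv.Perm (Fin l) → _) := by
  obtain ⟨q, hq⟩ := Equiv.Perm.mem_sumCongrHom_range_of_perm_mapsTo_inl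
    (σ := finSumFinEquiv.symm.permCongr τ) (by
      rintro _ ⟨i, rfl⟩
      obtain ⟨j, hj⟩ := h i
      exact ⟨j, by simp [Equiv.permCongr_apply, hj]⟩)
  refine ⟨q, ?_⟩
  have : blockPerm q = finSumFinEquiv.permCongr (Equiv.Perm.sumCongrHom (Fin k) (Fin l) q) := rfl
  rw [this, hq]
  ext i
  simp [Equiv.permCongr_apply]

theorem sign_mul_self_cast {m : ℕ} (τ : Equiv.Perm (Fin m)) :
    ((Equiv.Perm.sign τ : ℤ) : ℝ) * ((Equiv.Perm.sign τ : ℤ) : ℝ) = 1 := by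
  rw [← Int.cast_mul, ← Units.val_mul, Int.units_mul_self]
  simp

/-- Writing the summation variable as `σ₀ * τ`, a term vanishes unless `τ` preserves the first
block. The surviving `τ` are the `k! l!` block permutations. Each of them contributes the same
amount, since the sign of each block occurs twice. -/
theorem starAt_monomial_comp_perm {e : Fin n → V} {b : Fin n → V →L[ℝ] ℝ}
    (hb : ∀ i j, b i (e j) = if i = j then 1 else 0) (hn : k + l = n)
    (σ₀ : Equiv.Perm (Fin n)) :
    starAt e b hn (monomial (fun i => b (σ₀ (Fin.cast hn (Fin.castAdd l i))))) =
      ((Equiv.Perm.sign σ₀ : ℤ) : ℝ) •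
        monomial (fun j => b (σ₀ (Fin.cast hn (Fin.natAdd k j)))) := by
  subst hn
  simp only [Fin.cast_eq_self]
  rw [starAt, inv_smul_eq_iff₀ (by positivity)]
  simp only [Fin.cast_eq_self]
  rw [← Equiv.sum_comp (Equiv.mulLeft σ₀)]
  rw [← Fintype.sum_of_injective (blockPerm : Equiv.Perm (Fin k) × Equiv.Perm (Fin l) → _)
    blockPerm_injective (fun _ => ((Equiv.Perm.sign σ₀ : ℤ) : ℝ) •
        monomial (fun j => b (σ₀ (Fin.natAdd k j)))) _ ?_ ?_]
  · rw [Finset.sum_const, Finset.card_univ, Fintype.card_prod, Fintype.card_perm,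
      Fintype.card_perm, Fintype.card_fin, Fintype.card_fin, ← Nat.cast_smul_eq_nsmul ℝ]
    push_cast
    rfl
  · intro τ hτ
    have : ∃ i : Fin k, ∀ j : Fin k, τ (Fin.castAdd l i) ≠ Fin.castAdd l j := by
      by_contra! h
      exact hτ (mem_range_blockPerm h)
    obtain ⟨i, hi⟩ := this
    have h0 : monomial (fun i => b (σ₀ (Fin.castAdd l i)))
        (fun i => e (σ₀ (τ (Fin.castAdd l i)))) = 0 := by
      rw [monomial_apply]
      refine Finset.sum_eq_zero fun ρ _ => ?_
      rw [Finset.prod_eq_zero (Finset.mem_univ (ρ.symm i)), mul_zero]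
      rw [hb, if_neg]
      intro h
      refine hi (ρ.symm i) ?_
      simpa using (σ₀.injective h).symm
    simp [Equiv.Perm.mul_apply, h0]
  · rintro ⟨q₁, q₂⟩
    simp only [Equiv.coe_mulLeft, Equiv.Perm.mul_apply, blockPerm_castAdd, blockPerm_natAdd,
      Equiv.Perm.sign_mul, sign_blockPerm]
    have h1 : monomial (fun i => b (σ₀ (Fin.castAdd l i)))
        (fun i => e (σ₀ (Fin.castAdd l (q₁ i)))) = ((Equiv.Perm.sign q₁ : ℤ) : ℝ) := by
      rw [monomial_apply, Finset.sum_eq_single q₁.symm]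
      · simp [hb]
      · intro ρ _ hρ
        have : ∃ i, q₁ (ρ i) ≠ i := by
          by_contra! h
          exact hρ (Equiv.ext fun i => by rw [Equiv.eq_symm_apply, h])
        obtain ⟨i, hi⟩ := this
        rw [Finset.prod_eq_zero (Finset.mem_univ i), mul_zero]
        rw [hb, if_neg]
        intro h
        exact hi (by simpa using (σ₀.injective h).symm)
      · simp
    have h2 : monomial (fun j => b (σ₀ (Fin.natAdd k (q₂ j)))) =
        ((Equiv.Perm.sign q₂ : ℤ) : ℝ) • monomial (fun j => b (σ₀ (Fin.natAdd k j))) :=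
      monomial_comp_perm (fun j => b (σ₀ (Fin.natAdd k j))) q₂
    rw [h1, h2, smul_smul]
    congr 1
    push_cast
    linear_combination (-((Equiv.Perm.sign σ₀ : ℤ) : ℝ)) *
      (sign_mul_self_cast q₁ * ((Equiv.Perm.sign q₂ : ℤ) : ℝ) ^ 2 + sign_mul_self_cast q₂)

end Hodge

/-! ### Coframes and their dual frames. -/

section Coframe

variable {E : Type*} [NormedAddCommGroup E] [NormedSpace ℝ E] {H : Type*} [TopologicalSpace H]
  {I : ModelWithCorners ℝ E H} {N : Type*} [TopologicalSpace N] [ChartedSpace H N] {k l n : ℕ}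

theorem star_apply_eq_starAt (θ : Fin n → DForm I N 1) (hn : k + l = n) (η : DForm I N k) (p : N) :
    star θ hn η p = starAt (dualFrame θ p) (fun i => covector (θ i p)) hn (η p) := rfl

theorem mono_apply_eq (θ : Fin n → DForm I N 1) (K : Fin k → Fin n) (p : N) :
    mono θ K p = monomial (fun i => covector (θ (K i) p)) := rfl

theorem wedge_apply_eq (α : DForm I N k) (β : DForm I N l) (p : N) :
    α.wedge β p = wedgeAt (α p) (β p) := rfl

variable [FiniteDimensional ℝ E]

/-- By dimension the `b i` form a basis of the dual space; its coordinate functionals live in the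
bidual and are brought back to `E` by the evaluation isomorphism. -/
theorem exists_dual_family {b : Fin n → E →L[ℝ] ℝ} (hb : LinearIndependent ℝ b)
    (hE : Module.finrank ℝ E = n) :
    ∃ e : Fin n → E, ∀ i j, b i (e j) = if i = j then 1 else 0 := by
  have hli : LinearIndependent ℝ (fun i => (b i : E →ₗ[ℝ] ℝ)) :=
    hb.map' (ContinuousLinearMap.coeLM ℝ)
      (LinearMap.ker_eq_bot.2 ContinuousLinearMap.coe_injective)
  let B : Module.Basis (Fin n) ℝ (Module.Dual ℝ E) :=
    basisOfLinearIndependentOfCardEqFinrank' _ hli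
      (by rw [Fintype.card_fin, Subspace.dual_finrank_eq, hE])
  refine ⟨fun j => (Module.evalEquiv ℝ E).symm (B.coord j), fun i j => ?_⟩
  have h1 : (b i : E →ₗ[ℝ] ℝ) ((Module.evalEquiv ℝ E).symm (B.coord j)) = B.coord j (B i) := by
    rw [Module.apply_evalEquiv_symm_apply]
    simp [B]
  refine h1.trans ?_
  simp [Finsupp.single_apply]

theorem eq_sum_of_dual {b : Fin n → E →L[ℝ] ℝ} {e : Fin n → E}
    (hb : ∀ i j, b i (e j) = if i = j then 1 else 0) (hE : Module.finrank ℝ E = n) (v : E) :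
    v = ∑ j, b j v • e j := by
  have hli : LinearIndependent ℝ e := by
    rw [Fintype.linearIndependent_iff]
    intro g hg i
    simpa [map_sum, hb] using congrArg (b i) hg
  let B := basisOfLinearIndependentOfCardEqFinrank' e hli (by simp [hE])
  have hB : ∀ j, B j = e j := fun j => by simp [B]
  have h1 : ∀ i, b i v = B.repr v i := by
    intro i
    have h2 : (b i : E →ₗ[ℝ] ℝ) = B.coord i := by
      refine B.ext fun j => ?_
      rw [B.coord_apply, B.repr_self, hB]
      exact (hb i j).trans (by simp [Finsupp.single_apply, eq_comm])
    exact DFunLike.congr_fun h2 v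
  conv_lhs => rw [← B.sum_repr v]
  simp [h1, hB]

theorem covector_dualFrame {θ : Fin n → DForm I N 1} (hθ : IsCoframe θ)
    (hE : Module.finrank ℝ E = n) (p : N) (i j : Fin n) :
    covector (θ i p) (dualFrame θ p j) = if i = j then 1 else 0 := by
  have hex : ∃ e : Fin n → TangentSpace I p,
      ∀ i j, covector (θ i p) (e j) = if i = j then 1 else 0 :=
    exists_dual_family (E := E) (hθ p) hE
  rw [dualFrame, dif_pos hex]
  exact hex.choose_spec i j

theorem eq_sum_covector_smul_dualFrame {θ : Fin n → DForm I N 1} (hθ : IsCoframe θ)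
    (hE : Module.finrank ℝ E = n) (p : N) (v : TangentSpace I p) :
    v = ∑ j, covector (θ j p) v • dualFrame θ p j :=
  eq_sum_of_dual (E := E) (covector_dualFrame hθ hE p) hE v

end Coframe

/-! ### The exterior derivative on a manifold, read in charts. -/

section ExteriorDerivative

variable {E : Type*} [NormedAddCommGroup E] [NormedSpace ℝ E] {H : Type*} [TopologicalSpace H]
  {I : ModelWithCorners ℝ E H} {N : Type*} [TopologicalSpace N] [ChartedSpace H N] {k l n : ℕ}

theorem inChart_wedge (α : DForm I N k) (β : DForm I N l) (q : N) :
    (α.wedge β).inChart q = fun u => wedgeAt (α.inChart q u) (β.inChart q u) :=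
  funext fun _ => wedgeAt_compContinuousLinearMap _ _ _

theorem covector_compContinuousLinearMap {V W : Type*} [AddCommGroup V] [Module ℝ V]
    [TopologicalSpace V] [AddCommGroup W] [Module ℝ W] [TopologicalSpace W]
    (α : V [⋀^Fin 1]→L[ℝ] ℝ) (L : W →L[ℝ] V) :
    covector (α.compContinuousLinearMap L) = (covector α).comp L := by
  ext w
  simp only [covector, ContinuousLinearMap.comp_apply]
  rfl

theorem covector_apply {V : Type*} [AddCommGroup V] [Module ℝ V]
    [TopologicalSpace V] (α : V [⋀^Fin 1]→L[ℝ] ℝ) (v : V) : covector α v = α (fun _ => v) :=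
  rfl

theorem inChart_mono (θ : Fin n → DForm I N 1) (K : Fin k → Fin n) (q : N) :
    (mono θ K).inChart q = fun u => monomial (fun i => covector ((θ (K i)).inChart q u)) := by
  funext u
  refine (monomial_compContinuousLinearMap _ _).trans ?_
  congr 1

/-- A form is differentiable at `p` when its expression in the chart centred at `p` is. -/
def DForm.DiffAt (η : DForm I N k) (p : N) : Prop :=
  DifferentiableAt ℝ (η.inChart p) (extChartAt I p p)

theorem DForm.DiffAt.add {α β : DForm I N k} {p : N} (hα : α.DiffAt p) (hβ : β.DiffAt p) :
    (α + β).DiffAt p :=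
  DifferentiableAt.add hα hβ

theorem DForm.DiffAt.const_smul {α : DForm I N k} {p : N} (hα : α.DiffAt p) (c : ℝ) :
    (c • α).DiffAt p :=
  DifferentiableAt.const_smul hα c

theorem DForm.DiffAt.neg {α : DForm I N k} {p : N} (hα : α.DiffAt p) : (-α).DiffAt p :=
  DifferentiableAt.neg hα

theorem DForm.DiffAt.sub {α β : DForm I N k} {p : N} (hα : α.DiffAt p) (hβ : β.DiffAt p) :
    (α - β).DiffAt p :=
  DifferentiableAt.sub hα hβ

section

variable [FiniteDimensional ℝ E]

theorem DForm.DiffAt.wedge {α : DForm I N k} {β : DForm I N l} {p : N} (hα : α.DiffAt p)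
    (hβ : β.DiffAt p) : (α.wedge β).DiffAt p := by
  rw [DForm.DiffAt, inChart_wedge]
  exact differentiableAt_wedgeAt hα hβ

theorem diffAt_mono {θ : Fin n → DForm I N 1} {p : N} (hθ : ∀ i, (θ i).DiffAt p)
    (K : Fin k → Fin n) : (mono θ K).DiffAt p := by
  rw [DForm.DiffAt, inChart_mono]
  exact differentiableAt_monomial fun i w => differentiableAt_apply_const (hθ (K i)) fun _ => w

end

theorem DForm.IsSmooth.diffAt [I.Boundaryless] {η : DForm I N k} (h : η.IsSmooth) (p : N) : η.DiffAt p :=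
  ((h p).contDiffAt (extChartAt_target_mem_nhds p)).differentiableAt (by simp)

variable [IsManifold I 1 N]

/-- The tangent space at `p` is identified with `E` through the chart centred at `p`, so the
derivative of that chart at its centre is the identity. -/
theorem inChart_self (η : DForm I N k) (p : N) :
    (η.inChart p (extChartAt I p p) : E [⋀^Fin k]→L[ℝ] ℝ) = (η p : E [⋀^Fin k]→L[ℝ] ℝ) := by
  have h1 : mfderivWithin 𝓘(ℝ, E) I (extChartAt I p).symm (Set.range I) (extChartAt I p p) =
      ContinuousLinearMap.id ℝ E := mfderivWithin_range_extChartAt_symm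
  have h2 : ∀ q : N, q = p → (η q : E [⋀^Fin k]→L[ℝ] ℝ) = (η p : E [⋀^Fin k]→L[ℝ] ℝ) := by
    rintro q rfl; rfl
  have h3 : (η.inChart p (extChartAt I p p) : E [⋀^Fin k]→L[ℝ] ℝ) =
      (η ((extChartAt I p).symm (extChartAt I p p)) : E [⋀^Fin k]→L[ℝ] ℝ) := by
    unfold DForm.inChart
    rw [h1]
    rfl
  exact h3.trans (h2 _ (extChartAt_to_inv p))

variable [I.Boundaryless]

theorem d_apply_eq_extDeriv (η : DForm I N k) (p : N) :
    (η.d p : E [⋀^Fin (k + 1)]→L[ℝ] ℝ) = extDeriv (η.inChart p) (extChartAt I p p) := by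
  have h1 : mfderiv I 𝓘(ℝ, E) (extChartAt I p) p = ContinuousLinearMap.id ℝ E :=
    mfderiv_extChartAt_self
  unfold DForm.d
  rw [h1, I.range_eq_univ, extDerivWithin_univ]
  rfl

theorem d_add {α β : DForm I N k} {p : N} (hα : α.DiffAt p) (hβ : β.DiffAt p) :
    (α + β).d p = α.d p + β.d p := by
  refine (d_apply_eq_extDeriv _ p).trans ((extDeriv_add hα hβ).trans ?_)
  rw [← d_apply_eq_extDeriv, ← d_apply_eq_extDeriv]
  rfl

/-- Unlike additivity, this holds for arbitrary forms, so the rules for `0` and for negation need no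
regularity either. -/
theorem d_smul (c : ℝ) (α : DForm I N k) : (c • α).d = c • α.d := by
  funext p
  have h : extDeriv ((c • α).inChart p) (extChartAt I p p) =
      c • extDeriv (α.inChart p) (extChartAt I p p) := extDeriv_smul c (α.inChart p)
  refine (d_apply_eq_extDeriv _ p).trans (h.trans ?_)
  rw [← d_apply_eq_extDeriv]
  rfl

theorem d_neg (α : DForm I N k) : (-α).d = -α.d := by
  have h : ∀ {m : ℕ} (β : DForm I N m), (-1 : ℝ) • β = -β := fun β => by
    funext p; ext v; exact neg_one_mul _
  have h1 := d_smul (-1) α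
  rwa [h, h] at h1

theorem d_zero : (0 : DForm I N k).d = 0 := by
  have h : ∀ {m : ℕ} (β : DForm I N m), (0 : ℝ) • β = 0 := fun β => by
    funext p; ext v; exact zero_mul _
  have h1 := d_smul 0 (0 : DForm I N k)
  rwa [h, h] at h1

theorem d_sub {α β : DForm I N k} {p : N} (hα : α.DiffAt p) (hβ : β.DiffAt p) :
    (α - β).d p = α.d p - β.d p := by
  rw [sub_eq_add_neg, d_add hα hβ.neg, d_neg]
  rfl

theorem d_wedge [FiniteDimensional ℝ E] {α : DForm I N k} {β : DForm I N l} {p : N}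
    (hα : α.DiffAt p) (hβ : β.DiffAt p) (v : Fin (k + l + 1) → TangentSpace I p) :
    (α.wedge β).d p v =
      α.d.wedge β p (v ∘ Fin.cast (by omega : k + 1 + l = k + l + 1)) +
        (-1 : ℝ) ^ k * α.wedge β.d p v := by
  have h1 := d_apply_eq_extDeriv (α.wedge β) p
  rw [inChart_wedge] at h1
  refine (DFunLike.congr_fun h1 v).trans ((extDeriv_wedgeAt hα hβ v).trans ?_)
  rw [← d_apply_eq_extDeriv, ← d_apply_eq_extDeriv, inChart_self, inChart_self]
  rfl

end ExteriorDerivative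

/-! ### Naturality of the exterior derivative under maps that are linear in charts. -/

section Pullback

variable {E : Type*} [NormedAddCommGroup E] [NormedSpace ℝ E] {H : Type*} [TopologicalSpace H]
  {I : ModelWithCorners ℝ E H} {N : Type*} [TopologicalSpace N] [ChartedSpace H N]
  {E' : Type*} [NormedAddCommGroup E'] [NormedSpace ℝ E'] {H' : Type*} [TopologicalSpace H']
  {I' : ModelWithCorners ℝ E' H'} {N' : Type*} [TopologicalSpace N'] [ChartedSpace H' N']
  {k l n : ℕ}

theorem pullback_mono (F : N' → N) (θ : Fin n → DForm I N 1) (K : Fin k → Fin n) :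
    (mono θ K).pullback (I' := I') F = mono (fun i => (θ i).pullback F) K := by
  funext p
  exact monomial_compContinuousLinearMap _ _

/-- For differentiable `G` this is naturality of the exterior derivative. Otherwise both sides are
the default value 0: restricting the pulled-back form to the affine image of the section `R` through
`y` recovers `G`, so the pullback is not differentiable either. Hence naturality along projections
needs no regularity, and it can be applied to `⋆₆ν₃` without proving that form differentiable. -/
theorem extDeriv_comp_projection {L : E' →L[ℝ] E} {R : E →L[ℝ] E'} (hR : ∀ x, L (R x) = x)
    (G : E → E [⋀^Fin k]→L[ℝ] ℝ) (y : E') :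
    extDeriv (fun u => (G (L u)).compContinuousLinearMap L) y =
      (extDeriv G (L y)).compContinuousLinearMap L := by
  by_cases hG : DifferentiableAt ℝ G (L y)
  · have := extDeriv_pullback (r := ⊤) hG L.contDiff.contDiffAt (by simp)
    simpa using this
  · have h : ¬ DifferentiableAt ℝ (fun u => (G (L u)).compContinuousLinearMap L) y := by
      intro h
      refine hG ?_
      -- The map `u ↦ R (u - L y) + y` is a section of `L` that sends `L y` to `y`.
      have h1 : DifferentiableAt ℝ (fun u => ((G (L (R (u - L y) + y))).compContinuousLinearMap
          L).compContinuousLinearMap R) (L y) := by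
        have h2 : DifferentiableAt ℝ (fun u => (G (L u)).compContinuousLinearMap L)
            ((fun u => R (u - L y) + y) (L y)) := by simpa using h
        have h3 := h2.comp (L y) (by fun_prop : DifferentiableAt ℝ (fun u => R (u - L y) + y) (L y))
        exact ((ContinuousAlternatingMap.compContinuousLinearMapCLM R).differentiableAt).comp _ h3
      have h4 : (fun u => ((G (L (R (u - L y) + y))).compContinuousLinearMap
          L).compContinuousLinearMap R) = G := by
        funext u
        rw [map_add, hR, sub_add_cancel]
        ext v
        simp [Function.comp_def, hR]
      rwa [h4] at h1
    rw [extDeriv, extDeriv, fderiv_zero_of_not_differentiableAt hG,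
      fderiv_zero_of_not_differentiableAt h]
    ext v
    simp [ContinuousAlternatingMap.alternatizeUncurryFin_apply]

variable [I.Boundaryless] [I'.Boundaryless] [IsManifold I 1 N] [IsManifold I' 1 N']
  {π : N' → N} {q : N'} {L : E' →L[ℝ] E}

theorem inChart_pullback_of_intertwine (hπ : MDifferentiable I' I π)
    (hL : ∀ u, π ((extChartAt I' q).symm u) = (extChartAt I (π q)).symm (L u))
    (hT : ∀ u ∈ (extChartAt I' q).target, L u ∈ (extChartAt I (π q)).target)
    (η : DForm I N k) {u : E'} (hu : u ∈ (extChartAt I' q).target) :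
    ((η.pullback π : DForm I' N' k).inChart q u : E' [⋀^Fin k]→L[ℝ] ℝ) =
      (η.inChart (π q) (L u) : E [⋀^Fin k]→L[ℝ] ℝ).compContinuousLinearMap L := by
  have h1 : MDifferentiableAt 𝓘(ℝ, E') I' (extChartAt I' q).symm u := by
    have := mdifferentiableWithinAt_extChartAt_symm (I := I') hu
    rwa [I'.range_eq_univ, mdifferentiableWithinAt_univ] at this
  have h2 : MDifferentiableAt 𝓘(ℝ, E) I (extChartAt I (π q)).symm (L u) := by
    have := mdifferentiableWithinAt_extChartAt_symm (I := I) (hT u hu)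
    rwa [I.range_eq_univ, mdifferentiableWithinAt_univ] at this
  have h3 := mfderiv_comp u (hπ _) h1
  have h4 : π ∘ (extChartAt I' q).symm = (extChartAt I (π q)).symm ∘ L := funext hL
  have h5 := mfderiv_comp u h2 L.differentiableAt.mdifferentiableAt
  have h6 : ∀ (a b : N) (A B : E' →L[ℝ] E), a = b → A = B →
      (η a : E [⋀^Fin k]→L[ℝ] ℝ).compContinuousLinearMap A =
        (η b : E [⋀^Fin k]→L[ℝ] ℝ).compContinuousLinearMap B := by
    rintro a _ A _ rfl rfl; rfl
  have h7 : (mfderiv 𝓘(ℝ, E') I (π ∘ (extChartAt I' q).symm) u : E' →L[ℝ] E) =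
      (mfderiv 𝓘(ℝ, E') I ((extChartAt I (π q)).symm ∘ L) u : E' →L[ℝ] E) := by rw [h4]
  have h8 := h6 _ _ _ _ (hL u) ((h3.symm.trans h7).trans h5)
  rw [L.mfderiv_eq] at h8
  unfold DForm.inChart DForm.pullback
  rw [I.range_eq_univ, I'.range_eq_univ, mfderivWithin_univ, mfderivWithin_univ]
  exact h8

theorem d_pullback_of_intertwine (hπ : MDifferentiable I' I π)
    (hL : ∀ u, π ((extChartAt I' q).symm u) = (extChartAt I (π q)).symm (L u))
    (hT : ∀ u ∈ (extChartAt I' q).target, L u ∈ (extChartAt I (π q)).target)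
    (hc : L (extChartAt I' q q) = extChartAt I (π q) (π q))
    (hd : (mfderiv I' I π q : E' →L[ℝ] E) = L) {R : E →L[ℝ] E'} (hR : ∀ x, L (R x) = x)
    (η : DForm I N k) :
    (η.pullback π : DForm I' N' k).d q = η.d.pullback π q := by
  have h1 : (η.pullback π : DForm I' N' k).inChart q =ᶠ[nhds (extChartAt I' q q)]
      fun u => (η.inChart (π q) (L u) : E [⋀^Fin k]→L[ℝ] ℝ).compContinuousLinearMap L := by
    filter_upwards [extChartAt_target_mem_nhds (I := I') q] with u hu
    exact inChart_pullback_of_intertwine hπ hL hT η hu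
  refine (d_apply_eq_extDeriv _ q).trans (h1.extDeriv_eq.trans ?_)
  rw [extDeriv_comp_projection hR, hc, ← d_apply_eq_extDeriv]
  unfold DForm.pullback
  rw [hd]
  rfl

theorem diffAt_pullback_of_intertwine (hπ : MDifferentiable I' I π)
    (hL : ∀ u, π ((extChartAt I' q).symm u) = (extChartAt I (π q)).symm (L u))
    (hT : ∀ u ∈ (extChartAt I' q).target, L u ∈ (extChartAt I (π q)).target)
    (hc : L (extChartAt I' q q) = extChartAt I (π q) (π q))
    {η : DForm I N k} (hη : η.DiffAt (π q)) :
    (η.pullback π : DForm I' N' k).DiffAt q := by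
  have h1 : (η.pullback π : DForm I' N' k).inChart q =ᶠ[nhds (extChartAt I' q q)]
      fun u => (η.inChart (π q) (L u) : E [⋀^Fin k]→L[ℝ] ℝ).compContinuousLinearMap L := by
    filter_upwards [extChartAt_target_mem_nhds (I := I') q] with u hu
    exact inChart_pullback_of_intertwine hπ hL hT η hu
  refine DifferentiableAt.congr_of_eventuallyEq ?_ h1
  have h2 : DifferentiableAt ℝ (η.inChart (π q)) (L (extChartAt I' q q)) := by rw [hc]; exact hη
  exact (ContinuousAlternatingMap.compContinuousLinearMapCLM L).differentiableAt.comp _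
    (h2.comp _ L.differentiableAt)

end Pullback

/-! ### The two projections of a product manifold. -/

section Product

variable {E : Type*} [NormedAddCommGroup E] [NormedSpace ℝ E] {H : Type*} [TopologicalSpace H]
  {I : ModelWithCorners ℝ E H} {N : Type*} [TopologicalSpace N] [ChartedSpace H N]
  {E' : Type*} [NormedAddCommGroup E'] [NormedSpace ℝ E'] {H' : Type*} [TopologicalSpace H']
  {I' : ModelWithCorners ℝ E' H'} {N' : Type*} [TopologicalSpace N'] [ChartedSpace H' N']
  {k : ℕ}

theorem extChartAt_prod_symm_fst (q : N × N') (u : E × E') :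
    ((extChartAt (I.prod I') q).symm u).1 = (extChartAt I q.1).symm u.1 := by
  rw [extChartAt_prod]; rfl

theorem extChartAt_prod_symm_snd (q : N × N') (u : E × E') :
    ((extChartAt (I.prod I') q).symm u).2 = (extChartAt I' q.2).symm u.2 := by
  rw [extChartAt_prod]; rfl

theorem mem_target_extChartAt_prod {q : N × N'} {u : E × E'}
    (hu : u ∈ (extChartAt (I.prod I') q).target) :
    u.1 ∈ (extChartAt I q.1).target ∧ u.2 ∈ (extChartAt I' q.2).target := by
  rw [extChartAt_prod] at hu; exact hu

variable [I.Boundaryless] [I'.Boundaryless] [IsManifold I 1 N] [IsManifold I' 1 N']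

theorem d_pullback_fst (η : DForm I N k) :
    (η.pullback Prod.fst : DForm (I.prod I') (N × N') k).d = η.d.pullback Prod.fst := by
  funext q
  exact d_pullback_of_intertwine (L := ContinuousLinearMap.fst ℝ E E')
    (R := ContinuousLinearMap.inl ℝ E E') mdifferentiable_fst (extChartAt_prod_symm_fst q)
    (fun u hu => (mem_target_extChartAt_prod hu).1) (by rw [extChartAt_prod]; rfl) mfderiv_fst
    (fun _ => rfl) η

theorem d_pullback_snd (η : DForm I' N' k) :
    (η.pullback Prod.snd : DForm (I.prod I') (N × N') k).d = η.d.pullback Prod.snd := by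
  funext q
  exact d_pullback_of_intertwine (L := ContinuousLinearMap.snd ℝ E E')
    (R := ContinuousLinearMap.inr ℝ E E') mdifferentiable_snd (extChartAt_prod_symm_snd q)
    (fun u hu => (mem_target_extChartAt_prod hu).2) (by rw [extChartAt_prod]; rfl) mfderiv_snd
    (fun _ => rfl) η

theorem diffAt_pullback_fst {η : DForm I N k} {q : N × N'} (hη : η.DiffAt q.1) :
    (η.pullback Prod.fst : DForm (I.prod I') (N × N') k).DiffAt q :=
  diffAt_pullback_of_intertwine (L := ContinuousLinearMap.fst ℝ E E')
    mdifferentiable_fst (extChartAt_prod_symm_fst q)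
    (fun u hu => (mem_target_extChartAt_prod hu).1) (by rw [extChartAt_prod]; rfl) hη

theorem diffAt_pullback_snd {η : DForm I' N' k} {q : N × N'} (hη : η.DiffAt q.2) :
    (η.pullback Prod.snd : DForm (I.prod I') (N × N') k).DiffAt q :=
  diffAt_pullback_of_intertwine (L := ContinuousLinearMap.snd ℝ E E')
    mdifferentiable_snd (extChartAt_prod_symm_snd q)
    (fun u hu => (mem_target_extChartAt_prod hu).2) (by rw [extChartAt_prod]; rfl) hη

end Product

/-! ### The form `ds` on the circle. -/

section CircleForm

attribute [local instance] finrank_real_complex_fact'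

theorem contMDiff_coe_circle : ContMDiff (𝓡 1) 𝓘(ℝ, ℂ) ∞ (fun w : Circle => (w : ℂ)) :=
  contMDiff_coe_sphere (E := ℂ)

theorem mfderiv_coe_circle_injective (z : Circle) :
    Function.Injective (mfderiv (𝓡 1) 𝓘(ℝ, ℂ) (fun w : Circle => (w : ℂ)) z) := by
  have := injective_mvfderiv_subtypeVal_sphere (E := ℂ) (n := 1) z
  convert! this

theorem ds_apply (z : Circle) (v : Fin 1 → TangentSpace (𝓡 1) z) :
    ds z v = ((starRingEnd ℂ) (z : ℂ) *
      (show ℂ from mfderiv (𝓡 1) 𝓘(ℝ, ℂ) (fun w : Circle => (w : ℂ)) z (v 0))).im := rfl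

theorem diffAt_ds (z : Circle) : ds.DiffAt z := by
  let g : EuclideanSpace ℝ (Fin 1) → ℂ := fun u => ((extChartAt (𝓡 1) z).symm u : ℂ)
  have hsymm : ∀ u ∈ (extChartAt (𝓡 1) z).target,
      MDifferentiableAt 𝓘(ℝ, EuclideanSpace ℝ (Fin 1)) (𝓡 1) (extChartAt (𝓡 1) z).symm u := by
    intro u hu
    have := mdifferentiableWithinAt_extChartAt_symm (I := 𝓡 1) hu
    rwa [(𝓡 1).range_eq_univ, mdifferentiableWithinAt_univ] at this
  have hg : ContDiffAt ℝ ∞ g (extChartAt (𝓡 1) z z) := by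
    have h1 : ContMDiffOn 𝓘(ℝ, EuclideanSpace ℝ (Fin 1)) 𝓘(ℝ, ℂ) ∞ g
        (extChartAt (𝓡 1) z).target :=
      contMDiff_coe_circle.comp_contMDiffOn (contMDiffOn_extChartAt_symm z)
    exact (contMDiffOn_iff_contDiffOn.1 h1).contDiffAt (extChartAt_target_mem_nhds z)
  refine differentiableAt_of_apply fun v => ?_
  -- With `g` the inverse chart viewed in `ℂ`, the form `ds` reads `Im (conj g · dg)`, which is
  -- differentiable because `g` is smooth.
  have hev : (fun u => ds.inChart z u v) =ᶠ[nhds (extChartAt (𝓡 1) z z)]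
      fun u => ((starRingEnd ℂ) (g u) * fderiv ℝ g u (v 0)).im := by
    filter_upwards [extChartAt_target_mem_nhds (I := 𝓡 1) z] with u hu
    have h1 := mfderiv_comp u (contMDiff_coe_circle.mdifferentiableAt (by simp)) (hsymm u hu)
    have h2 : fderiv ℝ g u = (mfderiv (𝓡 1) 𝓘(ℝ, ℂ) (fun w : Circle => (w : ℂ))
        ((extChartAt (𝓡 1) z).symm u)).comp
        (mfderiv 𝓘(ℝ, EuclideanSpace ℝ (Fin 1)) (𝓡 1) (extChartAt (𝓡 1) z).symm u) := by
      rw [← mfderiv_eq_fderiv]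
      exact h1
    rw [h2]
    unfold DForm.inChart
    rw [(𝓡 1).range_eq_univ, mfderivWithin_univ]
    rfl
  refine DifferentiableAt.congr_of_eventuallyEq ?_ hev
  have h1 : DifferentiableAt ℝ (fderiv ℝ g) (extChartAt (𝓡 1) z z) :=
    (hg.fderiv_right (m := 1) (by norm_cast)).differentiableAt (by simp)
  have h2 := hg.differentiableAt (by simp)
  have h3 : DifferentiableAt ℝ (fun u => (starRingEnd ℂ) (g u)) (extChartAt (𝓡 1) z z) :=
    (Complex.conjCLE.differentiableAt).comp _ h2
  exact (Complex.imCLM.differentiableAt).comp _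
    (h3.mul (h1.clm_apply (differentiableAt_const (v 0))))

theorem alternating_two_eq_zero (α : EuclideanSpace ℝ (Fin 1) [⋀^Fin 2]→L[ℝ] ℝ) : α = 0 := by
  ext v
  have : ∀ i, v i = v i 0 • EuclideanSpace.single 0 1 := by
    intro i; ext j; fin_cases j; simp
  rw [show v = fun i => v i 0 • (fun _ => EuclideanSpace.single (0 : Fin 1) (1 : ℝ)) i from
    funext this, α.map_smul_univ, α.map_eq_zero_of_eq _ (i := 0) (j := 1) rfl (by decide)]
  simp

theorem d_ds : ds.d = 0 := by
  funext z
  exact alternating_two_eq_zero (ds.d z)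

/-- Let `w` be the image of `v` in `ℂ`. Differentiating `|z|² = 1` gives `Re (z̄ w) = 0`, and the
hypothesis says `Im (z̄ w) = 0`; so `w = 0`, and the inclusion of the circle is an immersion. -/
theorem ds_ne_zero (z : Circle) (v : TangentSpace (𝓡 1) z) (hv : ds z (fun _ => v) = 0) : v = 0 := by
  rw [ds_apply] at hv
  let w : ℂ := mfderiv (𝓡 1) 𝓘(ℝ, ℂ) (fun w : Circle => (w : ℂ)) z v
  have h1 : MDifferentiableAt (𝓡 1) 𝓘(ℝ, ℂ) (fun w : Circle => (w : ℂ)) z :=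
    contMDiff_coe_circle.mdifferentiableAt (by simp)
  have hre : ((starRingEnd ℂ) (z : ℂ) * w).re = 0 := by
    have hsq : HasFDerivAt (fun u : ℂ => Complex.normSq u) (2 • (innerSL ℝ (z : ℂ))) (z : ℂ) := by
      have := (hasStrictFDerivAt_norm_sq (z : ℂ)).hasFDerivAt
      simpa [Complex.normSq_eq_norm_sq] using this
    have h2 : HasMFDerivAt (𝓡 1) 𝓘(ℝ, ℝ) (fun w : Circle => Complex.normSq (w : ℂ)) z _ :=
      HasMFDerivAt.comp z (g := fun u : ℂ => Complex.normSq u) (I' := 𝓘(ℝ, ℂ))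
        hsq.hasMFDerivAt h1.hasMFDerivAt
    have h3 : (fun w : Circle => Complex.normSq (w : ℂ)) = fun _ => 1 := by
      funext w; simp
    rw [h3] at h2
    have h4 := hasMFDerivAt_unique h2 (hasMFDerivAt_const (1 : ℝ) z)
    have h5 := DFunLike.congr_fun h4 v
    have h6 : (2 : ℕ) • (inner ℝ (z : ℂ) w : ℝ) = 0 := h5
    simp [Complex.inner] at h6 ⊢
    linarith
  have h0 : (starRingEnd ℂ) (z : ℂ) * w = 0 := Complex.ext hre hv
  have hw0 : w = 0 := by simpa using h0
  exact mfderiv_coe_circle_injective z (hw0.trans (map_zero _).symm)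

end CircleForm

/-! ### Algebra of forms, monomials and the star on a manifold. -/

section Algebra

variable {E : Type*} [NormedAddCommGroup E] [NormedSpace ℝ E] {H : Type*} [TopologicalSpace H]
  {I : ModelWithCorners ℝ E H} {N : Type*} [TopologicalSpace N] [ChartedSpace H N] {k l n : ℕ}

theorem add_wedge (α α' : DForm I N k) (β : DForm I N l) :
    (α + α').wedge β = α.wedge β + α'.wedge β :=
  funext fun _ => wedgeAt_add_left _ _ _

theorem wedge_add (α : DForm I N k) (β β' : DForm I N l) :
    α.wedge (β + β') = α.wedge β + α.wedge β' :=
  funext fun _ => wedgeAt_add_right _ _ _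

theorem wedge_smul (c : ℝ) (α : DForm I N k) (β : DForm I N l) :
    α.wedge (c • β) = c • α.wedge β :=
  funext fun _ => wedgeAt_smul_right _ _ _

theorem wedge_neg (α : DForm I N k) (β : DForm I N l) : α.wedge (-β) = -α.wedge β :=
  funext fun _ => map_neg (wedgeₗ k l _) _

theorem sub_wedge (α α' : DForm I N k) (β : DForm I N l) :
    (α - α').wedge β = α.wedge β - α'.wedge β :=
  funext fun _ => LinearMap.map_sub₂ (wedgeₗ k l) _ _ _

theorem wedge_sub (α : DForm I N k) (β β' : DForm I N l) :
    α.wedge (β - β') = α.wedge β - α.wedge β' :=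
  funext fun _ => map_sub (wedgeₗ k l _) _ _

theorem zero_wedge (β : DForm I N l) : (0 : DForm I N k).wedge β = 0 :=
  funext fun _ => LinearMap.map_zero₂ (wedgeₗ k l) _

theorem wedge_zero (α : DForm I N k) : α.wedge (0 : DForm I N l) = 0 :=
  funext fun _ => map_zero (wedgeₗ k l _)

theorem mono_wedge_mono (θ : Fin n → DForm I N 1) (K : Fin k → Fin n) (L : Fin l → Fin n) :
    (mono θ K).wedge (mono θ L) = mono θ (Fin.append K L) := by
  funext p
  refine (wedgeAt_monomial _ _).trans (congrArg monomial ?_)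
  funext i
  refine Fin.addCases (fun j => ?_) (fun j => ?_) i <;> simp

theorem mono_of_not_injective (θ : Fin n → DForm I N 1) {K : Fin k → Fin n}
    (hK : ¬ Function.Injective K) : mono θ K = 0 :=
  funext fun p => monomial_eq_zero_of_not_injective _ fun h =>
    hK (Function.Injective.of_comp (f := fun i => covector (θ i p)) h)

theorem mono_comp_perm (θ : Fin n → DForm I N 1) (K : Fin k → Fin n) (σ : Equiv.Perm (Fin k)) :
    mono θ (K ∘ σ) = ((Equiv.Perm.sign σ : ℤ) : ℝ) • mono θ K :=
  funext fun p => monomial_comp_perm (fun i => covector (θ (K i) p)) σ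

theorem mono_singleton (θ : Fin n → DForm I N 1) (i : Fin n) : mono θ ![i] = θ i := by
  funext p
  ext v
  rw [mono_apply_eq, monomial_eq_det, Matrix.det_fin_one]
  simp only [Matrix.of_apply, covector_apply]
  congr 1
  funext j
  fin_cases j
  rfl

theorem mono_const_smul (θ : Fin n → DForm I N 1) (a : Fin n → ℝ) (K : Fin k → Fin n) :
    mono (fun i => a i • θ i) K = (∏ i, a (K i)) • mono θ K :=
  funext fun p => monomial_smul (fun i => a (K i)) (fun i => covector (θ (K i) p))

theorem star_add (θ : Fin n → DForm I N 1) (hn : k + l = n) (α β : DForm I N k) :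
    star θ hn (α + β) = star θ hn α + star θ hn β :=
  funext fun p =>
    map_add (starₗ (dualFrame θ p) (fun i => covector (θ i p)) hn) (α p) (β p)

theorem star_sub (θ : Fin n → DForm I N 1) (hn : k + l = n) (α β : DForm I N k) :
    star θ hn (α - β) = star θ hn α - star θ hn β :=
  funext fun p =>
    map_sub (starₗ (dualFrame θ p) (fun i => covector (θ i p)) hn) (α p) (β p)

theorem star_zero (θ : Fin n → DForm I N 1) (hn : k + l = n) :
    star θ hn (0 : DForm I N k) = 0 :=
  funext fun p => map_zero (starₗ (dualFrame θ p) (fun i => covector (θ i p)) hn)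

theorem star_mono [FiniteDimensional ℝ E] {θ : Fin n → DForm I N 1} (hθ : IsCoframe θ)
    (hE : Module.finrank ℝ E = n) (hn : k + l = n) {K : Fin k → Fin n} {L : Fin l → Fin n}
    (σ : Equiv.Perm (Fin n)) (hK : ∀ i, K i = σ (Fin.cast hn (Fin.castAdd l i)))
    (hL : ∀ i, L i = σ (Fin.cast hn (Fin.natAdd k i))) :
    star θ hn (mono θ K) = ((Equiv.Perm.sign σ : ℤ) : ℝ) • mono θ L := by
  obtain rfl := funext hK
  obtain rfl := funext hL
  exact funext fun p => starAt_monomial_comp_perm (covector_dualFrame hθ hE p) hn σ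

/-- Values of a monomial on vectors of the dual frame. -/
theorem mono_dualFrame [FiniteDimensional ℝ E] {θ : Fin n → DForm I N 1} (hθ : IsCoframe θ)
    (hE : Module.finrank ℝ E = n) (p : N) (K K' : Fin k → Fin n) :
    mono θ K p (fun i => dualFrame θ p (K' i)) =
      ((∑ σ : Equiv.Perm (Fin k), (Equiv.Perm.sign σ : ℤ) *
        if ∀ i, K i = K' (σ i) then 1 else 0 : ℤ) : ℝ) := by
  rw [mono_apply_eq, monomial_apply]
  push_cast
  refine Finset.sum_congr rfl fun σ _ => ?_
  simp only [covector_dualFrame hθ hE, Finset.prod_ite_zero, Finset.mem_univ, true_implies,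
    Finset.prod_const_one]

end Algebra

/-! ### The star of a base 3-form wedged with the last coframe element. -/

section Codim

theorem starₗ_apply {V : Type*} [AddCommGroup V] [Module ℝ V] [TopologicalSpace V] {k l n : ℕ}
    (e : Fin n → V) (b : Fin n → V →L[ℝ] ℝ) (hn : k + l = n) (α : V [⋀^Fin k]→L[ℝ] ℝ) :
    starₗ e b hn α = starAt e b hn α := rfl

theorem wedgeₗ_apply {V : Type*} [AddCommGroup V] [Module ℝ V] [TopologicalSpace V] {k l : ℕ}
    (α : V [⋀^Fin k]→L[ℝ] ℝ) (β : V [⋀^Fin l]→L[ℝ] ℝ) : wedgeₗ k l α β = wedgeAt α β := rfl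

variable {V : Type*} [AddCommGroup V] [Module ℝ V] [TopologicalSpace V]
  {W : Type*} [AddCommGroup W] [Module ℝ W] [TopologicalSpace W]

theorem exists_perm_extending (K : Fin 3 → Fin 6) (hK : Function.Injective K) :
    ∃ σ : Equiv.Perm (Fin 6), ∀ i : Fin 3, K i = σ (Fin.castAdd 3 i) := by
  obtain ⟨σ, hσ⟩ := (Equiv.Perm.isMultiplyPretransitive (Fin 6) 3).exists_smul_eq
    (Fin.castAddEmb 3) ⟨K, hK⟩
  exact ⟨σ, fun i => (DFunLike.congr_fun hσ i).symm⟩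

/-- The Hodge star of `α ∧ b₇`, where `α` is a 3-form on a 6-dimensional quotient. -/
theorem starAt_wedgeAt_last {e : Fin 6 → V} {b : Fin 6 → V →L[ℝ] ℝ} {e' : Fin 7 → W}
    {b' : Fin 7 → W →L[ℝ] ℝ} (hb : ∀ i j, b i (e j) = if i = j then 1 else 0)
    (hsum : ∀ v, v = ∑ j, b j v • e j) (hb' : ∀ i j, b' i (e' j) = if i = j then 1 else 0)
    {L : W →L[ℝ] V} (hL : ∀ i : Fin 6, b' i.castSucc = (b i).comp L)
    (α : V [⋀^Fin 3]→L[ℝ] ℝ) :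
    starAt e' b' (rfl : 3 + 1 + 3 = 7)
        (wedgeAt (α.compContinuousLinearMap L) (monomial (fun _ : Fin 1 => b' 6))) =
      -(starAt e b (rfl : 3 + 3 = 6) α).compContinuousLinearMap L := by
  let Φ : (V [⋀^Fin 3]→L[ℝ] ℝ) →ₗ[ℝ] (W [⋀^Fin 3]→L[ℝ] ℝ) :=
    (starₗ e' b' (rfl : 3 + 1 + 3 = 7)).comp (((wedgeₗ 3 1).flip
      (monomial (fun _ : Fin 1 => b' 6))).comp
        (ContinuousAlternatingMap.compContinuousLinearMapₗ L))
  let Ψ : (V [⋀^Fin 3]→L[ℝ] ℝ) →ₗ[ℝ] (W [⋀^Fin 3]→L[ℝ] ℝ) :=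
    -(ContinuousAlternatingMap.compContinuousLinearMapₗ L).comp
        (starₗ e b (rfl : 3 + 3 = 6))
  have hΦ : ∀ β, Φ β = starAt e' b' (rfl : 3 + 1 + 3 = 7)
      (wedgeAt (β.compContinuousLinearMap L) (monomial (fun _ : Fin 1 => b' 6))) := fun β => by
    rw [LinearMap.comp_apply, LinearMap.comp_apply, LinearMap.flip_apply, starₗ_apply,
      wedgeₗ_apply]
    rfl
  have hΨ : ∀ β, Ψ β = -(starAt e b (rfl : 3 + 3 = 6) β).compContinuousLinearMap L :=
    fun β => by
      rw [LinearMap.neg_apply, LinearMap.comp_apply, starₗ_apply,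
        ContinuousAlternatingMap.compContinuousLinearMapₗ_apply]
  clear_value Φ Ψ
  have key : Φ = Ψ := by
    refine linearMap_ext_monomial hsum fun K => ?_
    by_cases hK : Function.Injective K
    · obtain ⟨σ, hσ⟩ := exists_perm_extending K hK
      obtain rfl := funext hσ
      -- `ρ` brings the last index into the fourth slot past three others, so it is odd; this is the
      -- minus sign in the statement. The extension `τ` of `σ` fixes the last index and keeps the
      -- sign of `σ`.
      let ρ : Equiv.Perm (Fin 7) := ⟨![0, 1, 2, 6, 3, 4, 5], ![0, 1, 2, 4, 5, 6, 3],
        by decide, by decide⟩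
      have hρ : Equiv.Perm.sign ρ = -1 := by decide
      let τ := σ.viaFintypeEmbedding Fin.castSuccEmb
      have hτ : ∀ i : Fin 6, τ i.castSucc = (σ i).castSucc := fun i =>
        σ.viaFintypeEmbedding_apply_image Fin.castSuccEmb i
      have hτ' : τ 6 = 6 := σ.viaFintypeEmbedding_apply_notMem_range _ (by decide)
      have hτs : Equiv.Perm.sign τ = Equiv.Perm.sign σ := Equiv.Perm.viaFintypeEmbedding_sign _ _
      have h1 := starAt_monomial_comp_perm hb (rfl : 3 + 3 = 6) σ
      have h2 := starAt_monomial_comp_perm hb' (rfl : 3 + 1 + 3 = 7) (τ * ρ)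
      have h3 : (fun i : Fin (3 + 1) => b' ((τ * ρ) (Fin.cast (rfl : 3 + 1 + 3 = 7) (Fin.castAdd 3 i)))) =
          Fin.append (fun i : Fin 3 => (b (σ (Fin.castAdd 3 i))).comp L)
            (fun _ : Fin 1 => b' 6) := by
        funext i
        fin_cases i
        · exact (congrArg b' (hτ 0)).trans (hL _)
        · exact (congrArg b' (hτ 1)).trans (hL _)
        · exact (congrArg b' (hτ 2)).trans (hL _)
        · exact congrArg b' hτ'
      have h4 : (fun i : Fin 3 => b' ((τ * ρ) (Fin.cast (rfl : 3 + 1 + 3 = 7) (Fin.natAdd (3 + 1) i)))) =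
          fun i : Fin 3 => (b (σ (Fin.natAdd 3 i))).comp L := by
        funext i
        fin_cases i
        · exact (congrArg b' (hτ 3)).trans (hL _)
        · exact (congrArg b' (hτ 4)).trans (hL _)
        · exact (congrArg b' (hτ 5)).trans (hL _)
      rw [h3, h4, ← wedgeAt_monomial, ← monomial_compContinuousLinearMap,
        ← monomial_compContinuousLinearMap] at h2
      rw [hΦ, hΨ]
      have h5 : b ∘ (fun i : Fin 3 => σ (Fin.castAdd 3 i)) =
        fun i => b (σ (Fin.cast (rfl : 3 + 3 = 6) (Fin.castAdd 3 i))) := rfl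
      rw [h5, h1]
      refine h2.trans ?_
      rw [Equiv.Perm.sign_mul, hτs, hρ]
      ext v
      simp
    · have h0 : monomial (b ∘ K) = 0 := monomial_eq_zero_of_not_injective _ fun h =>
        hK (Function.Injective.of_comp h)
      rw [h0]
      exact (LinearMap.map_zero Φ).trans (LinearMap.map_zero Ψ).symm
  exact (hΦ α).symm.trans ((LinearMap.congr_fun key α).trans (hΨ α))

end Codim

/-! ### The model `G₂` forms and their Hodge duality. -/

section StarSeven

variable {E : Type*} [NormedAddCommGroup E] [NormedSpace ℝ E] {H : Type*} [TopologicalSpace H]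
  {I : ModelWithCorners ℝ E H} {N : Type*} [TopologicalSpace N] [ChartedSpace H N] {k l n : ℕ}
  [FiniteDimensional ℝ E]

theorem star_mono_pos {θ : Fin n → DForm I N 1} (hθ : IsCoframe θ)
    (hE : Module.finrank ℝ E = n) (hn : k + l = n) {K : Fin k → Fin n} {L : Fin l → Fin n}
    (σ : Equiv.Perm (Fin n)) (hK : ∀ i, K i = σ (Fin.cast hn (Fin.castAdd l i)))
    (hL : ∀ i, L i = σ (Fin.cast hn (Fin.natAdd k i))) (hσ : Equiv.Perm.sign σ = 1) :
    star θ hn (mono θ K) = mono θ L := by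
  refine (star_mono hθ hE hn σ hK hL).trans ?_
  rw [hσ]
  funext p; ext v
  exact (congrArg (· * mono θ L p v) (by simp)).trans (one_mul _)

/-- The `G₂` 3-form adapted to the coframe `θ`. -/
def formG2 (θ : Fin 7 → DForm I N 1) : DForm I N 3 :=
  mono θ ![0, 1, 6] + mono θ ![2, 3, 6] + mono θ ![4, 5, 6] + mono θ ![1, 3, 5] -
    mono θ ![1, 2, 4] - mono θ ![0, 3, 4] - mono θ ![0, 2, 5]

/-- The `G₂` 4-form adapted to the coframe `θ`. -/
def dualFormG2 (θ : Fin 7 → DForm I N 1) : DForm I N 4 :=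
  mono θ ![2, 3, 4, 5] + mono θ ![0, 1, 4, 5] + mono θ ![0, 1, 2, 3] + mono θ ![0, 2, 4, 6] -
    mono θ ![0, 3, 5, 6] - mono θ ![1, 2, 5, 6] - mono θ ![1, 3, 4, 6]

/-- Each of the seven monomials followed by its complement, in the listed order, is an even
permutation, so the star acts termwise without changing signs. The same holds with the two blocks
exchanged in `star_dualFormG2`. -/
theorem star_formG2 {θ : Fin 7 → DForm I N 1} (hθ : IsCoframe θ)
    (hE : Module.finrank ℝ E = 7) (hn : 3 + 4 = 7) : star θ hn (formG2 θ) = dualFormG2 θ := by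
  have h0 : star θ hn (mono θ ![0, 1, 6]) = mono θ ![2, 3, 4, 5] :=
    star_mono_pos hθ hE (rfl : 3 + 4 = 7)
      ⟨![0, 1, 6, 2, 3, 4, 5], ![0, 1, 3, 4, 5, 6, 2], by decide, by decide⟩ (by decide) (by decide)
      (by decide)
  have h1 : star θ hn (mono θ ![2, 3, 6]) = mono θ ![0, 1, 4, 5] :=
    star_mono_pos hθ hE (rfl : 3 + 4 = 7)
      ⟨![2, 3, 6, 0, 1, 4, 5], ![3, 4, 0, 1, 5, 6, 2], by decide, by decide⟩ (by decide) (by decide)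
      (by decide)
  have h2 : star θ hn (mono θ ![4, 5, 6]) = mono θ ![0, 1, 2, 3] :=
    star_mono_pos hθ hE (rfl : 3 + 4 = 7)
      ⟨![4, 5, 6, 0, 1, 2, 3], ![3, 4, 5, 6, 0, 1, 2], by decide, by decide⟩ (by decide) (by decide)
      (by decide)
  have h3 : star θ hn (mono θ ![1, 3, 5]) = mono θ ![0, 2, 4, 6] :=
    star_mono_pos hθ hE (rfl : 3 + 4 = 7)
      ⟨![1, 3, 5, 0, 2, 4, 6], ![3, 0, 4, 1, 5, 2, 6], by decide, by decide⟩ (by decide) (by decide)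
      (by decide)
  have h4 : star θ hn (mono θ ![1, 2, 4]) = mono θ ![0, 3, 5, 6] :=
    star_mono_pos hθ hE (rfl : 3 + 4 = 7)
      ⟨![1, 2, 4, 0, 3, 5, 6], ![3, 0, 1, 4, 2, 5, 6], by decide, by decide⟩ (by decide) (by decide)
      (by decide)
  have h5 : star θ hn (mono θ ![0, 3, 4]) = mono θ ![1, 2, 5, 6] :=
    star_mono_pos hθ hE (rfl : 3 + 4 = 7)
      ⟨![0, 3, 4, 1, 2, 5, 6], ![0, 3, 4, 1, 2, 5, 6], by decide, by decide⟩ (by decide) (by decide)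
      (by decide)
  have h6 : star θ hn (mono θ ![0, 2, 5]) = mono θ ![1, 3, 4, 6] :=
    star_mono_pos hθ hE (rfl : 3 + 4 = 7)
      ⟨![0, 2, 5, 1, 3, 4, 6], ![0, 3, 1, 4, 5, 2, 6], by decide, by decide⟩ (by decide) (by decide)
      (by decide)
  have add {α β : DForm I N _} {α' β' : DForm I N _} (hα : star θ hn α = α')
      (hβ : star θ hn β = β') : star θ hn (α + β) = α' + β' :=
    (star_add θ hn α β).trans (congrArg₂ _ hα hβ)
  have sub {α β : DForm I N _} {α' β' : DForm I N _} (hα : star θ hn α = α')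
      (hβ : star θ hn β = β') : star θ hn (α - β) = α' - β' :=
    (star_sub θ hn α β).trans (congrArg₂ _ hα hβ)
  exact sub (sub (sub (add (add (add h0 h1) h2) h3) h4) h5) h6

theorem star_dualFormG2 {θ : Fin 7 → DForm I N 1} (hθ : IsCoframe θ)
    (hE : Module.finrank ℝ E = 7) (hn : 4 + 3 = 7) : star θ hn (dualFormG2 θ) = formG2 θ := by
  have h0 : star θ hn (mono θ ![2, 3, 4, 5]) = mono θ ![0, 1, 6] :=
    star_mono_pos hθ hE (rfl : 4 + 3 = 7)
      ⟨![2, 3, 4, 5, 0, 1, 6], ![4, 5, 0, 1, 2, 3, 6], by decide, by decide⟩ (by decide) (by decide)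
      (by decide)
  have h1 : star θ hn (mono θ ![0, 1, 4, 5]) = mono θ ![2, 3, 6] :=
    star_mono_pos hθ hE (rfl : 4 + 3 = 7)
      ⟨![0, 1, 4, 5, 2, 3, 6], ![0, 1, 4, 5, 2, 3, 6], by decide, by decide⟩ (by decide) (by decide)
      (by decide)
  have h2 : star θ hn (mono θ ![0, 1, 2, 3]) = mono θ ![4, 5, 6] :=
    star_mono_pos hθ hE (rfl : 4 + 3 = 7)
      ⟨![0, 1, 2, 3, 4, 5, 6], ![0, 1, 2, 3, 4, 5, 6], by decide, by decide⟩ (by decide) (by decide)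
      (by decide)
  have h3 : star θ hn (mono θ ![0, 2, 4, 6]) = mono θ ![1, 3, 5] :=
    star_mono_pos hθ hE (rfl : 4 + 3 = 7)
      ⟨![0, 2, 4, 6, 1, 3, 5], ![0, 4, 1, 5, 2, 6, 3], by decide, by decide⟩ (by decide) (by decide)
      (by decide)
  have h4 : star θ hn (mono θ ![0, 3, 5, 6]) = mono θ ![1, 2, 4] :=
    star_mono_pos hθ hE (rfl : 4 + 3 = 7)
      ⟨![0, 3, 5, 6, 1, 2, 4], ![0, 4, 5, 1, 6, 2, 3], by decide, by decide⟩ (by decide) (by decide)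
      (by decide)
  have h5 : star θ hn (mono θ ![1, 2, 5, 6]) = mono θ ![0, 3, 4] :=
    star_mono_pos hθ hE (rfl : 4 + 3 = 7)
      ⟨![1, 2, 5, 6, 0, 3, 4], ![4, 0, 1, 5, 6, 2, 3], by decide, by decide⟩ (by decide) (by decide)
      (by decide)
  have h6 : star θ hn (mono θ ![1, 3, 4, 6]) = mono θ ![0, 2, 5] :=
    star_mono_pos hθ hE (rfl : 4 + 3 = 7)
      ⟨![1, 3, 4, 6, 0, 2, 5], ![4, 0, 5, 1, 2, 6, 3], by decide, by decide⟩ (by decide) (by decide)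
      (by decide)
  have add {α β : DForm I N _} {α' β' : DForm I N _} (hα : star θ hn α = α')
      (hβ : star θ hn β = β') : star θ hn (α + β) = α' + β' :=
    (star_add θ hn α β).trans (congrArg₂ _ hα hβ)
  have sub {α β : DForm I N _} {α' β' : DForm I N _} (hα : star θ hn α = α')
      (hβ : star θ hn β = β') : star θ hn (α - β) = α' - β' :=
    (star_sub θ hn α β).trans (congrArg₂ _ hα hβ)
  exact sub (sub (sub (add (add (add h0 h1) h2) h3) h4) h5) h6

end StarSeven

/-! ### The warped coframe on `M × S¹`. -/

section WarpedProduct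

variable {M : Type*} [TopologicalSpace M] [ChartedSpace (EuclideanSpace ℝ (Fin 6)) M] {k l : ℕ}

theorem finrank_model7 :
    Module.finrank ℝ (EuclideanSpace ℝ (Fin 6) × EuclideanSpace ℝ (Fin 1)) = 7 := by
  simp [Module.finrank_prod]

theorem finrank_model6 : Module.finrank ℝ (EuclideanSpace ℝ (Fin 6)) = 6 := by
  simp

theorem fromBase_apply [IsManifold (𝓡 6) 1 M] (η : DForm (𝓡 6) M k) (q : M × Circle)
    (v : Fin k → EuclideanSpace ℝ (Fin 6) × EuclideanSpace ℝ (Fin 1)) :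
    fromBase η q v = η q.1 (fun i => (v i).1) := by
  unfold fromBase DForm.pullback
  rw [mfderiv_fst]
  rfl

theorem ds7_apply [IsManifold (𝓡 6) 1 M] (q : M × Circle)
    (v : Fin 1 → EuclideanSpace ℝ (Fin 6) × EuclideanSpace ℝ (Fin 1)) :
    ds7 q v = ds q.2 (fun i => (v i).2) := by
  unfold ds7 DForm.pullback
  rw [mfderiv_snd]
  rfl

theorem warpedCoframe_castSucc (f : ℝ) (x : Fin 6 → DForm (𝓡 6) M 1) (i : Fin 6) :
    warpedCoframe f x i.castSucc = fromBase (x i) := by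
  simp only [warpedCoframe, Fin.snoc_castSucc]

theorem warpedCoframe_last (f : ℝ) (x : Fin 6 → DForm (𝓡 6) M 1) :
    warpedCoframe f x 6 = f • ds7 := by
  simp only [warpedCoframe]
  exact Fin.snoc_last (n := 6) (α := fun _ => DForm I7 (M × Circle) 1) _ _

theorem fromBase_eq_comp (η : DForm (𝓡 6) M k) (q : M × Circle) :
    fromBase η q = (η q.1).compContinuousLinearMap (mfderiv I7 (𝓡 6) Prod.fst q) := rfl

theorem fromBase_add (α β : DForm (𝓡 6) M k) : fromBase (α + β) = fromBase α + fromBase β := rfl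

theorem fromBase_sub (α β : DForm (𝓡 6) M k) : fromBase (α - β) = fromBase α - fromBase β := rfl

theorem fromBase_neg (α : DForm (𝓡 6) M k) : fromBase (-α) = -fromBase α := rfl

theorem fromBase_mono (f : ℝ) (x : Fin 6 → DForm (𝓡 6) M 1) {K : Fin k → Fin 6}
    {K' : Fin k → Fin 7} (hK : ∀ i, K' i = (K i).castSucc) :
    fromBase (mono x K) = mono (warpedCoframe f x) K' := by
  obtain rfl := funext hK
  refine (pullback_mono _ _ _).trans ?_
  have : (fun i => fromBase (x i)) = fun i : Fin 6 => warpedCoframe f x i.castSucc :=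
    funext fun i => (warpedCoframe_castSucc f x i).symm
  rw [this]
  rfl

theorem smul_ds7_eq_mono (f : ℝ) (x : Fin 6 → DForm (𝓡 6) M 1) :
    f • ds7 = mono (warpedCoframe f x) ![6] := by
  rw [mono_singleton, warpedCoframe_last]

/-- The 4-form `x¹²³⁴ + x¹²⁵⁶ + x³⁴⁵⁶`, half of `ω²`. -/
def halfOmegaSq (x : Fin 6 → DForm (𝓡 6) M 1) : DForm (𝓡 6) M 4 :=
  mono x ![0, 1, 2, 3] + mono x ![0, 1, 4, 5] + mono x ![2, 3, 4, 5]

theorem warpedG2_eq (f : ℝ) (x : Fin 6 → DForm (𝓡 6) M 1) :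
    warpedG2 f x = formG2 (warpedCoframe f x) := by
  rw [warpedG2, ← wedge_smul, smul_ds7_eq_mono f x]
  rw [omega, psiMinus]
  simp only [fromBase_add, fromBase_neg]
  rw [fromBase_mono f x (K := ![0, 1]) (K' := ![0, 1]) (by decide),
    fromBase_mono f x (K := ![2, 3]) (K' := ![2, 3]) (by decide),
    fromBase_mono f x (K := ![4, 5]) (K' := ![4, 5]) (by decide),
    fromBase_mono f x (K := ![1, 3, 5]) (K' := ![1, 3, 5]) (by decide),
    fromBase_mono f x (K := ![1, 2, 4]) (K' := ![1, 2, 4]) (by decide),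
    fromBase_mono f x (K := ![0, 3, 4]) (K' := ![0, 3, 4]) (by decide),
    fromBase_mono f x (K := ![0, 2, 5]) (K' := ![0, 2, 5]) (by decide)]
  rw [add_wedge, add_wedge, mono_wedge_mono, mono_wedge_mono, mono_wedge_mono,
    show Fin.append ![0, 1] ![6] = (![0, 1, 6] : Fin 3 → Fin 7) by decide,
    show Fin.append ![2, 3] ![6] = (![2, 3, 6] : Fin 3 → Fin 7) by decide,
    show Fin.append ![4, 5] ![6] = (![4, 5, 6] : Fin 3 → Fin 7) by decide]
  rw [formG2]
  abel

theorem sum_smul_add_smul_apply {V : Type*} [AddCommGroup V] [Module ℝ V] [TopologicalSpace V]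
    {n : ℕ} (g : Fin n → ℝ) (a : Fin n → V →L[ℝ] ℝ) (c : ℝ) (b : V →L[ℝ] ℝ) (v : V) :
    (∑ i, g i • a i + c • b) v = ∑ i, g i * a i v + c * b v := by
  simp

variable [IsManifold (𝓡 6) 1 M]

/-- A linear relation evaluated on vectors tangent to `M` kills the six base coefficients; evaluated
on a nonzero vector tangent to the circle it kills the last, as neither `f` nor `ds` vanishes there.
-/
theorem IsCoframe.warpedCoframe {x : Fin 6 → DForm (𝓡 6) M 1} (hx : IsCoframe x) {f : ℝ}
    (hf : f ≠ 0) : IsCoframe (warpedCoframe f x) := by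
  intro q
  rw [Fintype.linearIndependent_iff]
  intro g hg
  rw [Fin.sum_univ_castSucc] at hg
  have heval : ∀ v : EuclideanSpace ℝ (Fin 6) × EuclideanSpace ℝ (Fin 1),
      ∑ i : Fin 6, g i.castSucc * x i q.1 (fun _ => v.1) +
        g 6 * (f * ds q.2 (fun _ => v.2)) = 0 := by
    intro v
    have h1 := DFunLike.congr_fun hg v
    refine Eq.trans ?_ ((sum_smul_add_smul_apply (V := TangentSpace I7 q) _ _ _ _ _).symm.trans h1)
    congr 1
    · refine Finset.sum_congr rfl fun i _ => ?_
      rw [warpedCoframe_castSucc]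
      exact congrArg _ (fromBase_apply (x i) q fun _ => v).symm
    · rw [show Fin.last 6 = 6 from rfl, warpedCoframe_last]
      exact congrArg (fun r => g 6 * (f * r)) (ds7_apply q fun _ => v).symm
  have hbase : ∀ i : Fin 6, g i.castSucc = 0 := by
    refine Fintype.linearIndependent_iff.1 (hx q.1) (fun i => g i.castSucc) ?_
    ext v
    have h1 := heval (v, 0)
    have h2 : ds q.2 (fun _ => (0 : EuclideanSpace ℝ (Fin 1))) = 0 :=
      (ds q.2).map_coord_zero 0 rfl
    rw [h2, mul_zero, mul_zero, add_zero] at h1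
    rw [sum_apply]
    exact h1
  intro i
  refine Fin.lastCases ?_ hbase i
  have h1 := heval (0, EuclideanSpace.single 0 1)
  simp only [hbase, zero_mul, Finset.sum_const_zero, zero_add] at h1
  rcases mul_eq_zero.1 h1 with h | h
  · exact h
  · rcases mul_eq_zero.1 h with h | h
    · exact absurd h hf
    · have h3 : EuclideanSpace.single (0 : Fin 1) (1 : ℝ) = 0 := ds_ne_zero q.2 _ h
      simp at h3

theorem star_fromBase_wedge_ds7 {x : Fin 6 → DForm (𝓡 6) M 1} (hx : IsCoframe x) {f : ℝ}
    (hf : f ≠ 0) (γ : DForm (𝓡 6) M 3) :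
    star (warpedCoframe f x) (rfl : 3 + 1 + 3 = 7) ((fromBase γ).wedge (f • ds7)) =
      -fromBase (star x (rfl : 3 + 3 = 6) γ) := by
  funext q
  have h := starAt_wedgeAt_last (V := TangentSpace (𝓡 6) q.1) (W := TangentSpace I7 q)
    (covector_dualFrame hx finrank_model6 q.1)
    (eq_sum_covector_smul_dualFrame hx finrank_model6 q.1)
    (covector_dualFrame (hx.warpedCoframe hf) finrank_model7 q)
    (L := mfderiv I7 (𝓡 6) Prod.fst q) (fun i => by
      rw [warpedCoframe_castSucc]
      exact covector_compContinuousLinearMap _ _) (γ q.1)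
  have h1 : (-fromBase (star x (rfl : 3 + 3 = 6) γ)) q = -(starAt (dualFrame x q.1)
      (fun i => covector (x i q.1)) (rfl : 3 + 3 = 6) (γ q.1)).compContinuousLinearMap
        (mfderiv I7 (𝓡 6) Prod.fst q) := by
    rw [Pi.neg_apply, fromBase_eq_comp, star_apply_eq_starAt]
  have h2 : (fromBase γ).wedge (mono (WarpedG2.warpedCoframe f x) ![6]) q =
      wedgeAt ((γ q.1).compContinuousLinearMap (mfderiv I7 (𝓡 6) Prod.fst q))
        (monomial fun _ : Fin 1 => covector (WarpedG2.warpedCoframe f x 6 q)) := by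
    rw [wedge_apply_eq, mono_apply_eq, fromBase_eq_comp]
    congr 2
    funext i
    fin_cases i
    rfl
  rw [h1, smul_ds7_eq_mono f x, star_apply_eq_starAt, h2]
  exact h

end WarpedProduct

/-- The permutation `ρ` exchanging blocks of lengths 2 and 3 has sign `(-1)^(2·3) = 1`. -/
theorem wedgeAt_comm_two_three {V : Type*} [AddCommGroup V] [Module ℝ V] [TopologicalSpace V]
    (α : V [⋀^Fin 2]→L[ℝ] ℝ) (β : V [⋀^Fin 3]→L[ℝ] ℝ) (v : Fin 5 → V) :
    wedgeAt α β v = wedgeAt β α v := by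
  let ρ : Equiv.Perm (Fin 5) := ⟨![2, 3, 4, 0, 1], ![3, 4, 0, 1, 2], by decide, by decide⟩
  have hρ : Equiv.Perm.sign ρ = 1 := by decide
  refine (wedgeAt_apply α β v).trans (Eq.trans ?_ (wedgeAt_apply β α v).symm)
  rw [mul_comm ((Nat.factorial 2 : ℕ) : ℝ)]
  congr 1
  refine Eq.trans ?_ (Equiv.sum_comp (Equiv.mulRight ρ) fun σ : Equiv.Perm (Fin 5) =>
    ((Equiv.Perm.sign σ : ℤ) : ℝ) * (β (fun i : Fin 3 => v (σ (Fin.castAdd 2 i))) *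
      α (fun j : Fin 2 => v (σ (Fin.natAdd 3 j)))))
  refine Finset.sum_congr rfl fun σ _ => ?_
  have h1 : (fun i : Fin 3 => v ((σ * ρ) (Fin.castAdd 2 i))) =
      fun i => v (σ (Fin.natAdd 2 i)) := by
    funext i; fin_cases i <;> rfl
  have h2 : (fun j : Fin 2 => v ((σ * ρ) (Fin.natAdd 3 j))) =
      fun j => v (σ (Fin.castAdd 3 j)) := by
    funext j; fin_cases j <;> rfl
  simp only [Equiv.coe_mulRight, h1, h2, Equiv.Perm.sign_mul, hρ, mul_one]
  rw [mul_comm (α _)]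

/-! ### Identities for `ω` and `ψ±` in dimension six. -/

section SixDim

variable {M : Type*} [TopologicalSpace M] [ChartedSpace (EuclideanSpace ℝ (Fin 6)) M] {k l : ℕ}

theorem omega_wedge_omega (x : Fin 6 → DForm (𝓡 6) M 1) :
    (omega x).wedge (omega x) = (2 : ℝ) • halfOmegaSq x := by
  have zero : ∀ {K L : Fin 2 → Fin 6}, ¬ Function.Injective (Fin.append K L) →
      (mono x K).wedge (mono x L) = 0 := fun h =>
    (mono_wedge_mono x _ _).trans (mono_of_not_injective x h)
  have same : ∀ {K L : Fin 2 → Fin 6} {N : Fin 4 → Fin 6}, Fin.append K L = N →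
      (mono x K).wedge (mono x L) = mono x N := fun h =>
    (mono_wedge_mono x _ _).trans (congrArg (mono x) h)
  have swap : ∀ {K L : Fin 2 → Fin 6} {N : Fin 4 → Fin 6}, Fin.append L K = N →
      (mono x K).wedge (mono x L) = mono x N := by
    rintro K L N rfl
    let ρ : Equiv.Perm (Fin 4) := ⟨![2, 3, 0, 1], ![2, 3, 0, 1], by decide, by decide⟩
    have hρ : Equiv.Perm.sign ρ = 1 := by decide
    have h1 : Fin.append K L = Fin.append L K ∘ ρ := by
      funext i; fin_cases i <;> rfl
    refine (mono_wedge_mono x K L).trans ((congrArg (mono x) h1).trans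
      ((mono_comp_perm x _ ρ).trans ?_))
    rw [hρ]
    funext p; ext v
    exact (congrArg (· * mono x (Fin.append L K) p v) (by simp)).trans (one_mul _)
  rw [omega, halfOmegaSq]
  simp only [add_wedge, wedge_add]
  rw [zero (K := ![0, 1]) (L := ![0, 1]) (by decide), zero (K := ![2, 3]) (L := ![2, 3]) (by decide),
    zero (K := ![4, 5]) (L := ![4, 5]) (by decide),
    same (K := ![0, 1]) (L := ![2, 3]) (N := ![0, 1, 2, 3]) (by decide),
    same (K := ![0, 1]) (L := ![4, 5]) (N := ![0, 1, 4, 5]) (by decide),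
    same (K := ![2, 3]) (L := ![4, 5]) (N := ![2, 3, 4, 5]) (by decide),
    swap (K := ![2, 3]) (L := ![0, 1]) (N := ![0, 1, 2, 3]) (by decide),
    swap (K := ![4, 5]) (L := ![0, 1]) (N := ![0, 1, 4, 5]) (by decide),
    swap (K := ![4, 5]) (L := ![2, 3]) (N := ![2, 3, 4, 5]) (by decide)]
  funext p; ext v
  have h : ∀ a b c : ℝ, 0 + a + b + (a + 0 + c) + (b + c + 0) = 2 * (a + b + c) := by
    intros; ring
  exact h (mono x ![0, 1, 2, 3] p v) (mono x ![0, 1, 4, 5] p v) (mono x ![2, 3, 4, 5] p v)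

/-- Every monomial of `ψ₊` takes one index from each of the pairs 12, 34, 56, so its product with a
monomial of `ω` repeats an index. The same is true of `ψ₋`. -/
theorem omega_wedge_psiPlus (x : Fin 6 → DForm (𝓡 6) M 1) : (omega x).wedge (psiPlus x) = 0 := by
  have zero : ∀ {K : Fin 2 → Fin 6} {L : Fin 3 → Fin 6}, ¬ Function.Injective (Fin.append K L) →
      (mono x K).wedge (mono x L) = 0 := fun h =>
    (mono_wedge_mono x _ _).trans (mono_of_not_injective x h)
  have z : ∀ {K : Fin 2 → Fin 6}, (K = ![0, 1] ∨ K = ![2, 3] ∨ K = ![4, 5]) →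
      (mono x K).wedge (psiPlus x) = 0 := by
    intro K hK
    rw [psiPlus, wedge_sub, wedge_sub, wedge_sub]
    rcases hK with rfl | rfl | rfl <;>
    rw [zero (by decide), zero (by decide), zero (by decide), zero (by decide)] <;> simp
  rw [omega, add_wedge, add_wedge, z (by decide), z (by decide), z (by decide)]
  simp

theorem omega_wedge_psiMinus (x : Fin 6 → DForm (𝓡 6) M 1) :
    (omega x).wedge (psiMinus x) = 0 := by
  have zero : ∀ {K : Fin 2 → Fin 6} {L : Fin 3 → Fin 6}, ¬ Function.Injective (Fin.append K L) →
      (mono x K).wedge (mono x L) = 0 := fun h =>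
    (mono_wedge_mono x _ _).trans (mono_of_not_injective x h)
  have z : ∀ {K : Fin 2 → Fin 6}, (K = ![0, 1] ∨ K = ![2, 3] ∨ K = ![4, 5]) →
      (mono x K).wedge (psiMinus x) = 0 := by
    intro K hK
    rw [psiMinus, wedge_add, wedge_add, wedge_add, wedge_neg]
    rcases hK with rfl | rfl | rfl <;>
    rw [zero (by decide), zero (by decide), zero (by decide), zero (by decide)] <;> simp
  rw [omega, add_wedge, add_wedge, z (by decide), z (by decide), z (by decide)]
  simp

theorem diffAt_omega {x : Fin 6 → DForm (𝓡 6) M 1} {p : M} (hx : ∀ i, (x i).DiffAt p) :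
    (omega x).DiffAt p :=
  ((diffAt_mono hx _).add (diffAt_mono hx _)).add (diffAt_mono hx _)

theorem diffAt_psiPlus {x : Fin 6 → DForm (𝓡 6) M 1} {p : M} (hx : ∀ i, (x i).DiffAt p) :
    (psiPlus x).DiffAt p :=
  (((diffAt_mono hx _).sub (diffAt_mono hx _)).sub (diffAt_mono hx _)).sub (diffAt_mono hx _)

theorem diffAt_psiMinus {x : Fin 6 → DForm (𝓡 6) M 1} {p : M} (hx : ∀ i, (x i).DiffAt p) :
    (psiMinus x).DiffAt p :=
  (((diffAt_mono hx _).neg.add (diffAt_mono hx _)).add (diffAt_mono hx _)).add (diffAt_mono hx _)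

theorem diffAt_halfOmegaSq {x : Fin 6 → DForm (𝓡 6) M 1} {p : M} (hx : ∀ i, (x i).DiffAt p) :
    (halfOmegaSq x).DiffAt p :=
  ((diffAt_mono hx _).add (diffAt_mono hx _)).add (diffAt_mono hx _)

theorem wedge_comm_two_three (α : DForm (𝓡 6) M 2) (β : DForm (𝓡 6) M 3) :
    (α.wedge β : DForm (𝓡 6) M 5) = β.wedge α := by
  funext p
  ext v
  exact wedgeAt_comm_two_three (α p) (β p) v

variable [IsManifold (𝓡 6) 1 M]

section

attribute [local irreducible] DForm.wedge DForm.d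

/-- Differentiate `ω ∧ ψ = 0`. Two of the three conditions defining `Ω³₁₂` are thus automatic once
`ψ±` are closed. -/
theorem d_omega_wedge_eq_zero {x : Fin 6 → DForm (𝓡 6) M 1} (hx : ∀ i p, (x i).DiffAt p)
    {ψ : DForm (𝓡 6) M 3} (hψ : ∀ p, ψ.DiffAt p) (hd : ψ.d = 0) (hw : (omega x).wedge ψ = 0) :
    (omega x).d.wedge ψ = 0 := by
  funext p
  ext v
  have h := d_wedge (diffAt_omega fun i => hx i p) (hψ p) v
  rw [hw, d_zero, hd, wedge_zero] at h
  have h1 : (0 : ℝ) = (omega x).d.wedge ψ p v + (-1 : ℝ) ^ 2 * 0 := h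
  simp only [mul_zero, add_zero] at h1
  exact h1.symm

/-- From `d(ω ∧ ω) = 2 dω ∧ ω`. The remaining condition for `dω ∈ Ω³₁₂` becomes a closedness
statement that can be read off `d⋆φ = 0`. -/
theorem d_halfOmegaSq_eq_zero_iff {x : Fin 6 → DForm (𝓡 6) M 1} (hx : ∀ i p, (x i).DiffAt p) :
    (halfOmegaSq x).d = 0 ↔ (omega x).d.wedge (omega x) = 0 := by
  have key : ∀ p (v : Fin 5 → TangentSpace (𝓡 6) p),
      (halfOmegaSq x).d p v = (omega x).d.wedge (omega x) p v := by
    intro p v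
    have h := d_wedge (diffAt_omega fun i => hx i p) (diffAt_omega fun i => hx i p) v
    rw [omega_wedge_omega, d_smul] at h
    have h1 : 2 * (halfOmegaSq x).d p v = (omega x).d.wedge (omega x) p v +
        (-1 : ℝ) ^ 2 * (omega x).wedge (omega x).d p v := h
    have h2 : (omega x).wedge (omega x).d p v = (omega x).d.wedge (omega x) p v :=
      congrFun (congrArg DFunLike.coe (congrFun (wedge_comm_two_three (omega x) (omega x).d) p)) v
    rw [h2] at h1
    linarith
  constructor
  · intro h
    funext p; ext v
    rw [← key p v, h]
  · intro h
    funext p; ext v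
    exact (key p v).trans (by rw [h])

end

end SixDim

/-! ### The codifferential and the Laplacian of closed forms. -/

section Codifferential

variable {E : Type*} [NormedAddCommGroup E] [NormedSpace ℝ E] {H : Type*} [TopologicalSpace H]
  {I : ModelWithCorners ℝ E H} {N : Type*} [TopologicalSpace N] [ChartedSpace H N] {j l n : ℕ}

theorem codiff_of_star_eq {θ : Fin n → DForm I N 1} (hs : Even (n * (j + 2) + 1))
    (hn : j + 1 + l = n) {η : DForm I N (j + 1)} {β : DForm I N l} (h : star θ hn η = β) :
    codiff θ hn η = star θ (by omega) β.d := by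
  subst h
  rw [codiff, hs.neg_one_pow]
  funext p
  ext v
  exact one_mul _

variable [I.Boundaryless] [IsManifold I 1 N]

theorem hodgeLaplacian_of_d_eq_zero {θ : Fin n → DForm I N 1} (hn : j + 1 + (l + 1) = n)
    {η : DForm I N (j + 1)} (h : η.d = 0) :
    hodgeLaplacian θ hn η = (codiff θ hn η).d := by
  rw [hodgeLaplacian, h, codiff, codiff, star_zero, d_zero, star_zero]
  funext p
  ext v
  have h0 : ∀ a b : ℝ, a + b * 0 = a := fun a b => by ring
  exact h0 _ _

end Codifferential

/-! ### The Laplacian of `⋆φ` for a warped structure. -/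

section WarpedFlow

variable {M : Type*} [TopologicalSpace M] [ChartedSpace (EuclideanSpace ℝ (Fin 6)) M] {k : ℕ}

theorem dualFormG2_warpedCoframe (f : ℝ) (x : Fin 6 → DForm (𝓡 6) M 1) :
    dualFormG2 (warpedCoframe f x) =
      fromBase (halfOmegaSq x) + (fromBase (psiPlus x)).wedge (f • ds7) := by
  rw [smul_ds7_eq_mono f x, halfOmegaSq, psiPlus]
  simp only [fromBase_add, fromBase_sub]
  rw [fromBase_mono f x (K := ![0, 1, 2, 3]) (K' := ![0, 1, 2, 3]) (by decide),
    fromBase_mono f x (K := ![0, 1, 4, 5]) (K' := ![0, 1, 4, 5]) (by decide),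
    fromBase_mono f x (K := ![2, 3, 4, 5]) (K' := ![2, 3, 4, 5]) (by decide),
    fromBase_mono f x (K := ![0, 2, 4]) (K' := ![0, 2, 4]) (by decide),
    fromBase_mono f x (K := ![0, 3, 5]) (K' := ![0, 3, 5]) (by decide),
    fromBase_mono f x (K := ![1, 2, 5]) (K' := ![1, 2, 5]) (by decide),
    fromBase_mono f x (K := ![1, 3, 4]) (K' := ![1, 3, 4]) (by decide)]
  rw [sub_wedge, sub_wedge, sub_wedge, mono_wedge_mono, mono_wedge_mono, mono_wedge_mono,
    mono_wedge_mono,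
    show Fin.append ![0, 2, 4] ![6] = (![0, 2, 4, 6] : Fin 4 → Fin 7) by decide,
    show Fin.append ![0, 3, 5] ![6] = (![0, 3, 5, 6] : Fin 4 → Fin 7) by decide,
    show Fin.append ![1, 2, 5] ![6] = (![1, 2, 5, 6] : Fin 4 → Fin 7) by decide,
    show Fin.append ![1, 3, 4] ![6] = (![1, 3, 4, 6] : Fin 4 → Fin 7) by decide]
  rw [dualFormG2]
  abel

variable [IsManifold (𝓡 6) 1 M]

theorem starWarpedG2_eq_dualFormG2 {x : Fin 6 → DForm (𝓡 6) M 1} (hx : IsCoframe x) {f : ℝ}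
    (hf : f ≠ 0) : starWarpedG2 f x = dualFormG2 (warpedCoframe f x) :=
  (congrArg (star (warpedCoframe f x) (rfl : 3 + 4 = 7)) (warpedG2_eq f x)).trans
    (star_formG2 (hx.warpedCoframe hf) finrank_model7 rfl)

theorem fromBase_eq_zero_iff {η : DForm (𝓡 6) M k} : fromBase η = 0 ↔ η = 0 := by
  constructor
  · intro h
    funext p
    ext v
    have h1 := fromBase_apply η (p, 1) fun i => (v i, 0)
    rw [h] at h1
    exact h1.symm
  · rintro rfl
    rfl

theorem diffAt_smul_ds7 (f : ℝ) (q : M × Circle) : (f • ds7 : DForm I7 (M × Circle) 1).DiffAt q :=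
  DForm.DiffAt.const_smul (diffAt_pullback_snd (diffAt_ds q.2)) f

theorem d_smul_ds7 (f : ℝ) : (f • ds7 : DForm I7 (M × Circle) 1).d = 0 := by
  have h : (ds7 : DForm I7 (M × Circle) 1).d = 0 := by
    rw [ds7, d_pullback_snd, d_ds]
    rfl
  rw [d_smul, h]
  funext p
  ext v
  exact mul_zero f

section

attribute [local irreducible] DForm.wedge DForm.d DForm.pullback

theorem d_fromBase_wedge_ds7 {η : DForm (𝓡 6) M k} (hη : ∀ p, η.DiffAt p) (f : ℝ)
    (q : M × Circle) (v : Fin (k + 1 + 1) → TangentSpace I7 q) :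
    ((fromBase η).wedge (f • ds7)).d q v = (fromBase η.d).wedge (f • ds7) q v := by
  refine (d_wedge (diffAt_pullback_fst (hη q.1)) (diffAt_smul_ds7 f q) v).trans ?_
  rw [d_smul_ds7, wedge_zero, d_pullback_fst]
  have h : ∀ a : ℝ, a + (-1 : ℝ) ^ k * 0 = a := fun a => by ring
  exact h _

/-- In `⋆φ = ½ω² + ψ₊ ∧ f ds` the second term is closed. Only `dψ₊ = 0` is assumed, so that the
formula is available before balancedness is known. -/
theorem d_starWarpedG2 {x : Fin 6 → DForm (𝓡 6) M 1} (hx : IsCoframe x)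
    (hd : ∀ i p, (x i).DiffAt p) {f : ℝ} (hf : f ≠ 0) (hψ : (psiPlus x).d = 0) :
    (starWarpedG2 f x).d = fromBase (halfOmegaSq x).d := by
  rw [starWarpedG2_eq_dualFormG2 hx hf, dualFormG2_warpedCoframe]
  funext q
  have h1 : (fromBase (halfOmegaSq x)).DiffAt q :=
    diffAt_pullback_fst (diffAt_halfOmegaSq fun i => hd i q.1)
  have h2 : (fromBase (psiPlus x)).DiffAt q :=
    diffAt_pullback_fst (diffAt_psiPlus fun i => hd i q.1)
  have h3 : ((fromBase (psiPlus x)).wedge (f • ds7)).d q = 0 := by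
    ext v
    refine (d_fromBase_wedge_ds7 (fun p => diffAt_psiPlus fun i => hd i p) f q v).trans ?_
    have h0 : fromBase (psiPlus x).d = 0 := fromBase_eq_zero_iff.2 hψ
    rw [h0, zero_wedge]
    rfl
  refine (d_add h1 (h2.wedge (diffAt_smul_ds7 f q))).trans ?_
  rw [d_pullback_fst, h3]
  exact add_zero _

theorem d_warpedG2 {x : Fin 6 → DForm (𝓡 6) M 1}
    (hd : ∀ i p, (x i).DiffAt p) (f : ℝ) (hψ : (psiMinus x).d = 0) :
    (warpedG2 f x).d = (fromBase (omega x).d).wedge (f • ds7) := by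
  rw [warpedG2, ← wedge_smul]
  funext q
  have h1 : (fromBase (omega x)).DiffAt q :=
    diffAt_pullback_fst (diffAt_omega fun i => hd i q.1)
  have h2 : (fromBase (psiMinus x)).DiffAt q :=
    diffAt_pullback_fst (diffAt_psiMinus fun i => hd i q.1)
  have h3 : (fromBase (psiMinus x)).d q = 0 := by
    have h0 : fromBase (psiMinus x).d = 0 := fromBase_eq_zero_iff.2 hψ
    rw [d_pullback_fst]
    exact congrFun h0 q
  refine (d_sub (h1.wedge (diffAt_smul_ds7 f q)) h2).trans ?_
  rw [h3]
  refine (sub_zero _).trans ?_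
  ext v
  exact d_fromBase_wedge_ds7 (fun p => diffAt_omega fun i => hd i p) f q v

theorem star_starWarpedG2 {x : Fin 6 → DForm (𝓡 6) M 1} (hx : IsCoframe x) {f : ℝ}
    (hf : f ≠ 0) :
    star (warpedCoframe f x) (rfl : 4 + 3 = 7) (starWarpedG2 f x) = warpedG2 f x :=
  (congrArg (star (warpedCoframe f x) (rfl : 4 + 3 = 7)) (starWarpedG2_eq_dualFormG2 hx hf)).trans
    ((star_dualFormG2 (hx.warpedCoframe hf) finrank_model7 rfl).trans (warpedG2_eq f x).symm)

theorem hodgeLaplacian_starWarpedG2 {x : Fin 6 → DForm (𝓡 6) M 1} (hx : IsCoframe x)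
    (hd : ∀ i p, (x i).DiffAt p) {f : ℝ} (hf : f ≠ 0) (hψ : (psiMinus x).d = 0)
    (hclosed : (starWarpedG2 f x).d = 0) (hn : 3 + 1 + (2 + 1) = 7) :
    hodgeLaplacian (warpedCoframe f x) (j := 3) (l := 2) hn (starWarpedG2 f x) =
      -fromBase (dStarNu3 x) := by
  have h0 : star (warpedCoframe f x) (rfl : 3 + 1 + 3 = 7) (starWarpedG2 f x) = warpedG2 f x :=
    star_starWarpedG2 hx hf
  have h1 : codiff (warpedCoframe f x) (j := 3) (l := 3) rfl (starWarpedG2 f x) =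
      star (warpedCoframe f x) (rfl : 3 + 1 + 3 = 7) (warpedG2 f x).d :=
    -- The sign exponent is `7 · 5 + 1 = 36`, so the codifferential here is `+⋆d⋆`.
    codiff_of_star_eq (j := 3) (l := 3) (n := 7) (by decide) rfl h0
  have h2 := congrArg (star (warpedCoframe f x) (rfl : 3 + 1 + 3 = 7)) (d_warpedG2 hd f hψ)
  have h3 := h1.trans (h2.trans (star_fromBase_wedge_ds7 hx hf (omega x).d))
  refine (hodgeLaplacian_of_d_eq_zero (j := 3) (l := 2) (n := 7) hn hclosed).trans ((congrArg DForm.d h3).trans ?_)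
  rw [d_neg, d_pullback_fst]
  rfl

end

end WarpedFlow

/-! ### Evaluating monomials on the dual frame. -/

section DualFrame

variable {E : Type*} [NormedAddCommGroup E] [NormedSpace ℝ E] [FiniteDimensional ℝ E]
  {H : Type*} [TopologicalSpace H]
  {I : ModelWithCorners ℝ E H} {N : Type*} [TopologicalSpace N] [ChartedSpace H N] {k n : ℕ}

theorem mono_dualFrame_self {θ : Fin n → DForm I N 1} (hθ : IsCoframe θ)
    (hE : Module.finrank ℝ E = n) (p : N) {K : Fin k → Fin n} (hK : Function.Injective K) :
    mono θ K p (fun i => dualFrame θ p (K i)) = 1 := by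
  rw [mono_dualFrame hθ hE, Finset.sum_eq_single 1]
  · simp
  · intro σ _ hσ
    rw [if_neg, mul_zero]
    exact fun h => hσ (Equiv.ext fun i => (hK (h i)).symm)
  · simp

theorem mono_dualFrame_eq_zero {θ : Fin n → DForm I N 1} (hθ : IsCoframe θ)
    (hE : Module.finrank ℝ E = n) (p : N) {K K' : Fin k → Fin n} (hK : ∃ i, ∀ j, K i ≠ K' j) :
    mono θ K p (fun i => dualFrame θ p (K' i)) = 0 := by
  obtain ⟨i, hi⟩ := hK
  rw [mono_dualFrame hθ hE, Finset.sum_eq_zero, Int.cast_zero]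
  intro σ _
  rw [if_neg, mul_zero]
  exact fun h => hi _ (h i)

end DualFrame

/-- The coefficient `c_{K 1} ⋯ c_{K k}` of a monomial in the coframe `cᵢ hⁱ`. -/
def diagCoeff {k n : ℕ} (c : Fin n → ℝ → ℝ) (K : Fin k → Fin n) (t : ℝ) : ℝ := ∏ i, c (K i) t

theorem differentiableAt_diagCoeff {k n : ℕ} {c : Fin n → ℝ → ℝ} {t : ℝ}
    (hc : ∀ i, DifferentiableAt ℝ (c i) t) (K : Fin k → Fin n) :
    DifferentiableAt ℝ (diagCoeff c K) t :=
  DifferentiableAt.fun_finsetProd fun i _ => hc (K i)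

theorem diagCoeff_snoc {k n : ℕ} (c : Fin n → ℝ → ℝ) (f : ℝ → ℝ) {K : Fin k → Fin n}
    {K' : Fin k → Fin (n + 1)} (hK : ∀ i, K' i = (K i).castSucc) :
    diagCoeff (Fin.snoc (α := fun _ => ℝ → ℝ) c f) K' = diagCoeff c K := by
  funext t
  refine Finset.prod_congr rfl fun i _ => ?_
  rw [hK, Fin.snoc_castSucc (α := fun _ => ℝ → ℝ)]

theorem diagCoeff_snoc_last {k n : ℕ} (c : Fin n → ℝ → ℝ) (f : ℝ → ℝ) {K : Fin k → Fin n}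
    {K' : Fin (k + 1) → Fin (n + 1)} (hK : ∀ i : Fin k, K' i.castSucc = (K i).castSucc)
    (hK' : K' (Fin.last k) = Fin.last n) :
    diagCoeff (Fin.snoc (α := fun _ => ℝ → ℝ) c f) K' = fun t => f t * diagCoeff c K t := by
  funext t
  rw [diagCoeff, Fin.prod_univ_castSucc, hK', Fin.snoc_last (α := fun _ => ℝ → ℝ), mul_comm]
  congr 1
  refine Finset.prod_congr rfl fun i _ => ?_
  rw [hK, Fin.snoc_castSucc (α := fun _ => ℝ → ℝ)]

/-! ### The diagonal ansatz and the reduced system in the fixed coframe. -/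

section Ansatz

variable {M : Type*} [TopologicalSpace M] [ChartedSpace (EuclideanSpace ℝ (Fin 6)) M] {k : ℕ}

theorem mono_ansatz (h : Fin 6 → DForm (𝓡 6) M 1) (c : Fin 6 → ℝ → ℝ) (t : ℝ)
    (K : Fin k → Fin 6) : mono (ansatz h c t) K = diagCoeff c K t • mono h K :=
  mono_const_smul h (fun i => c i t) K

theorem diffAt_ansatz {h : Fin 6 → DForm (𝓡 6) M 1} (hd : ∀ i p, (h i).DiffAt p)
    (c : Fin 6 → ℝ → ℝ) (t : ℝ) (i : Fin 6) (p : M) : (ansatz h c t i).DiffAt p :=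
  (hd i p).const_smul (c i t)

theorem IsCoframe.ansatz {h : Fin 6 → DForm (𝓡 6) M 1} (hh : IsCoframe h) {c : Fin 6 → ℝ → ℝ}
    {t : ℝ} (hc : ∀ i, c i t ≠ 0) : IsCoframe (ansatz h c t) := fun p =>
  (hh p).units_smul fun i => Units.mk0 (c i t) (hc i)

theorem warpedCoframe_ansatz (f : ℝ → ℝ) (h : Fin 6 → DForm (𝓡 6) M 1) (c : Fin 6 → ℝ → ℝ)
    (t : ℝ) : warpedCoframe (f t) (ansatz h c t) =
      fun i => (Fin.snoc (α := fun _ => ℝ → ℝ) c f : Fin 7 → ℝ → ℝ) i t • warpedCoframe 1 h i := by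
  funext i
  refine Fin.lastCases ?_ (fun j => ?_) i
  · refine (warpedCoframe_last _ _).trans ?_
    rw [Fin.snoc_last (n := 6) (α := fun _ => ℝ → ℝ)]
    refine Eq.trans ?_ (congrArg (f t • ·) (warpedCoframe_last 1 h).symm)
    funext p
    ext v
    exact congrArg (f t * ·) (one_mul _).symm
  · rw [warpedCoframe_castSucc, warpedCoframe_castSucc,
      Fin.snoc_castSucc (n := 6) (α := fun _ => ℝ → ℝ)]
    rfl

theorem mono_warpedCoframe_ansatz (f : ℝ → ℝ) (h : Fin 6 → DForm (𝓡 6) M 1)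
    (c : Fin 6 → ℝ → ℝ) (t : ℝ) (K : Fin k → Fin 7) :
    mono (warpedCoframe (f t) (ansatz h c t)) K =
      diagCoeff (Fin.snoc (α := fun _ => ℝ → ℝ) c f : Fin 7 → ℝ → ℝ) K t •
        mono (warpedCoframe 1 h) K := by
  rw [warpedCoframe_ansatz]
  exact mono_const_smul _ _ K

/-- The coflow at time `t` in terms of the fixed coframe `h`. -/
def CoframeEquations (f : ℝ → ℝ) (h : Fin 6 → DForm (𝓡 6) M 1) (c : Fin 6 → ℝ → ℝ) (t : ℝ) :
    Prop :=
  (deriv (fun τ => f τ * diagCoeff c ![0, 2, 4] τ) t = 0 ∧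
    deriv (fun τ => f τ * diagCoeff c ![0, 3, 5] τ) t = 0 ∧
    deriv (fun τ => f τ * diagCoeff c ![1, 2, 5] τ) t = 0 ∧
    deriv (fun τ => f τ * diagCoeff c ![1, 3, 4] τ) t = 0) ∧
  ∀ p v, dStarNu3 (ansatz h c t) p v =
    deriv (diagCoeff c ![0, 1, 2, 3]) t * mono h ![0, 1, 2, 3] p v +
      deriv (diagCoeff c ![0, 1, 4, 5]) t * mono h ![0, 1, 4, 5] p v +
      deriv (diagCoeff c ![2, 3, 4, 5]) t * mono h ![2, 3, 4, 5] p v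

theorem hasDerivAt_halfOmegaSq_ansatz (h : Fin 6 → DForm (𝓡 6) M 1) {c : Fin 6 → ℝ → ℝ} {t : ℝ}
    (hc : ∀ i, DifferentiableAt ℝ (c i) t) (p : M) (v : Fin 4 → TangentSpace (𝓡 6) p) :
    HasDerivAt (fun τ => halfOmegaSq (ansatz h c τ) p v)
      (deriv (diagCoeff c ![0, 1, 2, 3]) t * mono h ![0, 1, 2, 3] p v +
      deriv (diagCoeff c ![0, 1, 4, 5]) t * mono h ![0, 1, 4, 5] p v +
      deriv (diagCoeff c ![2, 3, 4, 5]) t * mono h ![2, 3, 4, 5] p v) t := by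
  have hK : ∀ K : Fin 4 → Fin 6, HasDerivAt (fun τ => mono (ansatz h c τ) K p v)
      (deriv (diagCoeff c K) t * mono h K p v) t := by
    intro K
    simp only [mono_ansatz]
    exact (differentiableAt_diagCoeff hc K).hasDerivAt.mul_const _
  exact ((hK _).fun_add (hK _)).fun_add (hK _)

theorem hasDerivAt_psiPlus_ansatz (h : Fin 6 → DForm (𝓡 6) M 1) {c : Fin 6 → ℝ → ℝ} {t : ℝ}
    (hc : ∀ i, DifferentiableAt ℝ (c i) t) (p : M) (v : Fin 3 → TangentSpace (𝓡 6) p) :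
    HasDerivAt (fun τ => psiPlus (ansatz h c τ) p v)
      (deriv (diagCoeff c ![0, 2, 4]) t * mono h ![0, 2, 4] p v -
      deriv (diagCoeff c ![0, 3, 5]) t * mono h ![0, 3, 5] p v -
      deriv (diagCoeff c ![1, 2, 5]) t * mono h ![1, 2, 5] p v -
      deriv (diagCoeff c ![1, 3, 4]) t * mono h ![1, 3, 4] p v) t := by
  have hK : ∀ K : Fin 3 → Fin 6, HasDerivAt (fun τ => mono (ansatz h c τ) K p v)
      (deriv (diagCoeff c K) t * mono h K p v) t := by
    intro K
    simp only [mono_ansatz]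
    exact (differentiableAt_diagCoeff hc K).hasDerivAt.mul_const _
  exact (((hK _).fun_sub (hK _)).fun_sub (hK _)).fun_sub (hK _)

/-- After multiplication by `f` the second equation says `∂ₜ(fψ₊) = 0`. A point of `M` is needed to
read off its four coefficients, by evaluation on the dual frame of `h`. The factors 2 in the first
equation cancel because `ω² = 2 · ½ω²`. -/
theorem solvesBalancedSystem_iff [Nonempty M] {h : Fin 6 → DForm (𝓡 6) M 1} (hh : IsCoframe h)
    {J : Set ℝ} {f : ℝ → ℝ} (hf : ∀ t ∈ J, DifferentiableAt ℝ f t) (hf0 : ∀ t ∈ J, f t ≠ 0)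
    {c : Fin 6 → ℝ → ℝ} (hc : ∀ i, ∀ t ∈ J, DifferentiableAt ℝ (c i) t) :
    SolvesBalancedSystem J f (ansatz h c) ↔ ∀ t ∈ J, CoframeEquations f h c t := by
  refine forall₂_congr fun t ht => ?_
  have hct : ∀ i, DifferentiableAt ℝ (c i) t := fun i => hc i t ht
  have hder : ∀ K : Fin 3 → Fin 6, deriv (fun τ => f τ * diagCoeff c K τ) t =
      deriv f t * diagCoeff c K t + f t * deriv (diagCoeff c K) t := fun K =>
    deriv_fun_mul (hf t ht) (differentiableAt_diagCoeff hct K)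
  rw [and_comm]
  refine and_congr ?_ (forall₂_congr fun p v => ?_)
  · have hψ : ∀ p v, psiPlus (ansatz h c t) p v = diagCoeff c ![0, 2, 4] t * mono h ![0, 2, 4] p v -
        diagCoeff c ![0, 3, 5] t * mono h ![0, 3, 5] p v -
        diagCoeff c ![1, 2, 5] t * mono h ![1, 2, 5] p v -
        diagCoeff c ![1, 3, 4] t * mono h ![1, 3, 4] p v := by
      intro p v
      simp only [psiPlus, mono_ansatz]
      rfl
    have hiff : ∀ p v, (∃ ψ' : ℝ, HasDerivAt (fun τ => psiPlus (ansatz h c τ) p v) ψ' t ∧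
        deriv f t / f t * psiPlus (ansatz h c t) p v + ψ' = 0) ↔
        deriv (fun τ => f τ * diagCoeff c ![0, 2, 4] τ) t * mono h ![0, 2, 4] p v -
        deriv (fun τ => f τ * diagCoeff c ![0, 3, 5] τ) t * mono h ![0, 3, 5] p v -
        deriv (fun τ => f τ * diagCoeff c ![1, 2, 5] τ) t * mono h ![1, 2, 5] p v -
        deriv (fun τ => f τ * diagCoeff c ![1, 3, 4] τ) t * mono h ![1, 3, 4] p v = 0 := by
      intro p v
      have hd := hasDerivAt_psiPlus_ansatz h hct p v
      have hft := hf0 t ht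
      simp only [hder, hψ]
      constructor
      · rintro ⟨ψ', h1, h2⟩
        rw [h1.unique hd] at h2
        field_simp at h2
        linear_combination h2
      · intro h1
        refine ⟨_, hd, ?_⟩
        field_simp
        linear_combination h1
    simp only [hiff]
    constructor
    · intro H
      obtain ⟨p⟩ := ‹Nonempty M›
      have hself : ∀ {K : Fin 3 → Fin 6}, Function.Injective K →
          mono h K p (fun i => dualFrame h p (K i)) = 1 := mono_dualFrame_self hh finrank_model6 p
      have hzero : ∀ {K K' : Fin 3 → Fin 6}, (∃ i, ∀ j, K i ≠ K' j) →
          mono h K p (fun i => dualFrame h p (K' i)) = 0 :=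
        mono_dualFrame_eq_zero hh finrank_model6 p
      have e := fun K : Fin 3 → Fin 6 => H p fun i => dualFrame h p (K i)
      have e1 := e ![0, 2, 4]
      have e2 := e ![0, 3, 5]
      have e3 := e ![1, 2, 5]
      have e4 := e ![1, 3, 4]
      rw [hself (by decide), hzero (by decide), hzero (by decide), hzero (by decide)] at e1
      rw [hzero (by decide), hself (by decide), hzero (by decide), hzero (by decide)] at e2
      rw [hzero (by decide), hzero (by decide), hself (by decide), hzero (by decide)] at e3
      rw [hzero (by decide), hzero (by decide), hzero (by decide), hself (by decide)] at e4
      exact ⟨by linarith, by linarith, by linarith, by linarith⟩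
    · rintro ⟨h1, h2, h3, h4⟩ p v
      rw [h1, h2, h3, h4]
      ring
  · have hd := (hasDerivAt_halfOmegaSq_ansatz h hct p v).const_mul 2
    have hw : (fun τ => (omega (ansatz h c τ)).wedge (omega (ansatz h c τ)) p v) =
        fun τ => 2 * halfOmegaSq (ansatz h c τ) p v := by
      funext τ
      rw [omega_wedge_omega]
      rfl
    rw [hw]
    constructor
    · intro h1
      have := h1.unique hd
      linarith
    · intro h1
      rw [h1]
      exact hd

end Ansatz

/-! ### The coflow in the fixed coframe. -/

section Coflow

variable {M : Type*} [TopologicalSpace M] [ChartedSpace (EuclideanSpace ℝ (Fin 6)) M]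

theorem hasDerivAt_dualFormG2_ansatz (h : Fin 6 → DForm (𝓡 6) M 1) {c : Fin 6 → ℝ → ℝ}
    {f : ℝ → ℝ} {t : ℝ} (hc : ∀ i, DifferentiableAt ℝ (c i) t) (hf : DifferentiableAt ℝ f t)
    (q : M × Circle) (v : Fin 4 → TangentSpace I7 q) :
    HasDerivAt (fun τ => dualFormG2 (warpedCoframe (f τ) (ansatz h c τ)) q v)
      (deriv (diagCoeff c ![2, 3, 4, 5]) t * mono (warpedCoframe 1 h) ![2, 3, 4, 5] q v +
      deriv (diagCoeff c ![0, 1, 4, 5]) t * mono (warpedCoframe 1 h) ![0, 1, 4, 5] q v +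
      deriv (diagCoeff c ![0, 1, 2, 3]) t * mono (warpedCoframe 1 h) ![0, 1, 2, 3] q v +
      deriv (fun τ => f τ * diagCoeff c ![0, 2, 4] τ) t *
        mono (warpedCoframe 1 h) ![0, 2, 4, 6] q v -
      deriv (fun τ => f τ * diagCoeff c ![0, 3, 5] τ) t *
        mono (warpedCoframe 1 h) ![0, 3, 5, 6] q v -
      deriv (fun τ => f τ * diagCoeff c ![1, 2, 5] τ) t *
        mono (warpedCoframe 1 h) ![1, 2, 5, 6] q v -
      deriv (fun τ => f τ * diagCoeff c ![1, 3, 4] τ) t *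
        mono (warpedCoframe 1 h) ![1, 3, 4, 6] q v) t := by
  let b : Fin 7 → ℝ → ℝ := Fin.snoc (n := 6) (α := fun _ => ℝ → ℝ) c f
  have hb : ∀ i, DifferentiableAt ℝ (b i) t := by
    intro i
    refine Fin.lastCases (motive := fun i => DifferentiableAt ℝ (b i) t) ?_ (fun j => ?_) i
    · simp only [b, Fin.snoc_last (n := 6) (α := fun _ => ℝ → ℝ)]
      exact hf
    · simp only [b, Fin.snoc_castSucc (n := 6) (α := fun _ => ℝ → ℝ)]
      exact hc j
  have hK : ∀ K : Fin 4 → Fin 7,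
      HasDerivAt (fun τ => mono (warpedCoframe (f τ) (ansatz h c τ)) K q v)
        (deriv (diagCoeff b K) t * mono (warpedCoframe 1 h) K q v) t := by
    intro K
    simp only [mono_warpedCoframe_ansatz]
    exact (differentiableAt_diagCoeff hb K).hasDerivAt.mul_const _
  rw [← diagCoeff_snoc c f (K := ![2, 3, 4, 5]) (K' := ![2, 3, 4, 5]) (by decide),
    ← diagCoeff_snoc c f (K := ![0, 1, 4, 5]) (K' := ![0, 1, 4, 5]) (by decide),
    ← diagCoeff_snoc c f (K := ![0, 1, 2, 3]) (K' := ![0, 1, 2, 3]) (by decide),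
    ← diagCoeff_snoc_last c f (K := ![0, 2, 4]) (K' := ![0, 2, 4, 6]) (by decide) rfl,
    ← diagCoeff_snoc_last c f (K := ![0, 3, 5]) (K' := ![0, 3, 5, 6]) (by decide) rfl,
    ← diagCoeff_snoc_last c f (K := ![1, 2, 5]) (K' := ![1, 2, 5, 6]) (by decide) rfl,
    ← diagCoeff_snoc_last c f (K := ![1, 3, 4]) (K' := ![1, 3, 4, 6]) (by decide) rfl]
  exact ((((((hK _).fun_add (hK _)).fun_add (hK _)).fun_add (hK _)).fun_sub (hK _)).fun_sub
    (hK _)).fun_sub (hK _)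

theorem neg_neg_apply (η : DForm I7 (M × Circle) 4) (q : M × Circle)
    (v : Fin 4 → TangentSpace I7 q) : -((-η) q v) = η q v := neg_neg _

theorem mono_warpedCoframe_apply (h : Fin 6 → DForm (𝓡 6) M 1) {K : Fin 4 → Fin 6}
    {K' : Fin 4 → Fin 7} (hK : ∀ i, K' i = (K i).castSucc) (q : M × Circle)
    (v : Fin 4 → TangentSpace I7 q) :
    mono (warpedCoframe 1 h) K' q v = fromBase (mono h K) q v := by
  rw [fromBase_mono 1 h hK]

variable [IsManifold (𝓡 6) 1 M]

theorem fst_dualFrame_last {h : Fin 6 → DForm (𝓡 6) M 1} (hh : IsCoframe h) (q : M × Circle) :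
    (dualFrame (warpedCoframe 1 h) q 6 : EuclideanSpace ℝ (Fin 6) × EuclideanSpace ℝ (Fin 1)).1 =
      0 := by
  have h1 : ∀ i, covector (h i q.1) (dualFrame (warpedCoframe 1 h) q 6 :
      EuclideanSpace ℝ (Fin 6) × EuclideanSpace ℝ (Fin 1)).1 = 0 := by
    intro i
    have h2 := covector_dualFrame (hh.warpedCoframe one_ne_zero) finrank_model7 q i.castSucc 6
    rw [if_neg (show i.castSucc ≠ 6 from (Fin.castSucc_lt_last i).ne), warpedCoframe_castSucc] at h2
    exact (fromBase_apply (h i) q _).symm.trans h2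
  refine (eq_sum_covector_smul_dualFrame hh finrank_model6 q.1 _).trans ?_
  refine Finset.sum_eq_zero fun i _ => ?_
  rw [h1]
  exact zero_smul _ _

theorem fromBase_dualFrame_last {h : Fin 6 → DForm (𝓡 6) M 1} (hh : IsCoframe h)
    (η : DForm (𝓡 6) M 4) (q : M × Circle) {K : Fin 4 → Fin 7} (hK : K 3 = 6) :
    fromBase η q (fun i => dualFrame (warpedCoframe 1 h) q (K i)) = 0 := by
  refine (fromBase_apply η q _).trans ((η q.1).map_coord_zero 3 ?_)
  rw [hK]
  exact fst_dualFrame_last hh q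

/-- Splitting by `ds`: a form pulled back from `M` vanishes when one argument is the last dual frame
vector, so evaluation on such arguments isolates the four coefficients of `fψ₊`. What remains is an
identity of forms on `M`. -/
theorem coframeEquations_iff [Nonempty M] {h : Fin 6 → DForm (𝓡 6) M 1} (hh : IsCoframe h)
    (f : ℝ → ℝ) (c : Fin 6 → ℝ → ℝ) (t : ℝ) :
    CoframeEquations f h c t ↔ ∀ (q : M × Circle) (v : Fin 4 → TangentSpace I7 q),
      fromBase (dStarNu3 (ansatz h c t)) q v =
      deriv (diagCoeff c ![2, 3, 4, 5]) t * mono (warpedCoframe 1 h) ![2, 3, 4, 5] q v +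
      deriv (diagCoeff c ![0, 1, 4, 5]) t * mono (warpedCoframe 1 h) ![0, 1, 4, 5] q v +
      deriv (diagCoeff c ![0, 1, 2, 3]) t * mono (warpedCoframe 1 h) ![0, 1, 2, 3] q v +
      deriv (fun τ => f τ * diagCoeff c ![0, 2, 4] τ) t *
        mono (warpedCoframe 1 h) ![0, 2, 4, 6] q v -
      deriv (fun τ => f τ * diagCoeff c ![0, 3, 5] τ) t *
        mono (warpedCoframe 1 h) ![0, 3, 5, 6] q v -
      deriv (fun τ => f τ * diagCoeff c ![1, 2, 5] τ) t *
        mono (warpedCoframe 1 h) ![1, 2, 5, 6] q v -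
      deriv (fun τ => f τ * diagCoeff c ![1, 3, 4] τ) t *
        mono (warpedCoframe 1 h) ![1, 3, 4, 6] q v := by
  have hb1 : ∀ (q : M × Circle) (v : Fin 4 → TangentSpace I7 q), mono (warpedCoframe 1 h)
      ![2, 3, 4, 5] q v = mono h ![2, 3, 4, 5] q.1 (fun i => (v i).1) := fun q v =>
    (mono_warpedCoframe_apply h (by decide) q v).trans (fromBase_apply _ q v)
  have hb2 : ∀ (q : M × Circle) (v : Fin 4 → TangentSpace I7 q), mono (warpedCoframe 1 h)
      ![0, 1, 4, 5] q v = mono h ![0, 1, 4, 5] q.1 (fun i => (v i).1) := fun q v =>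
    (mono_warpedCoframe_apply h (by decide) q v).trans (fromBase_apply _ q v)
  have hb3 : ∀ (q : M × Circle) (v : Fin 4 → TangentSpace I7 q), mono (warpedCoframe 1 h)
      ![0, 1, 2, 3] q v = mono h ![0, 1, 2, 3] q.1 (fun i => (v i).1) := fun q v =>
    (mono_warpedCoframe_apply h (by decide) q v).trans (fromBase_apply _ q v)
  constructor
  · rintro ⟨⟨h1, h2, h3, h4⟩, h5⟩ q v
    rw [h1, h2, h3, h4, hb1, hb2, hb3]
    refine (fromBase_apply _ q v).trans ((h5 q.1 fun i => (v i).1).trans ?_)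
    ring
  · intro H
    have hz : deriv (fun τ => f τ * diagCoeff c ![0, 2, 4] τ) t = 0 ∧
        deriv (fun τ => f τ * diagCoeff c ![0, 3, 5] τ) t = 0 ∧
        deriv (fun τ => f τ * diagCoeff c ![1, 2, 5] τ) t = 0 ∧
        deriv (fun τ => f τ * diagCoeff c ![1, 3, 4] τ) t = 0 := by
      obtain ⟨p⟩ := ‹Nonempty M›
      have hθ : IsCoframe (warpedCoframe 1 h) := hh.warpedCoframe one_ne_zero
      have hself : ∀ {K : Fin 4 → Fin 7}, Function.Injective K → mono (warpedCoframe 1 h) K (p, 1)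
          (fun i => dualFrame (warpedCoframe 1 h) (p, 1) (K i)) = 1 :=
        mono_dualFrame_self hθ finrank_model7 (p, 1)
      have hzero : ∀ {K K' : Fin 4 → Fin 7}, (∃ i, ∀ j, K i ≠ K' j) →
          mono (warpedCoframe 1 h) K (p, 1)
            (fun i => dualFrame (warpedCoframe 1 h) (p, 1) (K' i)) = 0 :=
        mono_dualFrame_eq_zero hθ finrank_model7 (p, 1)
      have e := fun (K : Fin 4 → Fin 7) (hK : K 3 = 6) =>
        (fromBase_dualFrame_last hh (dStarNu3 (ansatz h c t)) (p, 1) hK).symm.trans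
          (H (p, 1) fun i => dualFrame (warpedCoframe 1 h) (p, 1) (K i))
      have e1 := e ![0, 2, 4, 6] rfl
      have e2 := e ![0, 3, 5, 6] rfl
      have e3 := e ![1, 2, 5, 6] rfl
      have e4 := e ![1, 3, 4, 6] rfl
      rw [hzero (by decide), hzero (by decide), hzero (by decide), hself (by decide),
        hzero (by decide), hzero (by decide), hzero (by decide)] at e1
      rw [hzero (by decide), hzero (by decide), hzero (by decide), hzero (by decide),
        hself (by decide), hzero (by decide), hzero (by decide)] at e2
      rw [hzero (by decide), hzero (by decide), hzero (by decide), hzero (by decide),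
        hzero (by decide), hself (by decide), hzero (by decide)] at e3
      rw [hzero (by decide), hzero (by decide), hzero (by decide), hzero (by decide),
        hzero (by decide), hzero (by decide), hself (by decide)] at e4
      exact ⟨by linarith, by linarith, by linarith, by linarith⟩
    refine ⟨hz, fun p v => ?_⟩
    obtain ⟨h1, h2, h3, h4⟩ := hz
    -- Vectors on `M` are lifted with zero circle component, at the arbitrary circle point 1.
    obtain ⟨w, hw⟩ : ∃ w : Fin 4 → TangentSpace I7 ((p, 1) : M × Circle),
        (fun i => (w i).1) = v := ⟨fun i => (v i, 0), rfl⟩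
    have e := H (p, 1) w
    rw [h1, h2, h3, h4, hb1, hb2, hb3] at e
    rw [← hw]
    refine (fromBase_apply (dStarNu3 (ansatz h c t)) (p, 1) w).symm.trans (e.trans ?_)
    ring

theorem neg_hodgeLaplacian_starWarpedG2_apply {x : Fin 6 → DForm (𝓡 6) M 1} (hx : IsCoframe x)
    (hd : ∀ i p, (x i).DiffAt p) {f : ℝ} (hf : f ≠ 0) (hψ : (psiMinus x).d = 0)
    (hclosed : (starWarpedG2 f x).d = 0) (hn : 3 + 1 + (2 + 1) = 7) (q : M × Circle)
    (v : Fin 4 → TangentSpace I7 q) :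
    -(hodgeLaplacian (warpedCoframe f x) (j := 3) (l := 2) hn (starWarpedG2 f x) q v) =
      fromBase (dStarNu3 x) q v :=
  (congrArg (fun η : DForm I7 (M × Circle) 4 => -(η q v))
    (hodgeLaplacian_starWarpedG2 hx hd hf hψ hclosed hn)).trans (neg_neg_apply _ q v)

/-- The explicit formula for `⋆φ` requires a coframe, hence nonvanishing coefficients, which are
given only on `J`. Openness of `J` makes this enough for time derivatives. -/
theorem starWarpedG2_ansatz_eventuallyEq {h : Fin 6 → DForm (𝓡 6) M 1} (hh : IsCoframe h)
    {J : Set ℝ} (hJ : IsOpen J) {f : ℝ → ℝ} (hf0 : ∀ t ∈ J, f t ≠ 0)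
    {c : Fin 6 → ℝ → ℝ} (hc0 : ∀ i, ∀ t ∈ J, c i t ≠ 0) {t : ℝ} (ht : t ∈ J)
    (q : M × Circle) (v : Fin 4 → TangentSpace I7 q) :
    (fun τ => starWarpedG2 (f τ) (ansatz h c τ) q v) =ᶠ[nhds t]
      fun τ => dualFormG2 (warpedCoframe (f τ) (ansatz h c τ)) q v := by
  filter_upwards [hJ.mem_nhds ht] with τ hτ
  exact congrArg (fun η : DForm I7 (M × Circle) 4 => η q v)
    (starWarpedG2_eq_dualFormG2 (hh.ansatz fun i => hc0 i τ hτ) (hf0 τ hτ))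

theorem solvesLaplacianCoflow_iff [Nonempty M] {h : Fin 6 → DForm (𝓡 6) M 1} (hh : IsCoframe h)
    (hd : ∀ i p, (h i).DiffAt p) {J : Set ℝ} (hJ : IsOpen J)
    {f : ℝ → ℝ} (hf : ∀ t ∈ J, DifferentiableAt ℝ f t) (hf0 : ∀ t ∈ J, f t ≠ 0)
    {c : Fin 6 → ℝ → ℝ} (hc : ∀ i, ∀ t ∈ J, DifferentiableAt ℝ (c i) t)
    (hc0 : ∀ i, ∀ t ∈ J, c i t ≠ 0) (hbal : ∀ t ∈ J, IsBalanced (ansatz h c t)) :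
    SolvesLaplacianCoflow J f (ansatz h c) ↔ ∀ t ∈ J, CoframeEquations f h c t := by
  refine forall₂_congr fun t ht => ?_
  have hcof : IsCoframe (ansatz h c t) := hh.ansatz fun i => hc0 i t ht
  have hdt : ∀ i p, (ansatz h c t i).DiffAt p := diffAt_ansatz hd c t
  have hclosed : (starWarpedG2 (f t) (ansatz h c t)).d = 0 :=
    (d_starWarpedG2 hcof hdt (hf0 t ht) (hbal t ht).2.1).trans
      (fromBase_eq_zero_iff.2 ((d_halfOmegaSq_eq_zero_iff hdt).2 (hbal t ht).1.1))
  have hder := hasDerivAt_dualFormG2_ansatz h (fun i => hc i t ht) (hf t ht)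
  have heq := fun (q : M × Circle) (v : Fin 4 → TangentSpace I7 q) =>
    starWarpedG2_ansatz_eventuallyEq hh hJ hf0 hc0 ht q v
  rw [coframeEquations_iff hh, and_iff_right hclosed]
  refine forall₂_congr fun q v => ?_
  rw [neg_hodgeLaplacian_starWarpedG2_apply hcof hdt (hf0 t ht) (hbal t ht).2.2 hclosed,
    (heq q v).hasDerivAt_iff]
  constructor
  · intro h1
    exact h1.unique (hder q v)
  · intro h1
    rw [h1]
    exact hder q v

end Coflow

/-! ### From the coframe equations to the equations (3) and (4). -/

section Coefficients

variable {J : Set ℝ} {c : Fin 6 → ℝ → ℝ} {f : ℝ → ℝ}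

theorem pos_of_continuousOn_of_ne_zero {g : ℝ → ℝ} (hJ : J.OrdConnected) (h0 : (0 : ℝ) ∈ J)
    (hg : ContinuousOn g J) (hne : ∀ t ∈ J, g t ≠ 0) (hg0 : 0 < g 0) {t : ℝ} (ht : t ∈ J) :
    0 < g t := by
  by_contra! hneg
  obtain ⟨s, hs, hs0⟩ := hJ.isPreconnected.intermediate_value ht h0 hg ⟨hneg, hg0.le⟩
  exact hne s hs hs0

theorem diagCoeff_three (a b d : Fin 6) (t : ℝ) :
    diagCoeff c ![a, b, d] t = c a t * c b t * c d t := by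
  simp [diagCoeff, Fin.prod_univ_succ, mul_assoc]

theorem diagCoeff_four (a b d e : Fin 6) (t : ℝ) :
    diagCoeff c ![a, b, d, e] t = c a t * c b t * c d t * c e t := by
  simp [diagCoeff, Fin.prod_univ_succ, mul_assoc]

/-- The four products are conserved and all equal `f 0` at time 0. Positivity of the `c i` then
excludes the other solutions of the resulting equations, in which some pairs agree only up to sign.
-/
theorem pairsAgree_of_deriv_eq_zero (hJopen : IsOpen J) (hJ : J.OrdConnected) (h0 : (0 : ℝ) ∈ J)
    (hf : ∀ t ∈ J, DifferentiableAt ℝ f t) (hf0 : ∀ t ∈ J, f t ≠ 0)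
    (hc : ∀ i, ∀ t ∈ J, DifferentiableAt ℝ (c i) t) (hne : ∀ i, ∀ t ∈ J, c i t ≠ 0)
    (hc0 : ∀ i, c i 0 = 1)
    (h : ∀ t ∈ J, deriv (fun τ => f τ * diagCoeff c ![0, 2, 4] τ) t = 0 ∧
      deriv (fun τ => f τ * diagCoeff c ![0, 3, 5] τ) t = 0 ∧
      deriv (fun τ => f τ * diagCoeff c ![1, 2, 5] τ) t = 0 ∧
      deriv (fun τ => f τ * diagCoeff c ![1, 3, 4] τ) t = 0) :
    PairsAgree J c := by
  intro t ht
  have hpos : ∀ i, 0 < c i t := fun i =>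
    pos_of_continuousOn_of_ne_zero hJ h0
      (fun s hs => (hc i s hs).continuousAt.continuousWithinAt) (hne i) (by rw [hc0]; norm_num) ht
  have hconst : ∀ a b d : Fin 6, (∀ s ∈ J, deriv (fun τ => f τ * diagCoeff c ![a, b, d] τ) s = 0) →
      f t * (c a t * c b t * c d t) = f 0 := by
    intro a b d hs
    have h1 : f t * diagCoeff c ![a, b, d] t = f 0 * diagCoeff c ![a, b, d] 0 :=
      hJopen.is_const_of_deriv_eq_zero hJ.isPreconnected
      (fun s hs => ((hf s hs).mul
        (differentiableAt_diagCoeff (fun i => hc i s hs) _)).differentiableWithinAt)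
      (fun s hs' => hs s hs') ht h0
    simpa [diagCoeff_three, hc0] using h1
  have e1 := hconst 0 2 4 fun s hs => (h s hs).1
  have e2 := hconst 0 3 5 fun s hs => (h s hs).2.1
  have e3 := hconst 1 2 5 fun s hs => (h s hs).2.2.1
  have e4 := hconst 1 3 4 fun s hs => (h s hs).2.2.2
  have k1 : c 2 t * c 4 t = c 3 t * c 5 t :=
    mul_left_cancel₀ (mul_ne_zero (hf0 t ht) (hpos 0).ne') (by linear_combination e1 - e2)
  have k2 : c 2 t * c 5 t = c 3 t * c 4 t :=
    mul_left_cancel₀ (mul_ne_zero (hf0 t ht) (hpos 1).ne') (by linear_combination e3 - e4)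
  have k3 : c 3 t = c 2 t := by
    -- Multiplying `k1` by `k2` gives `c₂² c₄c₅ = c₃² c₄c₅` (indices from 0).
    have : c 3 t ^ 2 = c 2 t ^ 2 :=
      mul_left_cancel₀ (mul_pos (hpos 4) (hpos 5)).ne'
        (by linear_combination -c 2 t * c 5 t * k1 - c 3 t * c 5 t * k2)
    exact (pow_left_inj₀ (hpos 3).le (hpos 2).le two_ne_zero).1 this
  have k4 : c 5 t = c 4 t :=
    mul_left_cancel₀ (hpos 2).ne' (by rw [k2, k3])
  have k5 : c 1 t = c 0 t :=
    mul_left_cancel₀ (mul_pos (hpos 2) (hpos 4)).ne'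
      (mul_left_cancel₀ (hf0 t ht) (by rw [k3] at e4; linear_combination e4 - e1))
  exact ⟨k5, k3, k4⟩

theorem hasDerivAt_sq_mul_sq {g₁ g₂ : ℝ → ℝ} {t : ℝ} (h1 : DifferentiableAt ℝ g₁ t)
    (h2 : DifferentiableAt ℝ g₂ t) (n1 : g₁ t ≠ 0) (n2 : g₂ t ≠ 0) :
    HasDerivAt (fun τ => g₁ τ * g₁ τ * g₂ τ * g₂ τ)
      (2 * (deriv g₁ t / g₁ t + deriv g₂ t / g₂ t) * (g₁ t * g₁ t * g₂ t * g₂ t)) t := by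
  refine (((h1.hasDerivAt.fun_mul h1.hasDerivAt).fun_mul h2.hasDerivAt).fun_mul
    h2.hasDerivAt).congr_deriv ?_
  field_simp
  ring

theorem hasDerivAt_mul_four {g₁ g₂ g₃ : ℝ → ℝ} {t : ℝ} (hf : DifferentiableAt ℝ f t)
    (h1 : DifferentiableAt ℝ g₁ t)
    (h2 : DifferentiableAt ℝ g₂ t) (h3 : DifferentiableAt ℝ g₃ t) (n : f t ≠ 0) (n1 : g₁ t ≠ 0)
    (n2 : g₂ t ≠ 0) (n3 : g₃ t ≠ 0) :
    HasDerivAt (fun τ => f τ * (g₁ τ * g₂ τ * g₃ τ))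
      ((deriv f t / f t + deriv g₁ t / g₁ t + deriv g₂ t / g₂ t + deriv g₃ t / g₃ t) *
        (f t * (g₁ t * g₂ t * g₃ t))) t := by
  refine (hf.hasDerivAt.fun_mul ((h1.hasDerivAt.fun_mul h2.hasDerivAt).fun_mul
    h3.hasDerivAt)).congr_deriv ?_
  field_simp
  ring

variable {M : Type*} [TopologicalSpace M] [ChartedSpace (EuclideanSpace ℝ (Fin 6)) M]

/-- With equal pairs the four coefficients of `fψ₊` coincide with `f f₁f₃f₅`, whose logarithmic
derivative is the left side of (4). The coefficients of `½ω²` are products of two squares such as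
`f₁²f₃²`, and their logarithmic derivatives are the right sides of (3). -/
theorem coframeEquations_iff_of_pairsAgree (hJopen : IsOpen J) (hp : PairsAgree J c)
    (hf : ∀ t ∈ J, DifferentiableAt ℝ f t) (hf0 : ∀ t ∈ J, f t ≠ 0)
    (hc : ∀ i, ∀ t ∈ J, DifferentiableAt ℝ (c i) t) (hne : ∀ i, ∀ t ∈ J, c i t ≠ 0)
    (h : Fin 6 → DForm (𝓡 6) M 1) :
    (∀ t ∈ J, CoframeEquations f h c t) ↔ CoefficientEquations J h c ∧ WarpingEquation J f c := by
  have hev : ∀ t ∈ J, ∀ᶠ τ in nhds t, c 1 τ = c 0 τ ∧ c 3 τ = c 2 τ ∧ c 5 τ = c 4 τ := fun t ht =>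
    Filter.mem_of_superset (hJopen.mem_nhds ht) hp
  have h3 : ∀ t ∈ J, ∀ a b d : Fin 6, (∀ τ ∈ J, c a τ * c b τ * c d τ = c 0 τ * c 2 τ * c 4 τ) →
      deriv (fun τ => f τ * diagCoeff c ![a, b, d] τ) t =
        (deriv f t / f t + deriv (c 0) t / c 0 t + deriv (c 2) t / c 2 t + deriv (c 4) t / c 4 t) *
          (f t * (c 0 t * c 2 t * c 4 t)) := by
    intro t ht a b d habd
    refine Eq.trans (Filter.EventuallyEq.deriv_eq ?_) (hasDerivAt_mul_four (hf t ht) (hc 0 t ht)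
      (hc 2 t ht) (hc 4 t ht) (hf0 t ht) (hne 0 t ht) (hne 2 t ht) (hne 4 t ht)).deriv
    filter_upwards [hJopen.mem_nhds ht] with τ hτ
    rw [diagCoeff_three, habd τ hτ]
  have h4 : ∀ t ∈ J, ∀ a a' b b' : Fin 6, (∀ τ ∈ J, c a' τ = c a τ) → (∀ τ ∈ J, c b' τ = c b τ) →
      deriv (diagCoeff c ![a, a', b, b']) t =
        2 * (deriv (c a) t / c a t + deriv (c b) t / c b t) * diagCoeff c ![a, a', b, b'] t := by
    intro t ht a a' b b' ha hb
    rw [diagCoeff_four, ha t ht, hb t ht]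
    refine Eq.trans (Filter.EventuallyEq.deriv_eq ?_) (hasDerivAt_sq_mul_sq (hc a t ht) (hc b t ht)
      (hne a t ht) (hne b t ht)).deriv
    filter_upwards [hJopen.mem_nhds ht] with τ hτ
    rw [diagCoeff_four, ha τ hτ, hb τ hτ]
  have h01 : ∀ τ ∈ J, c 1 τ = c 0 τ := fun τ hτ => (hp τ hτ).1
  have h23 : ∀ τ ∈ J, c 3 τ = c 2 τ := fun τ hτ => (hp τ hτ).2.1
  have h45 : ∀ τ ∈ J, c 5 τ = c 4 τ := fun τ hτ => (hp τ hτ).2.2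
  have hS : ∀ t ∈ J, CoframeEquations f h c t ↔
      (dStarNu3 (ansatz h c t) =
        (2 * (deriv (c 0) t / c 0 t + deriv (c 2) t / c 2 t)) • mono (ansatz h c t) ![0, 1, 2, 3] +
        (2 * (deriv (c 0) t / c 0 t + deriv (c 4) t / c 4 t)) • mono (ansatz h c t) ![0, 1, 4, 5] +
        (2 * (deriv (c 2) t / c 2 t + deriv (c 4) t / c 4 t)) •
          mono (ansatz h c t) ![2, 3, 4, 5]) ∧
      deriv f t / f t + deriv (c 0) t / c 0 t + deriv (c 2) t / c 2 t +
        deriv (c 4) t / c 4 t = 0 := by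
    intro t ht
    have hne' : f t * (c 0 t * c 2 t * c 4 t) ≠ 0 := mul_ne_zero (hf0 t ht)
      (mul_ne_zero (mul_ne_zero (hne 0 t ht) (hne 2 t ht)) (hne 4 t ht))
    -- All four conservation laws become the same equation, with a nonzero factor that can be
    -- dropped.
    rw [CoframeEquations, h3 t ht 0 2 4 fun τ _ => rfl,
      h3 t ht 0 3 5 fun τ hτ => by rw [h23 τ hτ, h45 τ hτ],
      h3 t ht 1 2 5 fun τ hτ => by rw [h01 τ hτ, h45 τ hτ],
      h3 t ht 1 3 4 fun τ hτ => by rw [h01 τ hτ, h23 τ hτ],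
      h4 t ht 0 1 2 3 h01 h23, h4 t ht 0 1 4 5 h01 h45, h4 t ht 2 3 4 5 h23 h45, and_self, and_self,
      and_self, mul_eq_zero_iff_right hne', and_comm]
    refine and_congr_left fun _ => ?_
    simp only [mono_ansatz]
    have hr : ∀ a b d x y z m₁ m₂ m₃ : ℝ, a * x * m₁ + b * y * m₂ + d * z * m₃ =
        a * (x * m₁) + b * (y * m₂) + d * (z * m₃) := by intros; ring
    constructor
    · intro h1
      funext p
      ext v
      exact (h1 p v).trans (hr _ _ _ _ _ _ _ _ _)
    · intro h1 p v
      rw [h1]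
      exact (hr _ _ _ _ _ _ _ _ _).symm
  constructor
  · intro H
    exact ⟨⟨_, _, _, fun t ht => ⟨((hS t ht).1 (H t ht)).1, rfl, rfl, rfl⟩⟩,
      fun t ht => ((hS t ht).1 (H t ht)).2⟩
  · rintro ⟨⟨B₁, B₂, B₃, hB⟩, hW⟩ t ht
    obtain ⟨e, e1, e2, e3⟩ := hB t ht
    rw [e1, e2, e3] at e
    exact (hS t ht).2 ⟨e, hW t ht⟩

end Coefficients

/-! ### Balancedness along the ansatz. -/

section Balanced

variable {M : Type*} [TopologicalSpace M] [ChartedSpace (EuclideanSpace ℝ (Fin 6)) M]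
  {h : Fin 6 → DForm (𝓡 6) M 1} {c : Fin 6 → ℝ → ℝ} {t : ℝ}

/-- Each monomial of `ψ₊` takes one index from each pair, so all of them are scaled by the same
factor; likewise for `ψ₋`. Closedness therefore persists from time 0. -/
theorem psiPlus_ansatz (h1 : c 1 t = c 0 t) (h2 : c 3 t = c 2 t) (h3 : c 5 t = c 4 t) :
    psiPlus (ansatz h c t) = (c 0 t * c 2 t * c 4 t) • psiPlus h := by
  simp only [psiPlus, mono_ansatz, diagCoeff_three, h1, h2, h3, smul_sub]

theorem psiMinus_ansatz (h1 : c 1 t = c 0 t) (h2 : c 3 t = c 2 t) (h3 : c 5 t = c 4 t) :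
    psiMinus (ansatz h c t) = (c 0 t * c 2 t * c 4 t) • psiMinus h := by
  simp only [psiMinus, mono_ansatz, diagCoeff_three, h1, h2, h3, smul_add, smul_neg]

variable [IsManifold (𝓡 6) 1 M]

theorem isBalanced_ansatz (hh : IsCoframe h) (hd : ∀ i p, (h i).DiffAt p) (hbal : IsBalanced h)
    (hc : ∀ i, c i t ≠ 0) (h1 : c 1 t = c 0 t) (h2 : c 3 t = c 2 t) (h3 : c 5 t = c 4 t)
    {f : ℝ} (hf : f ≠ 0) (hclosed : (starWarpedG2 f (ansatz h c t)).d = 0) :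
    IsBalanced (ansatz h c t) := by
  have hdt : ∀ i p, (ansatz h c t i).DiffAt p := diffAt_ansatz hd c t
  have hsmul : ∀ (a : ℝ) (k : ℕ), a • (0 : DForm (𝓡 6) M k) = 0 := fun a k => by
    funext p; ext v; exact mul_zero a
  have hp : (psiPlus (ansatz h c t)).d = 0 := by
    rw [psiPlus_ansatz h1 h2 h3, d_smul, hbal.2.1, hsmul]
  have hm : (psiMinus (ansatz h c t)).d = 0 := by
    rw [psiMinus_ansatz h1 h2 h3, d_smul, hbal.2.2, hsmul]
  have hω : (halfOmegaSq (ansatz h c t)).d = 0 :=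
    fromBase_eq_zero_iff.1 ((d_starWarpedG2 (hh.ansatz hc) hdt hf hp).symm.trans hclosed)
  exact ⟨⟨(d_halfOmegaSq_eq_zero_iff hdt).1 hω,
    d_omega_wedge_eq_zero hdt (fun p => diffAt_psiPlus fun i => hdt i p) hp (omega_wedge_psiPlus _),
    d_omega_wedge_eq_zero hdt (fun p => diffAt_psiMinus fun i => hdt i p) hm
      (omega_wedge_psiMinus _)⟩, hp, hm⟩

end Balanced

end

end WarpedG2

open WarpedG2 in
theorem mainTheorem10 {M : Type*} [TopologicalSpace M] [ChartedSpace (EuclideanSpace ℝ (Fin 6)) M]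
    [IsManifold (𝓡 6) ∞ M] [Nonempty M]
    (h : Fin 6 → DForm (𝓡 6) M 1) (hsmooth : ∀ i, (h i).IsSmooth) (hframe : IsCoframe h)
    (hbal : IsBalanced h)
    (J : Set ℝ) (hJopen : IsOpen J) (hJconn : J.OrdConnected) (hJ0 : (0 : ℝ) ∈ J)
    (f : ℝ → ℝ) (hfdiff : ∀ t ∈ J, DifferentiableAt ℝ f t) (hfne : ∀ t ∈ J, f t ≠ 0)
    (c : Fin 6 → ℝ → ℝ) (hcdiff : ∀ i, ∀ t ∈ J, DifferentiableAt ℝ (c i) t)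
    (hcne : ∀ i, ∀ t ∈ J, c i t ≠ 0) (hc0 : ∀ i, c i 0 = 1) :
    (PairsAgree J c →
      (SolvesLaplacianCoflow J f (ansatz h c) ↔
        CoefficientEquations J h c ∧ WarpingEquation J f c ∧
          ∀ t ∈ J, IsBalanced (ansatz h c t))) ∧
    ((∀ t ∈ J, IsBalanced (ansatz h c t)) →
      (SolvesLaplacianCoflow J f (ansatz h c) ↔ SolvesBalancedSystem J f (ansatz h c)) ∧
      (SolvesBalancedSystem J f (ansatz h c) ↔
        PairsAgree J c ∧ CoefficientEquations J h c ∧ WarpingEquation J f c)) := by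
  have : IsManifold (𝓡 6) 1 M := IsManifold.of_le (n := ∞) (by simp)
  have hd : ∀ i p, (h i).DiffAt p := fun i p => (hsmooth i).diffAt p
  have hcoflow := solvesLaplacianCoflow_iff hframe hd hJopen hfdiff hfne hcdiff hcne
  have hpairs := fun hp : PairsAgree J c =>
    coframeEquations_iff_of_pairsAgree hJopen hp hfdiff hfne hcdiff hcne h
  refine ⟨fun hp => ⟨fun H => ?_, fun ⟨hB, hW, hb⟩ => (hcoflow hb).2 ((hpairs hp).2 ⟨hB, hW⟩)⟩,
    fun hb => ⟨(hcoflow hb).trans (solvesBalancedSystem_iff hframe hfdiff hfne hcdiff).symm,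
      (solvesBalancedSystem_iff hframe hfdiff hfne hcdiff).trans ⟨fun H => ?_, fun ⟨hp, hBW⟩ =>
        (hpairs hp).2 hBW⟩⟩⟩
  -- Balancedness must come first, from the closedness half of the coflow alone, since the formula
  -- for the Laplacian depends on it.
  · have hb : ∀ t ∈ J, IsBalanced (ansatz h c t) := fun t ht =>
      isBalanced_ansatz hframe hd hbal (fun i => hcne i t ht) (hp t ht).1 (hp t ht).2.1
        (hp t ht).2.2 (hfne t ht) (H t ht).1
    obtain ⟨hB, hW⟩ := (hpairs hp).1 ((hcoflow hb).1 H)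
    exact ⟨hB, hW, hb⟩
  · have hp : PairsAgree J c := pairsAgree_of_deriv_eq_zero hJopen hJconn hJ0 hfdiff hfne hcdiff
      hcne hc0 fun t ht => (H t ht).1
    exact ⟨hp, (hpairs hp).1 H⟩
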